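/- **Theorem (support vector proliferation in bounded orthonormal systems).** *Setting.* Let $(X,\mu)$ be a probability space and $\mathcal H$ a reproducing kernel Hilbert space of real functions on $X$ with measurable kernel $k$ and $\mathcal H\subset L_2(\mu)$. Let $\mathcal T f(x)=\int k(x,y)f(y)\,d\mu(y)$ be its integral operator on $L_2(\mu)$, and let $v_1,v_2,\dots$ be a (finite or infinite) orthonormal basis of $L_2(\mu)$ of eigenfunctions, $\mathcal T v_\ell=\lambda_\ell v_\ell$ (as an identity between functions, at every point), with $\lambda_1\ge\lambda_2\ge\dots\ge 0$. Fix $p$ with $\lambda_1,\dots,\lambda_p>0$, let $G=\operatorname{span}(v_1,\dots,v_p)$ and $\mathcal T_G=\mathcal T|_G$. Assume the bounded orthonormal system condition: $\sum_{\ell=1}^p v_\ell(x)^2\le Cp$ for $\mu$-almost every $x$, where $C\ge 1$. Let $(x_1,y_1),\dots,(x_n,y_n)$, $n\ge 1$, be i.i.d. with $x_i\sim\mu$, $y_i\in\{-1,1\}$ and $\mathbb E[y_i\mid x_i]=\eta^*(x_i)$ for some $\eta^*\in G$. Let $\mathcal R:\mathcal H\to\mathbb R^n$, $\mathcal R f=\big((\mathcal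 P_{G^\perp}f)(x_i)\big)_{i}$, with $\mathcal P_{G^\perp}$ the orthogonal projection in $\mathcal H$ onto the complement of $G$, and let $\mathcal R^*$ be its adjoint. Let $\mathcal C_{\setminus i}:G\to\mathbb R^{n-1}$, $\mathcal C_{\setminus i}f=(f(x_j))_{j\ne i}$, with adjoint $\mathcal C_{\setminus i}^*$ for the $L_2(\mu)$ inner product on $G$. For fixed (non-random) numbers $\alpha_L,\alpha_U>0$ put $\bar\alpha=\frac{2\alpha_L\alpha_U}{\alpha_L+\alpha_U}$, $\bar{\mathcal S}=n\mathcal T_G(\bar\alpha\mathcal I_G+n\mathcal T_G)^{-1}$, $\bar{\mathcal B}=\mathcal I_G-\bar{\mathcal S}$ and $b=\|\bar{\mathcal B}\eta^*\|_{L_\infty(\mu)}$. *Claim.* For all $C\ge 1$ and $M>0$ there is a constant $c_0>0$, depending only on $C$ and $M$, such that the following holds in every setting as above. Let $0<\delta<1/2$ and $c\le 1/2$ be fixed numbers, let $b>0$, and suppose that with probability at least $1-\delta$ all of the following hold: 1. $\alpha_L I_n\preccurlyeq\mathcal R\mathcal R^*\preccurlyeq\alpha_U I_n$; 2. $\dfrac{\alpha_U-\alpha_L}{\alpha_U+\alpha_L}+\dfrac2n\big\|\mathcal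 C_{\setminus i}^*\mathcal C_{\setminus i}-n\mathcal I_G\big\|_{L_2\to L_2}\le c$ for every $i\in\{1,\dots,n\}$; 3. $b\le M\big(1-\|\bar{\mathcal S}\eta^*\|_{L_\infty(\mu)}\big)$. If $$\frac1b\sqrt{\frac{p\log n}{n}}+\frac{\alpha_U-\alpha_L}{\alpha_U+\alpha_L}\Big(\frac{\sqrt{\log n}}{b}+\sqrt n\Big)+c^2\sqrt p\le c_0,$$ then with probability at least $1-\delta-\frac2n$ the minimum-norm interpolation problem $$\min_{\eta\in\mathcal H}\|\eta\|_{\mathcal H}\quad\text{s.t. }\eta(x_i)=y_i\ \text{for all } i$$ and the hard-margin kernel SVM problem $$\min_{\eta\in\mathcal H}\|\eta\|_{\mathcal H}\quad\text{s.t. }y_i\eta(x_i)\ge1\ \text{for all } i$$ have one and the same unique solution $\hat\eta$; in particular every training point is a support vector, i.e. $\hat\eta(x_i)=\pm1$ for all $i$. -/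

import Mathlib

open MeasureTheory ProbabilityTheory Filter Topology
open scoped ENNReal

namespace SVP

noncomputable section

/-! ### The kernel and its integral operator -/

/-- The real-valued reproducing kernel `k(x, y) = ⟪k_x, k_y⟫` of a reproducing kernel Hilbert
space `H` of real-valued functions on `X`. -/
def ker {X : Type*} (H : Type*) [NormedAddCommGroup H] [InnerProductSpace ℝ H] [CompleteSpace H]
    [RKHS ℝ H X ℝ] (x y : X) : ℝ :=
  inner ℝ (RKHS.kerFun H x (1 : ℝ)) (RKHS.kerFun H y (1 : ℝ))

open scoped Classical in
/-- The kernel integral operator `T f (x) = ∫ k(x, y) f(y) dμ(y)` as a bounded operator on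
`L₂(μ)` (set to `0` when the formula does not define one; see `kernelOperator_spec`). -/
def kernelOperator {X : Type*} [MeasurableSpace X] (k : X → X → ℝ) (μ : Measure X) :
    Lp ℝ 2 μ →L[ℝ] Lp ℝ 2 μ :=
  if h : ∃ T : Lp ℝ 2 μ →L[ℝ] Lp ℝ 2 μ,
      ∀ f : Lp ℝ 2 μ, T f =ᵐ[μ] fun x => ∫ y, k x y * f y ∂μ
  then h.choose else 0

/-- If the functions of `H` are square integrable, the kernel integral operator of `H` is a
bounded operator on `L₂(μ)`, so that `kernelOperator` is given by its integral formula. -/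
theorem kernelOperator_spec {X : Type*} [MeasurableSpace X] {μ : Measure X}
    {H : Type*} [NormedAddCommGroup H] [InnerProductSpace ℝ H] [CompleteSpace H]
    [RKHS ℝ H X ℝ] (hH : ∀ f : H, MemLp (fun x => f x) 2 μ) (f : Lp ℝ 2 μ) :
    kernelOperator (ker H) μ f =ᵐ[μ] fun x => ∫ y, ker H x y * f y ∂μ := by
  have key : ∃ T : Lp ℝ 2 μ →L[ℝ] Lp ℝ 2 μ,
      ∀ f : Lp ℝ 2 μ, T f =ᵐ[μ] fun x => ∫ y, ker H x y * f y ∂μ := by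
    let J₀ : H →ₗ[ℝ] Lp ℝ 2 μ :=
      { toFun := fun f => (hH f).toLp _
        map_add' := fun f g => by
          rw [← MemLp.toLp_add]
          exact MemLp.toLp_congr _ _ (Eventually.of_forall fun x => by simp)
        map_smul' := fun c f => by
          rw [RingHom.id_apply, ← MemLp.toLp_const_smul]
          exact MemLp.toLp_congr _ _ (Eventually.of_forall fun x => by simp) }
    have hJ₀ : ∀ f : H, (J₀ f : X → ℝ) =ᵐ[μ] fun x => f x := fun f => (hH f).coeFn_toLp
    let J : H →L[ℝ] Lp ℝ 2 μ := ContinuousLinearMap.ofSeqClosedGraph (g := J₀) (by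
      intro u a g hu hg
      obtain ⟨ns, hns, hae⟩ := (tendstoInMeasure_of_tendsto_Lp hg).exists_seq_tendsto_ae
      have hall : ∀ᵐ x ∂μ, ∀ i, (J₀ (u i) : X → ℝ) x = u i x :=
        ae_all_iff.2 fun i => hJ₀ (u i)
      apply Lp.ext
      filter_upwards [hae, hall, hJ₀ a] with x h1 h2 h3
      rw [h3]
      refine tendsto_nhds_unique h1 ?_
      simp only [Function.comp, h2]
      exact ((RKHS.continuous_eval x).tendsto a).comp (hu.comp hns.tendsto_atTop))
    have hJ : ∀ f : H, (J f : X → ℝ) =ᵐ[μ] fun x => f x := fun f => hJ₀ f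
    refine ⟨J ∘L J.adjoint, fun f => ?_⟩
    have h1 := hJ (J.adjoint f)
    filter_upwards [h1] with x hx
    rw [ContinuousLinearMap.comp_apply, hx]
    have h2 : (J.adjoint f) x = inner ℝ (RKHS.kerFun H x (1 : ℝ)) (J.adjoint f) := by simp
    rw [h2, ContinuousLinearMap.adjoint_inner_right, L2.inner_def]
    refine integral_congr_ae ?_
    filter_upwards [hJ (RKHS.kerFun H x (1 : ℝ))] with y hy
    rw [hy]
    simp [ker, mul_comm]
  unfold kernelOperator
  rw [dif_pos key]
  exact key.choose_spec f

/-- An orthonormal basis `v_0, v_1, …` of `L₂(μ)` consisting of eigenfunctions of the kernel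
integral operator, with the eigenvalues `lam` in decreasing order. The basis has `N` elements;
`N = ⊤` when `L₂(μ)` is infinite dimensional, and if `N` is finite then `v ℓ` and `lam ℓ` play no
role for `ℓ ≥ N`. Eigenfunctions are functions, not classes: the eigenvalue equation
holds at every point. -/
structure EigenSystem {X : Type*} [MeasurableSpace X] (k : X → X → ℝ) (μ : Measure X) where
  N : ℕ∞
  lam : ℕ → ℝ
  v : ℕ → X → ℝ
  memLp : ∀ ℓ, MemLp (v ℓ) 2 μ
  orthonormal : ∀ ℓ m : ℕ, (ℓ : ℕ∞) < N → (m : ℕ∞) < N →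
    ∫ x, v ℓ x * v m x ∂μ = if ℓ = m then 1 else 0
  complete : ∀ f : X → ℝ, MemLp f 2 μ →
    (∀ ℓ : ℕ, (ℓ : ℕ∞) < N → ∫ x, f x * v ℓ x ∂μ = 0) → f =ᵐ[μ] 0
  eigen : ∀ ℓ : ℕ, (ℓ : ℕ∞) < N → ∀ x, ∫ y, k x y * v ℓ y ∂μ = lam ℓ * v ℓ x
  nonneg : ∀ ℓ : ℕ, (ℓ : ℕ∞) < N → 0 ≤ lam ℓ
  sorted : ∀ ℓ m : ℕ, ℓ ≤ m → (m : ℕ∞) < N → lam m ≤ lam ℓ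

section Operators

variable {X : Type*} [MeasurableSpace X] {k : X → X → ℝ} {μ : Measure X}

/-- The eigenfunction `v_ℓ` as an element of `L₂(μ)`. -/
def EigenSystem.vL (S : EigenSystem k μ) (ℓ : ℕ) : Lp ℝ 2 μ := (S.memLp ℓ).toLp (S.v ℓ)

/-- `G`, the span of the leading `p` eigenfunctions in `L₂(μ)`. -/
def EigenSystem.G (S : EigenSystem k μ) (p : ℕ) : Submodule ℝ (Lp ℝ 2 μ) :=
  Submodule.span ℝ (S.vL '' Set.Iio p)

instance EigenSystem.finiteDimensional_G (S : EigenSystem k μ) (p : ℕ) :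
    FiniteDimensional ℝ (S.G p) :=
  FiniteDimensional.span_of_finite ℝ ((Set.finite_Iio p).image _)

/-- `T_G = T P_G`, the kernel integral operator restricted to `G`. -/
def EigenSystem.TG (S : EigenSystem k μ) (p : ℕ) : Lp ℝ 2 μ →L[ℝ] Lp ℝ 2 μ :=
  kernelOperator k μ ∘L (S.G p).starProjection

/-- The idealized survival operator `n T_G (a I + n T_G)⁻¹`. It is used on `G` only; since `T_G`
leaves `G` invariant and vanishes on its orthogonal complement, inverting on `L₂(μ)` or on `G`
is the same there. -/
def EigenSystem.survival (S : EigenSystem k μ) (p n : ℕ) (a : ℝ) :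
    Lp ℝ 2 μ →L[ℝ] Lp ℝ 2 μ :=
  ((n : ℝ) • S.TG p) * Ring.inverse (a • 1 + (n : ℝ) • S.TG p)

/-- The idealized bias operator `I_G - n T_G (a I + n T_G)⁻¹`, used on `G` only. -/
def EigenSystem.bias (S : EigenSystem k μ) (p n : ℕ) (a : ℝ) : Lp ℝ 2 μ →L[ℝ] Lp ℝ 2 μ :=
  1 - S.survival p n a

/-- The `L_∞(μ)` norm (essential supremum of the absolute value). -/
def supNorm (f : Lp ℝ 2 μ) : ℝ := (eLpNorm f ∞ μ).toReal

/-- The sampling operator `C` on `G` with the `L₂(μ)` inner product, extended by `0` on the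
orthogonal complement of `G`: the element `g = ∑ ⟪v_ℓ, f⟫ v_ℓ` of `G` is sent to `(g (x_i))_i`. -/
def EigenSystem.C (S : EigenSystem k μ) (p : ℕ) {ι : Type*} [Fintype ι] (x : ι → X) :
    Lp ℝ 2 μ →L[ℝ] EuclideanSpace ℝ ι :=
  ∑ ℓ ∈ Finset.range p,
    (innerSL ℝ (S.vL ℓ)).smulRight (WithLp.toLp 2 fun i => S.v ℓ (x i))

end Operators

section Sampling

variable {X : Type*} {H : Type*} [NormedAddCommGroup H] [InnerProductSpace ℝ H] [RKHS ℝ H X ℝ]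

/-- The sampling operator `A : H → ℝⁿ`, `(A f)_i = f (x_i)`. -/
def A (H : Type*) [NormedAddCommGroup H] [InnerProductSpace ℝ H] [RKHS ℝ H X ℝ]
    {n : ℕ} (x : Fin n → X) : H →L[ℝ] EuclideanSpace ℝ (Fin n) :=
  (EuclideanSpace.equiv (Fin n) ℝ).symm.toContinuousLinearMap ∘L
    ContinuousLinearMap.pi fun i => (ContinuousLinearMap.proj (x i)) ∘L RKHS.coeCLM ℝ

/-- The functions in `H` that are linear combinations of `v_0, …, v_{p-1}`: the leading
eigenspace `G` as a subspace of `H`. -/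
def GH (H : Type*) [NormedAddCommGroup H] [InnerProductSpace ℝ H] [RKHS ℝ H X ℝ]
    (v : ℕ → X → ℝ) (p : ℕ) : Submodule ℝ H :=
  (Submodule.span ℝ (v '' Set.Iio p)).comap (RKHS.coeCLM ℝ : H →L[ℝ] X → ℝ).toLinearMap

instance finiteDimensional_GH (v : ℕ → X → ℝ) (p : ℕ) : FiniteDimensional ℝ (GH H v p) := by
  have : FiniteDimensional ℝ (Submodule.span ℝ (v '' Set.Iio p)) :=
    FiniteDimensional.span_of_finite ℝ ((Set.finite_Iio p).image _)
  refine FiniteDimensional.of_injective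
    (((RKHS.coeCLM ℝ : H →L[ℝ] X → ℝ).toLinearMap.restrict
      (p := GH H v p) (q := Submodule.span ℝ (v '' Set.Iio p)) fun f hf => hf)) ?_
  intro f g h
  exact Subtype.ext (RKHS.coeCLM_injective (congrArg Subtype.val h))

/-- The residual sampling operator `R = A P_{G^⊥}` on `H`. -/
def R (H : Type*) [NormedAddCommGroup H] [InnerProductSpace ℝ H] [RKHS ℝ H X ℝ]
    (v : ℕ → X → ℝ) (p : ℕ) {n : ℕ} (x : Fin n → X) : H →L[ℝ] EuclideanSpace ℝ (Fin n) :=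
  A H x ∘L (GH H v p)ᗮ.starProjection

/-- `f` solves the minimum-norm interpolation problem: it has the least norm among all functions
of `H` with `f (x_i) = y_i` for all `i`. -/
def IsMNI {n : ℕ} (x : Fin n → X) (y : Fin n → ℝ) (f : H) : Prop :=
  (∀ i, f (x i) = y i) ∧ ∀ g : H, (∀ i, g (x i) = y i) → ‖f‖ ≤ ‖g‖

/-- `f` solves the hard-margin support vector machine problem: it has the least norm among all
functions of `H` with `y_i f (x_i) ≥ 1` for all `i`. -/
def IsSVM {n : ℕ} (x : Fin n → X) (y : Fin n → ℝ) (f : H) : Prop :=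
  (∀ i, 1 ≤ y i * f (x i)) ∧ ∀ g : H, (∀ i, 1 ≤ y i * g (x i)) → ‖f‖ ≤ ‖g‖

/-- The point `x` is a support vector of `f` when it lies on the margin, `f x = ±1`. -/
def IsSupportVector (f : H) (x : X) : Prop := f x = 1 ∨ f x = -1

/-- Support vector proliferation: interpolation and support vector machine have the same
unique solution, and every training point is a support vector of it. -/
def Proliferation (H : Type*) [NormedAddCommGroup H] [InnerProductSpace ℝ H] [RKHS ℝ H X ℝ]
    {n : ℕ} (x : Fin n → X) (y : Fin n → ℝ) : Prop :=
  ∃ f : H, (∀ g : H, IsMNI x y g ↔ g = f) ∧ (∀ g : H, IsSVM x y g ↔ g = f) ∧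
    ∀ i, IsSupportVector f (x i)

end Sampling

/-- The harmonic mean of two positive numbers. -/
def harmonicMean (a b : ℝ) : ℝ := 2 * a * b / (a + b)

/-- The requirements on the training points `x_1, …, x_n`: concentration of the residual Gram
matrix `R R*`, concentration of the leave-one-out covariances on `G`, and `L_∞` control of the
idealized recovered signal, with `M` the constant hidden in the last inequality. -/
structure GoodSample {X : Type*} [MeasurableSpace X] {μ : Measure X}
    {H : Type*} [NormedAddCommGroup H] [InnerProductSpace ℝ H] [CompleteSpace H] [RKHS ℝ H X ℝ]
    (S : EigenSystem (ker H) μ) (p : ℕ) (η : Lp ℝ 2 μ) (αL αU c M : ℝ)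
    {n : ℕ} (x : Fin n → X) : Prop where
  gram_lower : αL • (1 : EuclideanSpace ℝ (Fin n) →L[ℝ] EuclideanSpace ℝ (Fin n)) ≤
    R H S.v p x ∘L (R H S.v p x).adjoint
  gram_upper : R H S.v p x ∘L (R H S.v p x).adjoint ≤
    αU • (1 : EuclideanSpace ℝ (Fin n) →L[ℝ] EuclideanSpace ℝ (Fin n))
  covariance : ∀ i : Fin n, (αU - αL) / (αU + αL) + 2 / n *
    ‖(S.C p fun j : {j // j ≠ i} => x j).adjoint ∘L (S.C p fun j : {j // j ≠ i} => x j)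
      - (n : ℝ) • (S.G p).starProjection‖ ≤ c
  signal : supNorm (S.bias p n (harmonicMean αL αU) η) ≤
    M * (1 - supNorm (S.survival p n (harmonicMean αL αU) η))

/-- `(x_1, y_1), …, (x_n, y_n)` is an i.i.d. sample of labelled points with `x_i ∼ μ`,
`y_i ∈ {-1, 1}` and `E[y_i | x_i] = η(x_i)`. -/
structure IsLabelledSample {X : Type*} [MeasurableSpace X] {Ω : Type*} [MeasurableSpace Ω]
    (μ : Measure X) (η : X → ℝ) (P : Measure Ω) {n : ℕ}
    (x : Fin n → Ω → X) (y : Fin n → Ω → ℝ) : Prop where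
  measurable_x : ∀ i, Measurable (x i)
  measurable_y : ∀ i, Measurable (y i)
  indep : iIndepFun (fun i ω => (x i ω, y i ω)) P
  law_x : ∀ i, P.map (x i) = μ
  labels : ∀ i ω, y i ω = 1 ∨ y i ω = -1
  regression : ∀ i, P[y i | MeasurableSpace.comap (x i) inferInstance] =ᵐ[P] fun ω => η (x i ω)

end

end SVP

/-! The minimum-norm interpolant also solves the SVM problem as soon as its dual coefficients `β`
satisfy `y_i β_i ≥ 0` (`proliferation_of_dual_nonneg`), and this sign condition holds at `i` if the
interpolant of the other points has margin below one at `x_i` (`dual_sign_of_leaveOneOut`). It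
therefore suffices that every leave-one-out prediction has absolute value below one. The prediction
is linear in the labels, with weights `looWeight` that depend on the positions only, so it splits
into a signal part (labels replaced by `η*(x_j)`) and a noise part. Write `ρ = (αU - αL) / (αU +
αL)` and `m` for the harmonic mean of `αL`, `αU`.

Signal. By `ker_eq` the kernel matrix is `Φ Λ Φᵗ + Q`, with `Φ` the sampling of `G` and `Q` the
residual Gram matrix, where `Q ≈ m I` and `Φᵗ Φ ≈ n I`. If `w` solves `(Φ Λ Φᵗ + Q) w = Φ f`, the
bias `g = f - Λ Φᵗ w` satisfies `Q w = Φ g`, so `(m / n) Φᵗ w ≈ g` and `g` is close to the idealized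
bias `k`. Evaluation at `x_i` costs a factor `‖u‖ ≤ √(C p)`, too much for an error of relative size
`c`. Hence the error is expanded once more: `abs_inner_bias_sub_le` leaves a remainder of order `c²
+ ρ`, and the first order term is a sum over points independent of `x_i`, which Bernstein's method
controls (`measure_covariance_ge_le`).

Noise. Given the positions, the noise is sub-Gaussian at scale `‖looWeight‖`, which is of order `√(p
/ n) + ρ` (`norm_looWeight_le`).

All errors are small multiples of `b`, while the hypothesis on the recovered signal leaves room `b /
M` below one. Two tail events per point, each of probability at most `1 / n²`, add up to the loss `2
/ n`. -/

namespace SVP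

/-! ### Symmetric operators with two-sided quadratic form bounds -/

section Quadratic

variable {W : Type*} [NormedAddCommGroup W] [InnerProductSpace ℝ W]

/-- Polarization: rescale `T x` to a vector `y` of length `‖x‖`, apply the quadratic bound to `x +
y` and `x - y`, and subtract. The parallelogram law gives the constant, so no spectral theorem is
needed. -/
theorem norm_le_of_abs_inner_self_le {T : W →ₗ[ℝ] W} (hT : T.IsSymmetric) {d : ℝ}
    (h : ∀ x, |inner ℝ x (T x)| ≤ d * ‖x‖ ^ 2) (x : W) : ‖T x‖ ≤ d * ‖x‖ := by
  by_cases h0 : T x = 0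
  · by_cases hx : x = 0
    · simp [hx]
    · have h1 := h x
      rw [h0, inner_zero_right, abs_zero] at h1
      have h2 : 0 < ‖x‖ := norm_pos_iff.2 hx
      rw [h0, norm_zero]
      nlinarith
  have hx : x ≠ 0 := fun hx => h0 (by rw [hx, map_zero])
  have h1 : 0 < ‖x‖ := norm_pos_iff.2 hx
  have h2 : 0 < ‖T x‖ := norm_pos_iff.2 h0
  set y : W := (‖x‖ / ‖T x‖) • T x with hy
  have hny : ‖y‖ = ‖x‖ := by
    rw [hy, norm_smul, Real.norm_eq_abs, abs_of_pos (by positivity)]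
    field_simp
  have hin : inner ℝ y (T x) = ‖x‖ * ‖T x‖ := by
    rw [hy, real_inner_smul_left, real_inner_self_eq_norm_sq]
    field_simp
  have hsym : inner ℝ x (T y) = inner ℝ y (T x) := by
    rw [← hT x y, real_inner_comm]
  have ha := (abs_le.1 (h (x + y))).2
  have hb := (abs_le.1 (h (x - y))).1
  have hpar := parallelogram_law_with_norm ℝ x y
  simp only [map_add, map_sub, inner_add_left, inner_add_right, inner_sub_left,
    inner_sub_right] at ha hb
  have : 4 * (‖x‖ * ‖T x‖) ≤ 4 * (d * ‖x‖) * ‖x‖ := by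
    have e : d * (‖x + y‖ ^ 2 + ‖x - y‖ ^ 2) = 4 * (d * ‖x‖) * ‖x‖ := by
      have : ‖x + y‖ ^ 2 + ‖x - y‖ ^ 2 = 4 * ‖x‖ ^ 2 := by
        rw [hny] at hpar; nlinarith
      rw [this]; ring
    nlinarith
  nlinarith

variable {Q : W →ₗ[ℝ] W} {a b : ℝ}

theorem norm_sub_midpoint_le (hQ : Q.IsSymmetric) (hl : ∀ x, a * ‖x‖ ^ 2 ≤ inner ℝ x (Q x))
    (hu : ∀ x, inner ℝ x (Q x) ≤ b * ‖x‖ ^ 2) (x : W) :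
    ‖Q x - ((a + b) / 2) • x‖ ≤ (b - a) / 2 * ‖x‖ := by
  have hs : (Q - ((a + b) / 2) • LinearMap.id).IsSymmetric := by
    intro x y
    simp [inner_sub_left, inner_sub_right, real_inner_smul_left, real_inner_smul_right, hQ x y]
  refine norm_le_of_abs_inner_self_le (T := Q - ((a + b) / 2) • LinearMap.id) hs (fun x => ?_) x
  have h1 := hl x
  have h2 := hu x
  simp only [LinearMap.sub_apply, LinearMap.smul_apply, LinearMap.id_apply, inner_sub_right,
    real_inner_smul_right, real_inner_self_eq_norm_sq]
  rw [abs_le]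
  constructor <;> linarith

theorem lower_norm_le (hl : ∀ x, a * ‖x‖ ^ 2 ≤ inner ℝ x (Q x)) (x : W) :
    a * ‖x‖ ≤ ‖Q x‖ := by
  by_cases hx : x = 0
  · simp [hx]
  have h1 : 0 < ‖x‖ := norm_pos_iff.2 hx
  have h2 := (hl x).trans (real_inner_le_norm x (Q x))
  nlinarith

/-- The spectrum of `Q⁻¹` lies in `[1/b, 1/a]`, an interval with midpoint the inverse harmonic mean
and half-length `(b - a) / (2 a b)`, which is the constant here. Stating it through `Q x` avoids the
inverse. -/
theorem norm_sub_inv_harmonicMean_smul_le (ha : 0 < a) (hab : a ≤ b) (hQ : Q.IsSymmetric)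
    (hl : ∀ x, a * ‖x‖ ^ 2 ≤ inner ℝ x (Q x))
    (hu : ∀ x, inner ℝ x (Q x) ≤ b * ‖x‖ ^ 2) (x : W) :
    ‖x - (harmonicMean a b)⁻¹ • Q x‖ ≤ (b - a) / (b + a) / harmonicMean a b * ‖Q x‖ := by
  have hb : 0 < b := ha.trans_le hab
  have hm : 0 < harmonicMean a b := by unfold harmonicMean; positivity
  have h1 := norm_sub_midpoint_le hQ hl hu x
  have h2 : ‖Q x - ((a + b) / 2) • x‖ ^ 2 ≤ ((b - a) / 2 * ‖x‖) ^ 2 := by gcongr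
  rw [norm_sub_sq_real, norm_smul, mul_pow, real_inner_smul_right, Real.norm_eq_abs, sq_abs] at h2
  have hr : 0 ≤ (b - a) / (b + a) / harmonicMean a b := by
    have : 0 ≤ b - a := sub_nonneg.2 hab
    positivity
  refine abs_le_of_sq_le_sq' ?_ (by positivity) |>.2
  rw [norm_sub_sq_real, norm_smul, mul_pow, real_inner_smul_right, Real.norm_eq_abs, sq_abs,
    real_inner_comm]
  -- The squared midpoint bound `h2` rearranged: it expresses `(Q - a)(b - Q) ≥ 0`.
  have h3 : ‖x‖ ^ 2 ≤ ((a + b) * inner ℝ (Q x) x - ‖Q x‖ ^ 2) / (a * b) := by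
    rw [le_div_iff₀ (by positivity)]
    nlinarith
  have e : ((a + b) * inner ℝ (Q x) x - ‖Q x‖ ^ 2) / (a * b)
      - 2 * ((harmonicMean a b)⁻¹ * inner ℝ (Q x) x) + (harmonicMean a b)⁻¹ ^ 2 * ‖Q x‖ ^ 2
      = ((b - a) / (b + a) / harmonicMean a b * ‖Q x‖) ^ 2 := by
    unfold harmonicMean
    field_simp
    ring
  linarith

end Quadratic

/-- Sampling operator `Φ` with transpose `Φt`, residual Gram operator `Q`, normalized kernel
operator `N = (n / a) T` and survival operator `Sv = N (1 + N)⁻¹`, together with the concentration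
bounds for `Q` and `Φt Φ`. -/
structure IsRidgeSystem {V W : Type*} [NormedAddCommGroup V] [InnerProductSpace ℝ V]
    [NormedAddCommGroup W] [InnerProductSpace ℝ W] (Φ : V →ₗ[ℝ] W) (Φt : W →ₗ[ℝ] V)
    (Q : W →ₗ[ℝ] W) (N Sv : V →ₗ[ℝ] V) (n a b c : ℝ) : Prop where
  adj : ∀ f w, inner ℝ (Φ f) w = inner ℝ f (Φt w)
  symm : Q.IsSymmetric
  lower : ∀ w, a * ‖w‖ ^ 2 ≤ inner ℝ w (Q w)
  upper : ∀ w, inner ℝ w (Q w) ≤ b * ‖w‖ ^ 2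
  cov : ∀ f, ‖n⁻¹ • (Φt (Φ f) - n • f)‖ ≤ (c - (b - a) / (b + a)) / 2 * ‖f‖
  surv : ∀ f, Sv (f + N f) = N f
  surv_norm : ∀ f, ‖Sv f‖ ≤ ‖f‖
  surv_symm : Sv.IsSymmetric
  n_pos : 0 < n
  a_pos : 0 < a
  a_le : a ≤ b
  c_le : c ≤ 1 / 2
  rho_le : (b - a) / (b + a) ≤ c

/-! ### Deterministic perturbation of noiseless kernel regression -/

namespace IsRidgeSystem

variable {V W : Type*} [NormedAddCommGroup V] [InnerProductSpace ℝ V]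
    [NormedAddCommGroup W] [InnerProductSpace ℝ W] {Φ : V →ₗ[ℝ] W} {Φt : W →ₗ[ℝ] V}
    {Q : W →ₗ[ℝ] W} {N Sv : V →ₗ[ℝ] V} {n a b c : ℝ}

section
variable (h : IsRidgeSystem Φ Φt Q N Sv n a b c)
include h

theorem harmonicMean_pos : 0 < harmonicMean a b := by
  have := h.a_pos
  have := h.a_pos.trans_le h.a_le
  unfold harmonicMean; positivity

theorem rho_nonneg : 0 ≤ (b - a) / (b + a) := by
  have := h.a_pos
  have := h.a_le
  exact div_nonneg (by linarith) (by linarith)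

theorem norm_map_sq_le (f : V) :
    ‖Φ f‖ ^ 2 ≤ n * (1 + (c - (b - a) / (b + a)) / 2) * ‖f‖ ^ 2 := by
  have hn := h.n_pos
  have e : Φt (Φ f) = n • (n⁻¹ • (Φt (Φ f) - n • f)) + n • f := by
    rw [smul_smul, mul_inv_cancel₀ hn.ne', one_smul]; abel
  have h1 := (real_inner_le_norm f (n⁻¹ • (Φt (Φ f) - n • f))).trans
    (mul_le_mul_of_nonneg_left (h.cov f) (norm_nonneg f))
  rw [← real_inner_self_eq_norm_sq, h.adj, e, inner_add_right, real_inner_smul_right _ _ n,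
    real_inner_smul_right _ _ n, real_inner_self_eq_norm_sq]
  have h2 := mul_le_mul_of_nonneg_left h1 hn.le
  linarith

theorem spread_nonneg : 0 ≤ n * (1 + (c - (b - a) / (b + a)) / 2) := by
  have := h.rho_le
  have := h.n_pos
  exact mul_nonneg h.n_pos.le (by linarith)

theorem norm_map_le (f : V) :
    ‖Φ f‖ ≤ √(n * (1 + (c - (b - a) / (b + a)) / 2)) * ‖f‖ := by
  have h1 := h.norm_map_sq_le f
  have h2 := h.spread_nonneg
  refine abs_le_of_sq_le_sq' ?_ (by positivity) |>.2
  rwa [mul_pow, Real.sq_sqrt h2]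

theorem norm_adj_le (w : W) :
    ‖Φt w‖ ≤ √(n * (1 + (c - (b - a) / (b + a)) / 2)) * ‖w‖ := by
  by_cases h0 : Φt w = 0
  · rw [h0, norm_zero]; positivity
  have h1 : 0 < ‖Φt w‖ := norm_pos_iff.2 h0
  have h2 : ‖Φt w‖ * ‖Φt w‖ ≤ ‖Φ (Φt w)‖ * ‖w‖ := by
    rw [← real_inner_self_eq_norm_mul_norm, ← h.adj]
    exact real_inner_le_norm _ _
  have h3 := h.norm_map_le (Φt w)
  have h4 := mul_le_mul_of_nonneg_right h3 (norm_nonneg w)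
  nlinarith

/-- Since `c ≤ 1/2`, the spread factor is at most `5/4`, and `5/4 ≤ (9/8)²`. -/
theorem sqrt_spread_le : √(n * (1 + (c - (b - a) / (b + a)) / 2)) ≤ 9 / 8 * √n := by
  have h1 := h.rho_nonneg
  have h2 := h.c_le
  have hn := h.n_pos
  rw [show (9 / 8 : ℝ) * √n = √(n * (9 / 8) ^ 2) by
    rw [Real.sqrt_mul hn.le, Real.sqrt_sq (by norm_num)]; ring]
  apply Real.sqrt_le_sqrt
  gcongr
  linarith

/-- Replacing `w` by `m⁻¹ Q w = m⁻¹ Φ g` turns `(m / n) Φᵗ w` into `n⁻¹ Φᵗ Φ g`. What remains is the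
relative error `ρ` of `Q⁻¹ ≈ m⁻¹`, with one factor of the sampling norm from each of `Φ` and `Φᵗ`.
-/
theorem norm_covariance_error_le {w : W} {g : V} (hw : Q w = Φ g) :
    ‖(harmonicMean a b / n) • Φt w - g - n⁻¹ • (Φt (Φ g) - n • g)‖
      ≤ (b - a) / (b + a) * (1 + (c - (b - a) / (b + a)) / 2) * ‖g‖ := by
  have hn := h.n_pos
  have hm := h.harmonicMean_pos
  have e : (harmonicMean a b / n) • Φt w - g - n⁻¹ • (Φt (Φ g) - n • g)
      = (harmonicMean a b / n) • Φt (w - (harmonicMean a b)⁻¹ • Q w) := by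
    rw [hw, map_sub, map_smul, smul_sub, smul_sub, smul_smul, smul_smul, inv_mul_cancel₀ hn.ne',
      one_smul, show harmonicMean a b / n * (harmonicMean a b)⁻¹ = n⁻¹ by field_simp]
    abel
  have h1 := norm_sub_inv_harmonicMean_smul_le h.a_pos h.a_le h.symm h.lower h.upper w
  have h2 := h.norm_adj_le (w - (harmonicMean a b)⁻¹ • Q w)
  have h3 := h.norm_map_le g
  have h4 := h.rho_nonneg
  rw [e, norm_smul, Real.norm_eq_abs, abs_of_pos (by positivity)]
  rw [hw] at h1 h2 ⊢
  calc _ ≤ harmonicMean a b / n * (√(n * (1 + (c - (b - a) / (b + a)) / 2)) *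
        ((b - a) / (b + a) / harmonicMean a b *
          (√(n * (1 + (c - (b - a) / (b + a)) / 2)) * ‖g‖))) := by
        refine mul_le_mul_of_nonneg_left (h2.trans ?_) (by positivity)
        refine mul_le_mul_of_nonneg_left (h1.trans ?_) (by positivity)
        exact mul_le_mul_of_nonneg_left h3 (by positivity)
    _ = (b - a) / (b + a) / n * √(n * (1 + (c - (b - a) / (b + a)) / 2)) ^ 2 * ‖g‖ := by
        field_simp
    _ = _ := by rw [Real.sq_sqrt h.spread_nonneg]; field_simp

theorem norm_covariance_error_le' {w : W} {g : V} (hw : Q w = Φ g) :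
    ‖(harmonicMean a b / n) • Φt w - g‖ ≤ c * ‖g‖ := by
  have h1 := h.norm_covariance_error_le hw
  have h2 := h.cov g
  have h3 := norm_add_le ((harmonicMean a b / n) • Φt w - g - n⁻¹ • (Φt (Φ g) - n • g))
    (n⁻¹ • (Φt (Φ g) - n • g))
  rw [sub_add_cancel] at h3
  have h4 := h.rho_nonneg
  have h5 := h.rho_le
  have h6 := h.c_le
  have h7 := norm_nonneg g
  -- With `e = c - ρ ≥ 0` this amounts to `ρ e ≤ e`: the factor two in front of the covariance
  -- deviation leaves room for the cross term.
  have : (b - a) / (b + a) * (1 + (c - (b - a) / (b + a)) / 2) + (c - (b - a) / (b + a)) / 2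
      ≤ c := by nlinarith
  nlinarith

/-- The smoothing error `g` of ridge regression on the noiseless data `Φ f` satisfies
`g = h - Sv δ` with `h` the idealized bias and `δ` the covariance error at `g`. -/
theorem bias_eq {w : W} {f g k : V}
    (hg : g + N ((harmonicMean a b / n) • Φt w) = f) (hk : k + N k = f) :
    g = k - Sv ((harmonicMean a b / n) • Φt w - g) := by
  set z := (harmonicMean a b / n) • Φt w with hz
  have h1 : Sv ((z - k) + N (z - k)) = N (z - k) := h.surv _
  have h2 : (z - k) + N (z - k) = z - g := by
    rw [map_sub, sub_add_sub_comm, hk, ← hg]; abel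
  have h3 : N (z - k) = k - g := by
    rw [map_sub, sub_eq_sub_iff_add_eq_add, add_comm (N z), hg, hk]
  rw [← h2, h1, h3]; abel

/-- In `g = k - Sv δ` the error satisfies `‖δ‖ ≤ c ‖g‖ ≤ ‖g‖ / 2` and `Sv` is a contraction, so `g`
is absorbed on the left. -/
theorem norm_bias_le {w : W} {f g k : V} (hw : Q w = Φ g)
    (hg : g + N ((harmonicMean a b / n) • Φt w) = f) (hk : k + N k = f) :
    ‖g‖ ≤ 2 * ‖k‖ := by
  have h1 := h.bias_eq hg hk
  have h2 := h.norm_covariance_error_le' hw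
  have h3 := h.surv_norm ((harmonicMean a b / n) • Φt w - g)
  have h4 := norm_sub_le k (Sv ((harmonicMean a b / n) • Φt w - g))
  rw [← h1] at h4
  have h5 := h.c_le
  have h6 := norm_nonneg g
  nlinarith

/-- With `D = n⁻¹ Φᵗ Φ - 1`, the identity `g = k - Sv δ` is iterated: `δ ≈ D g = D k - D (Sv δ)`.
The last term is of order `c²` and the approximation costs order `ρ`. The term with `D k` stays
explicit, because its operator norm bound is only of order `c`; it is treated probabilistically. -/
theorem abs_inner_bias_sub_le {w : W} {f g k : V} (hw : Q w = Φ g)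
    (hg : g + N ((harmonicMean a b / n) • Φt w) = f) (hk : k + N k = f) (u : V) :
    |inner ℝ u g - inner ℝ u k + inner ℝ (Sv u) (n⁻¹ • (Φt (Φ k) - n • k))|
      ≤ ‖u‖ * ((2 * c ^ 2 + 5 / 2 * ((b - a) / (b + a))) * ‖k‖) := by
  set ρ := (b - a) / (b + a) with hρ
  set D : V →ₗ[ℝ] V := n⁻¹ • (Φt ∘ₗ Φ - n • LinearMap.id) with hD
  have hDa : ∀ v, D v = n⁻¹ • (Φt (Φ v) - n • v) := fun v => by simp [hD]
  set δ := (harmonicMean a b / n) • Φt w - g with hδ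
  have h1 : g = k - Sv δ := h.bias_eq hg hk
  have h2 : ‖δ - D g‖ ≤ ρ * (1 + (c - ρ) / 2) * ‖g‖ := by
    rw [hDa]; exact h.norm_covariance_error_le hw
  have h3 : ‖δ‖ ≤ c * ‖g‖ := h.norm_covariance_error_le' hw
  have h4 : ‖g‖ ≤ 2 * ‖k‖ := h.norm_bias_le hw hg hk
  have h5 : ‖D (Sv δ)‖ ≤ (c - ρ) / 2 * ‖Sv δ‖ := by rw [hDa]; exact h.cov _
  have h6 := h.surv_norm δ
  have hρ0 : 0 ≤ ρ := h.rho_nonneg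
  have hρc : ρ ≤ c := h.rho_le
  have hc := h.c_le
  have hk0 := norm_nonneg k
  have e : inner ℝ u g - inner ℝ u k + inner ℝ (Sv u) (n⁻¹ • (Φt (Φ k) - n • k))
      = - inner ℝ (Sv u) (δ - D g - D (Sv δ)) := by
    rw [← hDa, h.surv_symm, h.surv_symm, ← inner_sub_right, ← inner_add_right, ← inner_neg_right]
    congr 1
    have : D g = D k - D (Sv δ) := by rw [← map_sub, ← h1]
    rw [this]
    simp only [map_sub]
    nth_rewrite 1 [h1]
    abel
  rw [e, abs_neg]
  refine (abs_real_inner_le_norm _ _).trans ?_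
  refine mul_le_mul (h.surv_norm u) ?_ (norm_nonneg _) (norm_nonneg _)
  have h7 := norm_sub_le (δ - D g) (D (Sv δ))
  have h8 : ‖δ - D g‖ ≤ ρ * (5 / 4) * (2 * ‖k‖) := by
    refine h2.trans (mul_le_mul ?_ h4 (norm_nonneg _) (by positivity))
    gcongr
    linarith
  have h9 : ‖Sv δ‖ ≤ c * (2 * ‖k‖) :=
    h6.trans (h3.trans (mul_le_mul_of_nonneg_left h4 (hρ0.trans hρc)))
  have h10 : ‖D (Sv δ)‖ ≤ c * (c * (2 * ‖k‖)) :=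
    h5.trans (mul_le_mul (by linarith) h9 (norm_nonneg _) (hρ0.trans hρc))
  nlinarith

theorem norm_coeff_signal_le {w : W} {f g k : V} (hw : Q w = Φ g)
    (hg : g + N ((harmonicMean a b / n) • Φt w) = f) (hk : k + N k = f) :
    a * ‖w‖ ≤ 9 / 4 * √n * ‖k‖ := by
  refine (lower_norm_le h.lower w).trans ?_
  rw [hw]
  refine (h.norm_map_le g).trans ?_
  have h1 := mul_le_mul h.sqrt_spread_le (h.norm_bias_le hw hg hk) (norm_nonneg _) (by positivity)
  linarith

/-- This is the part of the leave-one-out weights coming from `G`: `w` solves `(Φ Λ Φᵗ + Q) w = Φ Λ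
u`. The covariance error bound gives `Φᵗ w ≈ z = N (u - Φᵗ w)`, hence `z ≈ Sv u` and `‖z‖ ≤ 2 ‖u‖`;
then `w ≈ m⁻¹ Q w` is read off from `Q w = Φ ((m / n) z)`. -/
theorem norm_coeff_eval_le {w : W} {u : V}
    (hw : Q w = Φ ((harmonicMean a b / n) • N (u - Φt w))) :
    ‖w‖ ≤ 4 / √n * ‖u‖ := by
  have hn := h.n_pos
  have hm := h.harmonicMean_pos
  set q := u - Φt w with hq
  have h1 := h.norm_covariance_error_le' hw
  set z := N q with hz
  have h2 : ‖(harmonicMean a b / n) • z‖ = harmonicMean a b / n * ‖z‖ := by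
    rw [norm_smul, Real.norm_eq_abs, abs_of_pos (by positivity)]
  rw [h2, ← smul_sub, norm_smul, Real.norm_eq_abs, abs_of_pos (by positivity)] at h1
  have h3 : ‖Φt w - z‖ ≤ c * ‖z‖ := by
    have : 0 < harmonicMean a b / n := by positivity
    nlinarith
  have h4 : z = Sv (u - (Φt w - z)) := by
    rw [show u - (Φt w - z) = q + N q by rw [← hz, hq]; abel, h.surv]
  have h5 : ‖z‖ ≤ 2 * ‖u‖ := by
    have h6 := h.surv_norm (u - (Φt w - z))
    rw [← h4] at h6
    have h7 := norm_sub_le u (Φt w - z)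
    have h8 := h.c_le
    have h9 := norm_nonneg z
    nlinarith
  have h6 := norm_sub_inv_harmonicMean_smul_le h.a_pos h.a_le h.symm h.lower h.upper w
  have h7 : ‖Q w‖ ≤ 9 / 8 * √n * (harmonicMean a b / n * (2 * ‖u‖)) := by
    rw [hw]
    refine (h.norm_map_le _).trans ?_
    rw [h2]
    gcongr
    exact h.sqrt_spread_le
  have h8 : ‖w‖ ≤ ‖w - (harmonicMean a b)⁻¹ • Q w‖ + (harmonicMean a b)⁻¹ * ‖Q w‖ := by
    have := norm_add_le (w - (harmonicMean a b)⁻¹ • Q w) ((harmonicMean a b)⁻¹ • Q w)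
    rwa [sub_add_cancel, norm_smul, Real.norm_eq_abs, abs_of_pos (by positivity)] at this
  have h9 : (b - a) / (b + a) / harmonicMean a b * ‖Q w‖ ≤ 1 / 2 / harmonicMean a b * ‖Q w‖ := by
    have := h.rho_le.trans h.c_le
    exact mul_le_mul_of_nonneg_right (div_le_div_of_nonneg_right this hm.le) (norm_nonneg _)
  calc ‖w‖ ≤ 3 / 2 / harmonicMean a b * ‖Q w‖ := by
        have : 3 / 2 / harmonicMean a b * ‖Q w‖
          = 1 / 2 / harmonicMean a b * ‖Q w‖ + (harmonicMean a b)⁻¹ * ‖Q w‖ := by ring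
        linarith
    _ ≤ 3 / 2 / harmonicMean a b * (9 / 8 * √n * (harmonicMean a b / n * (2 * ‖u‖))) := by
        gcongr
    _ = 27 / 8 * (√n / n) * ‖u‖ := by field_simp; ring
    _ ≤ 4 / √n * ‖u‖ := by
        rw [Real.sqrt_div_self', mul_one_div]
        gcongr
        norm_num

end

end IsRidgeSystem

/-- Resampling one coordinate leaves the integral unchanged. This form of Fubini replaces
conditioning on the other coordinates in both exponential moment bounds. -/
theorem lintegral_pi_update {ι : Type*} [Fintype ι] [DecidableEq ι] {Z : ι → Type*}
    [∀ i, MeasurableSpace (Z i)] (ν : ∀ i, Measure (Z i)) [∀ i, IsProbabilityMeasure (ν i)]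
    {f : (∀ i, Z i) → ℝ≥0∞} (hf : Measurable f) (j : ι) :
    ∫⁻ z, f z ∂Measure.pi ν = ∫⁻ z, ∫⁻ t, f (Function.update z j t) ∂ν j ∂Measure.pi ν := by
  classical
  have key : ∀ g : (∀ i, Z i) → ℝ≥0∞, Measurable g → ∀ z₀ : ∀ i, Z i,
      ∫⁻ z, g z ∂Measure.pi ν
        = (∫⋯∫⁻_(Finset.univ.erase j), (∫⋯∫⁻_{j}, g ∂ν) ∂ν) z₀ := by
    intro g hg z₀
    rw [lintegral_eq_lmarginal_univ z₀, ← lmarginal_union' ν g hg (by simp),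
      ← Finset.insert_eq, Finset.insert_erase (Finset.mem_univ j)]
  obtain hZ | ⟨⟨z₀⟩⟩ := isEmpty_or_nonempty (∀ i, Z i)
  · simp [lintegral_of_isEmpty]
  have hm : Measurable (∫⋯∫⁻_{j}, f ∂ν) := hf.lmarginal ν
  have e : (fun z => ∫⁻ t, f (Function.update z j t) ∂ν j) = ∫⋯∫⁻_{j}, f ∂ν := by
    rw [lmarginal_singleton]
  rw [key f hf z₀, show (∫⁻ z, ∫⁻ t, f (Function.update z j t) ∂ν j ∂Measure.pi ν)
    = ∫⁻ z, (∫⋯∫⁻_{j}, f ∂ν) z ∂Measure.pi ν by rw [← e], key _ hm z₀]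
  have e2 : ∫⋯∫⁻_{j}, (∫⋯∫⁻_{j}, f ∂ν) ∂ν = ∫⋯∫⁻_{j}, f ∂ν := by
    rw [lmarginal_singleton, lmarginal_singleton]
    funext z
    simp
  rw [e2]

/-! ### Label noise -/

/-- Symmetrization: for an independent copy `y'` of the label `y`, Jensen bounds `exp (-a E y)` by
`E exp (-a y')`, and `E exp (a (y - y')) ≤ cosh (2 a) ≤ exp (2 a²)`. -/
theorem two_point_mgf_le {t : ℝ} (h0 : 0 ≤ t) (h1 : t ≤ 1) (a : ℝ) :
    t * Real.exp (a * (1 - (2 * t - 1)) - 2 * a ^ 2)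
      + (1 - t) * Real.exp (a * (-1 - (2 * t - 1)) - 2 * a ^ 2) ≤ 1 := by
  have hc : Real.exp (-(a * (2 * t - 1))) ≤ t * Real.exp (-a) + (1 - t) * Real.exp a := by
    have := convexOn_exp.2 (Set.mem_univ (-a)) (Set.mem_univ a) h0 (sub_nonneg.2 h1) (by ring)
    simp only [smul_eq_mul] at this
    refine le_trans (le_of_eq (congrArg Real.exp ?_)) this
    ring
  have hcosh := Real.cosh_le_exp_half_sq (2 * a)
  rw [Real.cosh_eq] at hcosh
  have e1 : Real.exp a * Real.exp (-a) = 1 := by rw [← Real.exp_add]; simp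
  have e2 : Real.exp (2 * a) = Real.exp a ^ 2 := by rw [← Real.exp_nat_mul]; norm_num
  have e3 : Real.exp (-(2 * a)) = Real.exp (-a) ^ 2 := by
    rw [← Real.exp_nat_mul]; congr 1; push_cast; ring
  rw [e2, e3] at hcosh
  have e4 : (2 * a) ^ 2 / 2 = 2 * a ^ 2 := by ring
  rw [e4] at hcosh
  set A := Real.exp a
  set B := Real.exp (-a)
  have hA : 0 < A := Real.exp_pos _
  have hB : 0 < B := Real.exp_pos _
  have e5 : t * Real.exp (a * (1 - (2 * t - 1)) - 2 * a ^ 2)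
      + (1 - t) * Real.exp (a * (-1 - (2 * t - 1)) - 2 * a ^ 2)
      = Real.exp (-(a * (2 * t - 1))) * (t * A + (1 - t) * B) / Real.exp (2 * a ^ 2) := by
    rw [show a * (1 - (2 * t - 1)) - 2 * a ^ 2 = -(a * (2 * t - 1)) + a - 2 * a ^ 2 by ring,
      show a * (-1 - (2 * t - 1)) - 2 * a ^ 2 = -(a * (2 * t - 1)) + -a - 2 * a ^ 2 by ring,
      Real.exp_sub, Real.exp_sub, Real.exp_add, Real.exp_add]
    ring
  rw [e5, div_le_one (Real.exp_pos _)]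
  have h2 : 0 ≤ t * A + (1 - t) * B := by
    have := sub_nonneg.2 h1
    positivity
  refine le_trans (mul_le_mul_of_nonneg_right hc h2) (le_trans ?_ hcosh)
  have h3 : (t * B + (1 - t) * A) * (t * A + (1 - t) * B)
      = (A ^ 2 + B ^ 2) / 2 + (t ^ 2 + (1 - t) ^ 2) * (A * B - (A ^ 2 + B ^ 2) / 2) := by ring
  have h4 : A * B - (A ^ 2 + B ^ 2) / 2 ≤ 0 := by nlinarith [sq_nonneg (A - B)]
  rw [h3]
  nlinarith [sq_nonneg t, sq_nonneg (1 - t)]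

section Labels

variable {X : Type*} [MeasurableSpace X] {μ : Measure X} {η : X → ℝ}

/-- `ν` is the joint law of a point `x ∼ μ` and a label `y = ±1` with `E[y | x] = η x`. -/
def IsLabelLaw (μ : Measure X) (η : X → ℝ) (ν : Measure (X × ℝ)) : Prop :=
  ∀ ψ : X × ℝ → ℝ≥0∞, Measurable ψ → ∫⁻ z, ψ z ∂ν =
    ∫⁻ t, (ENNReal.ofReal ((1 + η t) / 2) * ψ (t, 1)
      + ENNReal.ofReal ((1 - η t) / 2) * ψ (t, -1)) ∂μ

theorem IsLabelLaw.lintegral_le {ν : Measure (X × ℝ)} (hν : IsLabelLaw μ η ν)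
    (hη : Measurable η) (hb : ∀ᵐ t ∂μ, |η t| ≤ 1) {G : X → ℝ≥0∞} (hG : Measurable G)
    {a : X → ℝ} (ha : Measurable a) :
    ∫⁻ z, G z.1 * ENNReal.ofReal (Real.exp (a z.1 * (z.2 - η z.1) - 2 * a z.1 ^ 2)) ∂ν
      ≤ ∫⁻ z, G z.1 ∂ν := by
  rw [hν _ (by fun_prop), hν _ (by fun_prop)]
  refine lintegral_mono_ae ?_
  filter_upwards [hb] with t ht
  obtain ⟨h1, h2⟩ := abs_le.1 ht
  have key := two_point_mgf_le (t := (1 + η t) / 2) (by linarith) (by linarith) (a t)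
  rw [show 2 * ((1 + η t) / 2) - 1 = η t by ring, show 1 - (1 + η t) / 2 = (1 - η t) / 2 by ring]
    at key
  have e : ENNReal.ofReal ((1 + η t) / 2) + ENNReal.ofReal ((1 - η t) / 2) = 1 := by
    rw [← ENNReal.ofReal_add (by linarith) (by linarith)]
    norm_num
    ring
  rw [← add_mul, e, one_mul, mul_left_comm, mul_left_comm (ENNReal.ofReal ((1 - η t) / 2)),
    ← mul_add, ← ENNReal.ofReal_mul (by linarith), ← ENNReal.ofReal_mul (by linarith),
    ← ENNReal.ofReal_add (mul_nonneg (by linarith) (Real.exp_pos _).le)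
      (mul_nonneg (by linarith) (Real.exp_pos _).le)]
  refine mul_le_of_le_one_right' (ENNReal.ofReal_le_one.2 key)

/-- The weights may depend on all positions but on no label. Resampling the pair `(x_j, y_j)`
therefore affects the other factors through `x_j` only, and for fixed `x_j` the average over the
label is at most one. -/
theorem lintegral_noise_le {ι : Type*} [Fintype ι] {ν : ι → Measure (X × ℝ)}
    [∀ i, IsProbabilityMeasure (ν i)] (hν : ∀ i, IsLabelLaw μ η (ν i))
    (hη : Measurable η) (hb : ∀ᵐ t ∂μ, |η t| ≤ 1) {a : ι → (ι → X) → ℝ}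
    (ha : ∀ i, Measurable (a i)) (S : Finset ι) :
    ∫⁻ z, ∏ j ∈ S, ENNReal.ofReal (Real.exp (a j (fun k => (z k).1) * ((z j).2 - η (z j).1)
      - 2 * a j (fun k => (z k).1) ^ 2)) ∂Measure.pi ν ≤ 1 := by
  classical
  have hm : ∀ S : Finset ι, Measurable fun z : ι → X × ℝ =>
      ∏ j ∈ S, ENNReal.ofReal (Real.exp (a j (fun k => (z k).1) * ((z j).2 - η (z j).1)
        - 2 * a j (fun k => (z k).1) ^ 2)) := fun S => by
    refine Finset.measurable_prod _ fun j _ => ?_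
    have := ha j
    fun_prop
  induction S using Finset.induction_on with
  | empty => simp
  | insert j S hj ih =>
    refine le_trans ?_ ih
    rw [lintegral_pi_update ν (hm _) j, lintegral_pi_update ν (hm S) j]
    refine lintegral_mono fun z => ?_
    have hx : ∀ t : X × ℝ, (fun k => (Function.update z j t k).1)
        = Function.update (fun k => (z k).1) j t.1 := fun t => by
      funext k
      by_cases hk : k = j
      · subst hk; simp
      · simp [hk]
    have hS : ∀ t : X × ℝ, ∀ k ∈ S, Function.update z j t k = z k := fun t k hk =>
      Function.update_of_ne (ne_of_mem_of_not_mem hk hj) _ _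
    have hu : Measurable fun t : X => Function.update (fun k => (z k).1) j t :=
      measurable_update _
    have e : ∀ t : X × ℝ, ∏ k ∈ S, ENNReal.ofReal (Real.exp
        (a k (fun l => (Function.update z j t l).1) * ((Function.update z j t k).2
          - η (Function.update z j t k).1) - 2 * a k (fun l => (Function.update z j t l).1) ^ 2))
        = ∏ k ∈ S, ENNReal.ofReal (Real.exp
        (a k (Function.update (fun l => (z l).1) j t.1) * ((z k).2
          - η (z k).1) - 2 * a k (Function.update (fun l => (z l).1) j t.1) ^ 2)) := by
      intro t
      refine Finset.prod_congr rfl fun k hk => ?_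
      rw [hx, hS t k hk]
    simp only [Finset.prod_insert hj, e]
    simp only [hx, Function.update_self]
    refine le_trans (le_of_eq ?_) ((hν j).lintegral_le hη hb
      (G := fun t => ∏ k ∈ S, ENNReal.ofReal (Real.exp
        (a k (Function.update (fun l => (z l).1) j t) * ((z k).2
          - η (z k).1) - 2 * a k (Function.update (fun l => (z l).1) j t) ^ 2))) ?_
      (a := fun t => a j (Function.update (fun l => (z l).1) j t)) ((ha j).comp hu))
    · exact lintegral_congr fun t => mul_comm _ _
    · refine Finset.measurable_prod _ fun k _ => ?_
      have := (ha k).comp hu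
      simp only [Function.comp_def] at this
      fun_prop

theorem measure_noise_ge_le {ι : Type*} [Fintype ι] {ν : ι → Measure (X × ℝ)}
    [∀ i, IsProbabilityMeasure (ν i)] (hν : ∀ i, IsLabelLaw μ η (ν i))
    (hη : Measurable η) (hb : ∀ᵐ t ∂μ, |η t| ≤ 1) {a : ι → (ι → X) → ℝ}
    (ha : ∀ i, Measurable (a i)) {L : ℝ} (hL : 0 < L) (haL : ∀ x, ∑ i, a i x ^ 2 ≤ L ^ 2)
    {t : ℝ} (ht : 0 ≤ t) :
    Measure.pi ν {z | t ≤ ∑ j, a j (fun k => (z k).1) * ((z j).2 - η (z j).1)}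
      ≤ ENNReal.ofReal (Real.exp (-(t ^ 2 / (8 * L ^ 2)))) := by
  -- The minimizer of the Chernoff exponent `-s t + 2 s² L²`.
  set s := t / (4 * L ^ 2) with hs
  have hs0 : 0 ≤ s := by positivity
  have h1 := lintegral_noise_le hν hη hb (a := fun i x => s * a i x)
    (fun i => (ha i).const_mul s) Finset.univ
  have hm : Measurable fun z : ι → X × ℝ =>
      ∏ j, ENNReal.ofReal (Real.exp (s * a j (fun k => (z k).1) * ((z j).2 - η (z j).1)
        - 2 * (s * a j (fun k => (z k).1)) ^ 2)) := by
    refine Finset.measurable_prod _ fun j _ => ?_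
    have := ha j
    fun_prop
  have h2 := (mul_meas_ge_le_lintegral (μ := Measure.pi ν) hm
    (ENNReal.ofReal (Real.exp (t ^ 2 / (8 * L ^ 2))))).trans h1
  have h3 : {z : ι → X × ℝ | t ≤ ∑ j, a j (fun k => (z k).1) * ((z j).2 - η (z j).1)} ⊆
      {z | ENNReal.ofReal (Real.exp (t ^ 2 / (8 * L ^ 2))) ≤
        ∏ j, ENNReal.ofReal (Real.exp (s * a j (fun k => (z k).1) * ((z j).2 - η (z j).1)
        - 2 * (s * a j (fun k => (z k).1)) ^ 2))} := by
    intro z hz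
    simp only [Set.mem_ofPred_eq] at hz ⊢
    rw [← ENNReal.ofReal_prod_of_nonneg fun _ _ => (Real.exp_pos _).le, ← Real.exp_sum]
    refine ENNReal.ofReal_le_ofReal (Real.exp_le_exp.2 ?_)
    have e : ∑ j, (s * a j (fun k => (z k).1) * ((z j).2 - η (z j).1)
        - 2 * (s * a j (fun k => (z k).1)) ^ 2)
        = s * ∑ j, a j (fun k => (z k).1) * ((z j).2 - η (z j).1)
          - 2 * s ^ 2 * ∑ j, a j (fun k => (z k).1) ^ 2 := by
      rw [Finset.mul_sum, Finset.mul_sum, ← Finset.sum_sub_distrib]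
      exact Finset.sum_congr rfl fun j _ => by ring
    rw [e]
    have h4 := mul_le_mul_of_nonneg_left hz hs0
    have h5 := mul_le_mul_of_nonneg_left (haL fun k => (z k).1) (by positivity : 0 ≤ 2 * s ^ 2)
    have e2 : t ^ 2 / (8 * L ^ 2) = s * t - 2 * s ^ 2 * L ^ 2 := by
      rw [hs]; field_simp; ring
    rw [e2]
    linarith
  refine (measure_mono h3).trans ?_
  rw [Real.exp_neg, ENNReal.ofReal_inv_of_pos (Real.exp_pos _), ← one_div,
    ENNReal.le_div_iff_mul_le (by left; simp [Real.exp_pos]) (by simp), mul_comm]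
  exact h2

theorem measure_abs_noise_ge_le {ι : Type*} [Fintype ι] {ν : ι → Measure (X × ℝ)}
    [∀ i, IsProbabilityMeasure (ν i)] (hν : ∀ i, IsLabelLaw μ η (ν i))
    (hη : Measurable η) (hb : ∀ᵐ t ∂μ, |η t| ≤ 1) {a : ι → (ι → X) → ℝ}
    (ha : ∀ i, Measurable (a i)) {L : ℝ} (hL : 0 < L) (haL : ∀ x, ∑ i, a i x ^ 2 ≤ L ^ 2)
    {t : ℝ} (ht : 0 ≤ t) :
    Measure.pi ν {z | t ≤ |∑ j, a j (fun k => (z k).1) * ((z j).2 - η (z j).1)|}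
      ≤ 2 * ENNReal.ofReal (Real.exp (-(t ^ 2 / (8 * L ^ 2)))) := by
  have h1 := measure_noise_ge_le hν hη hb ha hL haL ht
  have h2 := measure_noise_ge_le hν hη hb (a := fun i x => - a i x) (fun i => (ha i).neg) hL
    (by simpa using haL) ht
  rw [two_mul]
  refine le_trans ?_ ((measure_union_le _ _).trans (add_le_add h1 h2))
  refine measure_mono fun z hz => ?_
  simp only [Set.mem_ofPred_eq, Set.mem_union, neg_mul, Finset.sum_neg_distrib] at hz ⊢
  exact le_abs.1 hz

end Labels

/-! ### Sums of a kernel over independent points -/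

section Pairs

variable {X : Type*} [MeasurableSpace X] {μ : Measure X} [IsProbabilityMeasure μ]

/-- Bernstein's argument: `exp z ≤ 1 + z + z²` for `|z| ≤ 1`, the linear term integrates to zero,
and `1 + s² V ≤ exp (s² V)`. The factor `2 B` bounds the centred variable. -/
theorem lintegral_exp_sub_integral_le {Y : X → ℝ} (hY : AEMeasurable Y μ) {B V s : ℝ}
    (hB : ∀ᵐ t ∂μ, |Y t| ≤ B) (hV : ∫ t, Y t ^ 2 ∂μ ≤ V) (hs : |s| * (2 * B) ≤ 1) :
    ∫⁻ t, ENNReal.ofReal (Real.exp (s * (Y t - ∫ r, Y r ∂μ))) ∂μ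
      ≤ ENNReal.ofReal (Real.exp (s ^ 2 * V)) := by
  set m := ∫ r, Y r ∂μ with hm
  have hYi : Integrable Y μ :=
    Integrable.of_bound hY.aestronglyMeasurable B (by simpa using hB)
  have hY2 : Integrable (fun t => Y t ^ 2) μ := by
    refine Integrable.of_bound (hY.pow_const 2).aestronglyMeasurable (B ^ 2) ?_
    filter_upwards [hB] with t ht
    rw [Real.norm_eq_abs, abs_pow]
    gcongr
  have hmB : |m| ≤ B := by
    have := norm_integral_le_of_norm_le_const (μ := μ) (f := Y) (C := B) (by simpa using hB)
    simpa using this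
  have hz : ∀ᵐ t ∂μ, |s * (Y t - m)| ≤ 1 := by
    filter_upwards [hB] with t ht
    rw [abs_mul]
    refine le_trans (mul_le_mul_of_nonneg_left ?_ (abs_nonneg s)) hs
    have := abs_sub (Y t) m
    linarith
  have hq : Integrable (fun t => 1 + s * (Y t - m) + s ^ 2 * (Y t ^ 2 - 2 * m * Y t + m ^ 2)) μ := by
    fun_prop
  calc ∫⁻ t, ENNReal.ofReal (Real.exp (s * (Y t - m))) ∂μ
      ≤ ∫⁻ t, ENNReal.ofReal
          (1 + s * (Y t - m) + s ^ 2 * (Y t ^ 2 - 2 * m * Y t + m ^ 2)) ∂μ := by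
        refine lintegral_mono_ae ?_
        filter_upwards [hz] with t ht
        refine ENNReal.ofReal_le_ofReal ?_
        have := (abs_le.1 (Real.abs_exp_sub_one_sub_id_le ht)).2
        nlinarith
    _ = ENNReal.ofReal (∫ t, (1 + s * (Y t - m)
          + s ^ 2 * (Y t ^ 2 - 2 * m * Y t + m ^ 2)) ∂μ) := by
        rw [ofReal_integral_eq_lintegral_ofReal hq]
        filter_upwards [hz] with t ht
        have := (abs_le.1 ht).1
        have e : s ^ 2 * (Y t ^ 2 - 2 * m * Y t + m ^ 2) = (s * (Y t - m)) ^ 2 := by ring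
        rw [e]
        simp only [Pi.zero_apply]
        nlinarith [sq_nonneg (s * (Y t - m))]
    _ ≤ ENNReal.ofReal (Real.exp (s ^ 2 * V)) := by
        refine ENNReal.ofReal_le_ofReal ?_
        have e : ∫ t, (1 + s * (Y t - m) + s ^ 2 * (Y t ^ 2 - 2 * m * Y t + m ^ 2)) ∂μ
            = 1 + s ^ 2 * (∫ t, Y t ^ 2 ∂μ - m ^ 2) := by
          have i1 : Integrable (fun t => s * (Y t - m)) μ := by fun_prop
          have i2 : Integrable (fun t => Y t ^ 2 - 2 * m * Y t) μ := by fun_prop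
          rw [integral_add (by fun_prop) (by fun_prop), integral_add (by fun_prop) i1,
            integral_const_mul, integral_const_mul, integral_sub hYi (by fun_prop),
            integral_add i2 (by fun_prop), integral_sub hY2 (by fun_prop), integral_const_mul]
          simp only [integral_const, probReal_univ, smul_eq_mul, one_mul, ← hm]
          ring
        rw [e]
        have h1 := Real.add_one_le_exp (s ^ 2 * V)
        nlinarith [sq_nonneg s, sq_nonneg m, mul_le_mul_of_nonneg_left hV (sq_nonneg s),
          mul_nonneg (sq_nonneg s) (sq_nonneg m)]

/-- The points `x_j`, `j ∈ S`, are integrated out one at a time while `x_i` is held fixed, so a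
bound uniform in the first argument suffices. -/
theorem lintegral_pair_prod_le {ι : Type*} [Fintype ι] {F : X → X → ℝ≥0∞}
    (hF : Measurable (Function.uncurry F)) {E : ℝ≥0∞} (hE : ∀ x, ∫⁻ t, F x t ∂μ ≤ E)
    {i : ι} (S : Finset ι) (hi : i ∉ S) :
    ∫⁻ x, ∏ j ∈ S, F (x i) (x j) ∂Measure.pi (fun _ : ι => μ) ≤ E ^ S.card := by
  classical
  have hm : ∀ S : Finset ι, Measurable fun x : ι → X => ∏ j ∈ S, F (x i) (x j) := fun S => by
    refine Finset.measurable_prod _ fun j _ => ?_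
    have hp : Measurable fun x : ι → X => (x i, x j) := by fun_prop
    exact hF.comp hp
  induction S using Finset.induction_on with
  | empty => simp
  | insert j S hj ih =>
    obtain ⟨hij, hiS⟩ : i ≠ j ∧ i ∉ S := by simpa using hi
    rw [lintegral_pi_update _ (hm _) j, Finset.card_insert_of_notMem hj, pow_succ']
    refine le_trans ?_ (mul_le_mul_right (ih hiS) E)
    rw [← lintegral_const_mul _ (hm S)]
    refine lintegral_mono fun x => ?_
    have hS : ∀ t : X, ∏ k ∈ S, F (x i) (Function.update x j t k) = ∏ k ∈ S, F (x i) (x k) :=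
      fun t => Finset.prod_congr rfl fun k hk => by
        rw [Function.update_of_ne (ne_of_mem_of_not_mem hk hj)]
    simp only [Finset.prod_insert hj, Function.update_self, Function.update_of_ne hij, hS]
    rw [lintegral_mul_const _ (hF.of_uncurry_left)]
    exact mul_le_mul_left (hE _) _

theorem measure_pair_sum_ge_le {ι : Type*} [Fintype ι] {F : X → X → ℝ}
    (hF : Measurable (Function.uncurry F)) {s V : ℝ} (hs : 0 ≤ s) (hV : 0 ≤ V)
    (hE : ∀ x, ∫⁻ t, ENNReal.ofReal (Real.exp (s * F x t)) ∂μ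
      ≤ ENNReal.ofReal (Real.exp (s ^ 2 * V))) {i : ι} {S : Finset ι} (hi : i ∉ S) {N T : ℝ}
    (hS : (S.card : ℝ) ≤ N) :
    Measure.pi (fun _ : ι => μ) {x | T ≤ ∑ j ∈ S, F (x i) (x j)}
      ≤ ENNReal.ofReal (Real.exp (-(s * T) + N * (s ^ 2 * V))) := by
  have hF' : Measurable (Function.uncurry fun x t => ENNReal.ofReal (Real.exp (s * F x t))) := by
    have : Measurable fun q : X × X => F q.1 q.2 := hF
    simp only [Function.uncurry_def]
    fun_prop
  have h1 := lintegral_pair_prod_le hF' hE S hi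
  have hm : Measurable fun x : ι → X => ∏ j ∈ S, ENNReal.ofReal (Real.exp (s * F (x i) (x j))) := by
    refine Finset.measurable_prod _ fun j _ => ?_
    have hp : Measurable fun x : ι → X => (x i, x j) := by fun_prop
    exact hF'.comp hp
  have h2 := (mul_meas_ge_le_lintegral hm (ENNReal.ofReal (Real.exp (s * T)))).trans h1
  have h3 : {x : ι → X | T ≤ ∑ j ∈ S, F (x i) (x j)} ⊆ {x | ENNReal.ofReal (Real.exp (s * T)) ≤
      ∏ j ∈ S, ENNReal.ofReal (Real.exp (s * F (x i) (x j)))} := by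
    intro x hx
    simp only [Set.mem_ofPred_eq] at hx ⊢
    rw [← ENNReal.ofReal_prod_of_nonneg fun _ _ => (Real.exp_pos _).le, ← Real.exp_sum,
      ← Finset.mul_sum]
    exact ENNReal.ofReal_le_ofReal (Real.exp_le_exp.2 (mul_le_mul_of_nonneg_left hx hs))
  refine (measure_mono h3).trans ?_
  rw [Real.exp_add, ENNReal.ofReal_mul (Real.exp_pos _).le, Real.exp_neg,
    ENNReal.ofReal_inv_of_pos (Real.exp_pos _),
    mul_comm (ENNReal.ofReal _)⁻¹, ← div_eq_mul_inv,
    ENNReal.le_div_iff_mul_le (by left; simp [Real.exp_pos]) (by simp), mul_comm]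
  refine h2.trans ?_
  rw [← ENNReal.ofReal_pow (Real.exp_pos _).le, ← Real.exp_nat_mul]
  exact ENNReal.ofReal_le_ofReal (Real.exp_le_exp.2
    (mul_le_mul_of_nonneg_right hS (by positivity)))

end Pairs

/-! ### Duality, the leave-one-out sign criterion and the residual Gram form -/

section Kernel

variable {X : Type*} {H : Type*} [NormedAddCommGroup H] [InnerProductSpace ℝ H] [CompleteSpace H]
  [RKHS ℝ H X ℝ]

theorem inner_kerFun_one (x : X) (g : H) : inner ℝ (RKHS.kerFun H x (1 : ℝ)) g = g x := by
  simp

theorem kerFun_one_apply (x t : X) : RKHS.kerFun H x (1 : ℝ) t = ker H t x := by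
  rw [← inner_kerFun_one, ker]

theorem ker_comm (x y : X) : ker H x y = ker H y x := real_inner_comm _ _

theorem sum_mul_ker_nonneg {ι : Type*} [Fintype ι] (x : ι → X) (w : ι → ℝ) :
    0 ≤ ∑ i, ∑ j, w i * w j * ker H (x i) (x j) := by
  have h : inner ℝ (∑ i, w i • RKHS.kerFun H (x i) (1 : ℝ))
      (∑ i, w i • RKHS.kerFun H (x i) (1 : ℝ))
      = ∑ i, ∑ j, w i * w j * ker H (x i) (x j) := by
    rw [sum_inner]
    refine Finset.sum_congr rfl fun i _ => ?_
    rw [inner_sum]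
    refine Finset.sum_congr rfl fun j _ => ?_
    rw [real_inner_smul_left, real_inner_smul_right, ker]
    ring
  rw [← h]
  exact real_inner_self_nonneg

variable {n : ℕ} {x : Fin n → X} {y : Fin n → ℝ}

/-- For `f = ∑ β_j k_{x_j}` one has `⟪f, g⟫ = ∑ β_j g (x_j)`, and the signs give `⟪f, g⟫ ≥ ‖f‖²` for
every `g` feasible in the SVM problem. So `‖f‖² + ‖g - f‖² ≤ ‖g‖²`, which yields optimality and
uniqueness together; interpolants are feasible, so both problems are covered. -/
theorem proliferation_of_dual_nonneg (hy : ∀ i, y i = 1 ∨ y i = -1) {β : Fin n → ℝ}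
    (hβ : ∀ i, ∑ j, β j * ker H (x i) (x j) = y i) (hs : ∀ i, 0 ≤ y i * β i) :
    Proliferation H x y := by
  have hyy : ∀ i, y i * y i = 1 := fun i => by rcases hy i with h | h <;> simp [h]
  set f : H := ∑ j, β j • RKHS.kerFun H (x j) (1 : ℝ) with hf
  have hin : ∀ g : H, inner ℝ f g = ∑ j, β j * g (x j) := fun g => by
    rw [hf, sum_inner]
    refine Finset.sum_congr rfl fun j _ => ?_
    rw [real_inner_smul_left, inner_kerFun_one]
  have hfx : ∀ i, f (x i) = y i := fun i => by
    rw [← inner_kerFun_one, real_inner_comm, hin, ← hβ i]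
    exact Finset.sum_congr rfl fun j _ => by rw [kerFun_one_apply, ker_comm]
  have hmargin : ∀ i, 1 ≤ y i * f (x i) := fun i => by rw [hfx, hyy]
  have hopt : ∀ g : H, (∀ i, 1 ≤ y i * g (x i)) → ‖f‖ ^ 2 + ‖g - f‖ ^ 2 ≤ ‖g‖ ^ 2 := by
    intro g hg
    have h1 : ‖f‖ ^ 2 ≤ inner ℝ f g := by
      rw [← real_inner_self_eq_norm_sq, hin, hin]
      refine Finset.sum_le_sum fun j _ => ?_
      rw [hfx]
      have h2 := mul_le_mul_of_nonneg_left (hg j) (hs j)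
      have h3 : y j * β j * (y j * g (x j)) = β j * g (x j) := by
        linear_combination (β j * g (x j)) * hyy j
      linarith
    rw [norm_sub_sq_real, real_inner_comm]
    linarith
  have hint : ∀ g : H, (∀ i, g (x i) = y i) → ∀ i, 1 ≤ y i * g (x i) := fun g hg i => by
    rw [hg, hyy]
  have hle : ∀ g : H, (∀ i, 1 ≤ y i * g (x i)) → ‖f‖ ≤ ‖g‖ := fun g hg => by
    have h1 := hopt g hg
    exact abs_le_of_sq_le_sq' (by nlinarith [sq_nonneg ‖g - f‖]) (norm_nonneg _) |>.2
  have huniq : ∀ g : H, (∀ i, 1 ≤ y i * g (x i)) → ‖g‖ ≤ ‖f‖ → g = f := fun g hg hgf => by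
    have h1 := hopt g hg
    have h2 : ‖g‖ ^ 2 ≤ ‖f‖ ^ 2 := by gcongr
    have h3 : ‖g - f‖ = 0 := by nlinarith [sq_nonneg ‖g - f‖]
    exact sub_eq_zero.1 (norm_eq_zero.1 h3)
  refine ⟨f, fun g => ⟨fun hg => huniq g (hint g hg.1) (hg.2 f hfx), ?_⟩,
    fun g => ⟨fun hg => huniq g hg.1 (hg.2 f hmargin), ?_⟩, fun i => ?_⟩
  · rintro rfl
    exact ⟨hfx, fun g hg => hle g (hint g hg)⟩
  · rintro rfl
    exact ⟨hmargin, hle⟩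
  · rw [IsSupportVector, hfx]
    exact hy i

/-- The dual coefficient of a point has the sign of its label if the interpolant of the other
points, here with coefficients `w`, has margin less than one there. -/
theorem dual_sign_of_leaveOneOut (hy : ∀ i, y i = 1 ∨ y i = -1) {β : Fin n → ℝ}
    (hβ : ∀ i, ∑ j, β j * ker H (x i) (x j) = y i) {i : Fin n} {w : Fin n → ℝ} (hw : w i = 0)
    (hwj : ∀ j, j ≠ i → ∑ k, w k * ker H (x j) (x k) = y j)
    (hi : y i * ∑ k, w k * ker H (x i) (x k) < 1) : 0 ≤ y i * β i := by
  have hyy : y i * y i = 1 := by rcases hy i with h | h <;> simp [h]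
  -- The kernel matrix applied to `β - w` vanishes except at `i`, where it is `y_i - r`. Positivity
  -- of the quadratic form then reads `β_i (y_i - r) ≥ 0`.
  have h1 := sum_mul_ker_nonneg (H := H) x (fun j => β j - w j)
  set r := ∑ k, w k * ker H (x i) (x k) with hr
  have h2 : ∀ j, ∑ k, (β j - w j) * (β k - w k) * ker H (x j) (x k)
      = if j = i then β i * (y i - r) else 0 := by
    intro j
    have e : ∑ k, (β j - w j) * (β k - w k) * ker H (x j) (x k) = (β j - w j) *
        (∑ k, β k * ker H (x j) (x k) - ∑ k, w k * ker H (x j) (x k)) := by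
      rw [← Finset.sum_sub_distrib, Finset.mul_sum]
      exact Finset.sum_congr rfl fun k _ => by ring
    rw [e, hβ]
    split_ifs with h
    · subst h
      rw [hw, ← hr, sub_zero]
    · rw [hwj j h, sub_self, mul_zero]
  simp only [h2, Finset.sum_ite_eq', Finset.mem_univ, if_true] at h1
  have h3 : β i * (y i - r) = (y i * β i) * (1 - y i * r) := by
    linear_combination (β i * r) * hyy
  rw [h3] at h1
  exact nonneg_of_mul_nonneg_left h1 (by linarith)

/-- The component orthogonal to `G` of the kernel function at `x`. -/
noncomputable def residual (H : Type*) [NormedAddCommGroup H] [InnerProductSpace ℝ H]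
    [CompleteSpace H] [RKHS ℝ H X ℝ] (v : ℕ → X → ℝ) (p : ℕ) (x : X) : H :=
  (GH H v p)ᗮ.starProjection (RKHS.kerFun H x (1 : ℝ))

theorem R_apply (v : ℕ → X → ℝ) (p : ℕ) (f : H) (i : Fin n) :
    R H v p x f i = inner ℝ (residual H v p (x i)) f := by
  rw [residual, Submodule.inner_starProjection_left_eq_right, inner_kerFun_one]
  rfl

theorem adjoint_R_apply (v : ℕ → X → ℝ) (p : ℕ) (w : EuclideanSpace ℝ (Fin n)) :
    (R H v p x).adjoint w = ∑ i, w i • residual H v p (x i) := by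
  refine ext_inner_right ℝ fun f => ?_
  rw [ContinuousLinearMap.adjoint_inner_left, sum_inner, PiLp.inner_apply]
  refine Finset.sum_congr rfl fun i _ => ?_
  rw [R_apply, real_inner_smul_left]
  simp [mul_comm]

theorem inner_gram_self (v : ℕ → X → ℝ) (p : ℕ) (w : EuclideanSpace ℝ (Fin n)) :
    inner ℝ w ((R H v p x ∘L (R H v p x).adjoint) w)
      = ‖∑ i, w i • residual H v p (x i)‖ ^ 2 := by
  rw [ContinuousLinearMap.comp_apply, ← ContinuousLinearMap.adjoint_inner_left, adjoint_R_apply,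
    real_inner_self_eq_norm_sq]

theorem le_norm_sum_residual {v : ℕ → X → ℝ} {p : ℕ} {a : ℝ}
    (h : a • (1 : EuclideanSpace ℝ (Fin n) →L[ℝ] EuclideanSpace ℝ (Fin n)) ≤
      R H v p x ∘L (R H v p x).adjoint) (w : EuclideanSpace ℝ (Fin n)) :
    a * ‖w‖ ^ 2 ≤ ‖∑ i, w i • residual H v p (x i)‖ ^ 2 := by
  have h1 := ((ContinuousLinearMap.le_def _ _).1 h).inner_nonneg_right w
  rw [sub_apply, inner_sub_right, inner_gram_self] at h1
  simp only [smul_apply, one_apply_eq_self,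
    real_inner_smul_right, real_inner_self_eq_norm_sq] at h1
  linarith

theorem norm_sum_residual_le {v : ℕ → X → ℝ} {p : ℕ} {a : ℝ}
    (h : R H v p x ∘L (R H v p x).adjoint ≤
      a • (1 : EuclideanSpace ℝ (Fin n) →L[ℝ] EuclideanSpace ℝ (Fin n)))
    (w : EuclideanSpace ℝ (Fin n)) :
    ‖∑ i, w i • residual H v p (x i)‖ ^ 2 ≤ a * ‖w‖ ^ 2 := by
  have h1 := ((ContinuousLinearMap.le_def _ _).1 h).inner_nonneg_right w
  rw [sub_apply, inner_sub_right, inner_gram_self] at h1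
  simp only [smul_apply, one_apply_eq_self,
    real_inner_smul_right, real_inner_self_eq_norm_sq] at h1
  linarith

end Kernel

/-! ### Eigenfunctions as elements of `H` and the splitting of the kernel -/

section Eigenfunctions

variable {X : Type*} [MeasurableSpace X] {μ : Measure X}
  {H : Type*} [NormedAddCommGroup H] [InnerProductSpace ℝ H] [CompleteSpace H] [RKHS ℝ H X ℝ]

/-- The inclusion of `H` into `L₂(μ)` is bounded by the closed graph theorem: an `L₂` limit is an
almost everywhere limit along a subsequence, and evaluations are continuous on `H`. The representer
is the image of `v` under its adjoint. -/
theorem exists_integral_representer (hH : ∀ f : H, MemLp (fun x => f x) 2 μ) {v : X → ℝ}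
    (hv : MemLp v 2 μ) :
    ∃ e : H, (∀ x, e x = ∫ t, ker H x t * v t ∂μ) ∧ ∀ g : H, inner ℝ e g = ∫ t, v t * g t ∂μ := by
  let J₀ : H →ₗ[ℝ] Lp ℝ 2 μ :=
    { toFun := fun f => (hH f).toLp _
      map_add' := fun f g => by
        rw [← MemLp.toLp_add]
        exact MemLp.toLp_congr _ _ (Eventually.of_forall fun x => by simp)
      map_smul' := fun c f => by
        rw [RingHom.id_apply, ← MemLp.toLp_const_smul]
        exact MemLp.toLp_congr _ _ (Eventually.of_forall fun x => by simp) }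
  have hJ₀ : ∀ f : H, (J₀ f : X → ℝ) =ᵐ[μ] fun x => f x := fun f => (hH f).coeFn_toLp
  let J : H →L[ℝ] Lp ℝ 2 μ := ContinuousLinearMap.ofSeqClosedGraph (g := J₀) (by
    intro u a g hu hg
    obtain ⟨ns, hns, hae⟩ := (tendstoInMeasure_of_tendsto_Lp hg).exists_seq_tendsto_ae
    have hall : ∀ᵐ x ∂μ, ∀ i, (J₀ (u i) : X → ℝ) x = u i x :=
      ae_all_iff.2 fun i => hJ₀ (u i)
    apply Lp.ext
    filter_upwards [hae, hall, hJ₀ a] with x h1 h2 h3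
    rw [h3]
    refine tendsto_nhds_unique h1 ?_
    simp only [Function.comp, h2]
    exact ((RKHS.continuous_eval x).tendsto a).comp (hu.comp hns.tendsto_atTop))
  have hJ : ∀ f : H, (J f : X → ℝ) =ᵐ[μ] fun x => f x := fun f => hJ₀ f
  have hin : ∀ g : H, inner ℝ (J.adjoint (hv.toLp v)) g = ∫ t, v t * g t ∂μ := fun g => by
    rw [ContinuousLinearMap.adjoint_inner_left, L2.inner_def]
    refine integral_congr_ae ?_
    filter_upwards [hJ g, hv.coeFn_toLp] with t h1 h2
    rw [h1, h2]
    simp [mul_comm]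
  refine ⟨J.adjoint (hv.toLp v), fun x => ?_, hin⟩
  rw [← inner_kerFun_one, real_inner_comm, hin]
  refine integral_congr_ae (Eventually.of_forall fun t => ?_)
  simp only [kerFun_one_apply]
  rw [ker_comm, mul_comm]

namespace EigenSystem

variable (S : EigenSystem (ker H) μ) {p : ℕ}

theorem exists_eigenvector (hH : ∀ f : H, MemLp (fun x => f x) 2 μ) {ℓ : ℕ} (hℓ : (ℓ : ℕ∞) < S.N)
    (hl : 0 < S.lam ℓ) :
    ∃ e : H, (∀ x, e x = S.v ℓ x) ∧
      ∀ g : H, inner ℝ e g = (S.lam ℓ)⁻¹ * ∫ t, S.v ℓ t * g t ∂μ := by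
  obtain ⟨e, h1, h2⟩ := exists_integral_representer hH (S.memLp ℓ)
  refine ⟨(S.lam ℓ)⁻¹ • e, fun x => ?_, fun g => ?_⟩
  · simp only [RKHS.coe_smul, Pi.smul_apply, smul_eq_mul]
    rw [h1, S.eigen ℓ hℓ, inv_mul_cancel_left₀ hl.ne']
  · rw [real_inner_smul_left, h2]

/-- `MemLp` gives measurability only up to null sets. The eigenvalue equation at every point writes
`v` as a parameter integral of a measurable function. -/
theorem measurable_v [SFinite μ] (hk : Measurable fun q : X × X => ker H q.1 q.2) {ℓ : ℕ}
    (hℓ : (ℓ : ℕ∞) < S.N) (hl : 0 < S.lam ℓ) : Measurable (S.v ℓ) := by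
  have h1 := (S.memLp ℓ).aestronglyMeasurable
  have e : S.v ℓ = fun x => (S.lam ℓ)⁻¹ * ∫ t, ker H x t * h1.mk (S.v ℓ) t ∂μ := by
    funext x
    have h2 := S.eigen ℓ hℓ x
    have h3 : ∫ t, ker H x t * S.v ℓ t ∂μ = ∫ t, ker H x t * h1.mk (S.v ℓ) t ∂μ := by
      refine integral_congr_ae ?_
      filter_upwards [h1.ae_eq_mk] with t ht
      rw [ht]
    rw [← h3, h2, inv_mul_cancel_left₀ hl.ne']
  rw [e]
  have h4 : StronglyMeasurable fun q : X × X => ker H q.1 q.2 * h1.mk (S.v ℓ) q.2 := by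
    have := h1.stronglyMeasurable_mk.measurable
    exact Measurable.stronglyMeasurable (by fun_prop)
  exact h4.integral_prod_right'.measurable.const_mul _

/-- The eigenfunctions `e_ℓ` are orthogonal in `H` with squared norm `1 / λ_ℓ`, so the projection of
`k_z` to `G` is `∑ λ_ℓ v_ℓ(z) e_ℓ`. The identity holds at every pair of points and involves no
infinite series. -/
theorem ker_eq (hH : ∀ f : H, MemLp (fun x => f x) 2 μ) (hp : (p : ℕ∞) ≤ S.N)
    (hl : ∀ ℓ < p, 0 < S.lam ℓ) (x y : X) :
    ker H x y = ∑ ℓ ∈ Finset.range p, S.lam ℓ * S.v ℓ x * S.v ℓ y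
      + inner ℝ (residual H S.v p x) (residual H S.v p y) := by
  have hN : ∀ ℓ < p, (ℓ : ℕ∞) < S.N := fun ℓ h => lt_of_lt_of_le (by exact_mod_cast h) hp
  choose! e he hei using fun ℓ (h : ℓ < p) => S.exists_eigenvector hH (hN ℓ h) (hl ℓ h)
  have hproj : ∀ z : X, (GH H S.v p).starProjection (RKHS.kerFun H z (1 : ℝ))
      = ∑ ℓ ∈ Finset.range p, (S.lam ℓ * S.v ℓ z) • e ℓ := by
    intro z
    have hmem : ∀ ℓ < p, e ℓ ∈ GH H S.v p := fun ℓ h => by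
      refine Submodule.subset_span ⟨ℓ, h, ?_⟩
      funext t
      exact (he ℓ h t).symm
    refine Submodule.eq_starProjection_of_mem_of_inner_eq_zero ?_ ?_
    · exact Submodule.sum_mem _ fun ℓ h =>
        Submodule.smul_mem _ _ (hmem ℓ (Finset.mem_range.1 h))
    · intro g hg
      have hspan : GH H S.v p ≤ Submodule.span ℝ (e '' Set.Iio p) := by
        intro f hf
        have hf' : (f : X → ℝ) ∈ Submodule.span ℝ (S.v '' Set.Iio p) := hf
        have him : S.v '' Set.Iio p
            = (RKHS.coeCLM ℝ : H →L[ℝ] X → ℝ).toLinearMap '' (e '' Set.Iio p) := by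
          rw [Set.image_image]
          refine Set.image_congr fun ℓ h => ?_
          funext t
          exact (he ℓ h t).symm
        rw [him, ← Submodule.map_span] at hf'
        obtain ⟨f', h1, h2⟩ := hf'
        rwa [← RKHS.coeCLM_injective h2]
      refine Submodule.span_induction ?_ ?_ ?_ ?_ (hspan hg)
      · rintro _ ⟨m, hm, rfl⟩
        rw [inner_sub_left, inner_kerFun_one, he m hm, sum_inner, sub_eq_zero]
        rw [Finset.sum_eq_single m]
        · rw [real_inner_smul_left, hei m hm]
          have h1 := S.orthonormal m m (hN m hm) (hN m hm)
          simp only [if_true] at h1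
          rw [integral_congr_ae (g := fun t => S.v m t * S.v m t)
            (Eventually.of_forall fun t => by simp only [he m hm]), h1]
          field_simp [(hl m hm).ne']
        · intro ℓ hℓ hne
          have hℓ' := Finset.mem_range.1 hℓ
          rw [real_inner_smul_left, hei ℓ hℓ']
          have h1 := S.orthonormal ℓ m (hN ℓ hℓ') (hN m hm)
          rw [if_neg hne] at h1
          rw [integral_congr_ae (g := fun t => S.v ℓ t * S.v m t)
            (Eventually.of_forall fun t => by simp only [he m hm]), h1]
          ring
        · intro h
          exact absurd (Finset.mem_range.2 hm) h
      · simp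
      · intro a b _ _ h1 h2
        rw [inner_add_right, h1, h2, add_zero]
      · intro a b _ h1
        rw [real_inner_smul_right, h1, mul_zero]
  have hres : ∀ z : X, residual H S.v p z = RKHS.kerFun H z (1 : ℝ)
      - (GH H S.v p).starProjection (RKHS.kerFun H z (1 : ℝ)) := fun z => by
    rw [residual, Submodule.starProjection_orthogonal]
    rfl
  have h1 : inner ℝ (residual H S.v p x) (residual H S.v p y)
      = inner ℝ (RKHS.kerFun H x (1 : ℝ)) (residual H S.v p y) := by
    rw [residual, residual, Submodule.inner_starProjection_left_eq_right]
    congr 1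
    exact Submodule.starProjection_eq_self_iff.2 (Submodule.starProjection_apply_mem _ _)
  rw [h1, hres y, inner_sub_right, hproj, inner_kerFun_one x (∑ ℓ ∈ _, _), ker]
  have h2 : (∑ ℓ ∈ Finset.range p, (S.lam ℓ * S.v ℓ y) • e ℓ : H) x
      = ∑ ℓ ∈ Finset.range p, S.lam ℓ * S.v ℓ x * S.v ℓ y := by
    rw [← inner_kerFun_one, inner_sum]
    refine Finset.sum_congr rfl fun ℓ h => ?_
    rw [real_inner_smul_right, inner_kerFun_one, he ℓ (Finset.mem_range.1 h)]
    ring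
  rw [h2]
  ring

end EigenSystem

end Eigenfunctions

/-! ### Diagonal operators -/

/-- The diagonal map with entries `d` on `ℝ^p`. -/
noncomputable def diagMap {p : ℕ} (d : Fin p → ℝ) :
    EuclideanSpace ℝ (Fin p) →ₗ[ℝ] EuclideanSpace ℝ (Fin p) where
  toFun f := WithLp.toLp 2 fun ℓ => d ℓ * f ℓ
  map_add' f g := by ext ℓ; simp [mul_add]
  map_smul' a f := by ext ℓ; simp [mul_left_comm]

theorem diagMap_apply {p : ℕ} (d : Fin p → ℝ) (f : EuclideanSpace ℝ (Fin p)) (ℓ : Fin p) :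
    diagMap d f ℓ = d ℓ * f ℓ := rfl

theorem diagMap_symm {p : ℕ} (d : Fin p → ℝ) : (diagMap d).IsSymmetric := by
  intro f g
  rw [PiLp.inner_apply, PiLp.inner_apply]
  refine Finset.sum_congr rfl fun ℓ _ => ?_
  simp only [diagMap_apply, RCLike.inner_apply, conj_trivial]
  ring

theorem norm_diagMap_le {p : ℕ} {d : Fin p → ℝ} (hd : ∀ ℓ, |d ℓ| ≤ 1)
    (f : EuclideanSpace ℝ (Fin p)) : ‖diagMap d f‖ ≤ ‖f‖ := by
  rw [EuclideanSpace.norm_eq, EuclideanSpace.norm_eq]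
  refine Real.sqrt_le_sqrt (Finset.sum_le_sum fun ℓ _ => ?_)
  rw [diagMap_apply, norm_mul, Real.norm_eq_abs]
  gcongr
  exact mul_le_of_le_one_left (norm_nonneg _) (hd ℓ)

section Orthonormal

variable {E : Type*} [NormedAddCommGroup E] [InnerProductSpace ℝ E] {p : ℕ} {w : Fin p → E}

/-- The synthesis map `f ↦ ∑ f_ℓ w_ℓ`. -/
noncomputable def synth (w : Fin p → E) : EuclideanSpace ℝ (Fin p) →ₗ[ℝ] E where
  toFun f := ∑ ℓ, f ℓ • w ℓ
  map_add' f g := by simp [add_smul, Finset.sum_add_distrib]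
  map_smul' a f := by simp [Finset.smul_sum, smul_smul]

theorem synth_apply (w : Fin p → E) (f : EuclideanSpace ℝ (Fin p)) :
    synth w f = ∑ ℓ, f ℓ • w ℓ := rfl

theorem inner_synth (hw : Orthonormal ℝ w) (f : EuclideanSpace ℝ (Fin p)) (ℓ : Fin p) :
    inner ℝ (w ℓ) (synth w f) = f ℓ :=
  hw.inner_right_fintype f ℓ

theorem norm_synth (hw : Orthonormal ℝ w) (f : EuclideanSpace ℝ (Fin p)) :
    ‖synth w f‖ = ‖f‖ := by
  have h : ‖synth w f‖ ^ 2 = ‖f‖ ^ 2 := by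
    rw [← real_inner_self_eq_norm_sq, ← real_inner_self_eq_norm_sq]
    nth_rewrite 1 [synth_apply]
    rw [sum_inner, PiLp.inner_apply]
    refine Finset.sum_congr rfl fun ℓ _ => ?_
    rw [real_inner_smul_left, inner_synth hw]
    simp [sq]
  exact (sq_eq_sq₀ (norm_nonneg _) (norm_nonneg _)).1 h

/-- The operator on `E` with eigenvectors `w_ℓ` and eigenvalues `d_ℓ`, zero on the complement. -/
noncomputable def diagOp (w : Fin p → E) (d : Fin p → ℝ) : E →L[ℝ] E :=
  ∑ ℓ, (innerSL ℝ (w ℓ)).smulRight (d ℓ • w ℓ)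

theorem diagOp_apply (w : Fin p → E) (d : Fin p → ℝ) (f : E) :
    diagOp w d f = ∑ ℓ, (inner ℝ (w ℓ) f * d ℓ) • w ℓ := by
  simp [diagOp, smul_smul]

theorem inner_diagOp (hw : Orthonormal ℝ w) (d : Fin p → ℝ) (f : E) (ℓ : Fin p) :
    inner ℝ (w ℓ) (diagOp w d f) = inner ℝ (w ℓ) f * d ℓ := by
  rw [diagOp_apply, hw.inner_right_fintype]

theorem diagOp_mul (hw : Orthonormal ℝ w) (d e : Fin p → ℝ) :
    diagOp w d * diagOp w e = diagOp w fun ℓ => d ℓ * e ℓ := by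
  ext f
  rw [mul_apply_eq_comp, diagOp_apply w d, diagOp_apply w fun ℓ => d ℓ * e ℓ]
  refine Finset.sum_congr rfl fun ℓ _ => ?_
  rw [inner_diagOp hw]
  congr 1
  ring

theorem diagOp_synth (hw : Orthonormal ℝ w) (d : Fin p → ℝ) (f : EuclideanSpace ℝ (Fin p)) :
    diagOp w d (synth w f) = synth w (diagMap d f) := by
  rw [diagOp_apply, synth_apply w (diagMap d f)]
  refine Finset.sum_congr rfl fun ℓ _ => ?_
  rw [inner_synth hw, diagMap_apply, mul_comm]

theorem starProjection_span_eq (hw : Orthonormal ℝ w)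
    [(Submodule.span ℝ (Set.range w)).HasOrthogonalProjection] :
    (Submodule.span ℝ (Set.range w)).starProjection = diagOp w fun _ => 1 := by
  ext f
  refine Submodule.eq_starProjection_of_mem_of_inner_eq_zero ?_ ?_
  · rw [diagOp_apply]
    exact Submodule.sum_mem _ fun ℓ _ => Submodule.smul_mem _ _ (Submodule.subset_span ⟨ℓ, rfl⟩)
  · intro g hg
    refine Submodule.span_induction ?_ (by simp) ?_ ?_ hg
    · rintro _ ⟨ℓ, rfl⟩
      rw [real_inner_comm, inner_sub_right, inner_diagOp hw, mul_one, sub_self]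
    · intro a b _ _ h1 h2
      rw [inner_add_right, h1, h2, add_zero]
    · intro a b _ h1
      rw [real_inner_smul_right, h1, mul_zero]

/-- With `s` the claimed entries, `a s = n d - n d s` shows that `a⁻¹ (1 - diagOp w s)` is a
two-sided inverse of `a + n diagOp w d` on the whole space. -/
theorem mul_inverse_diagOp (hw : Orthonormal ℝ w) {d : Fin p → ℝ} (hd : ∀ ℓ, 0 ≤ d ℓ) {n a : ℝ}
    (hn : 0 ≤ n) (ha : 0 < a) :
    (n • diagOp w d) * Ring.inverse (a • 1 + n • diagOp w d)
      = diagOp w fun ℓ => n * d ℓ / (a + n * d ℓ) := by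
  set s : Fin p → ℝ := fun ℓ => n * d ℓ / (a + n * d ℓ) with hs
  have hpos : ∀ ℓ, a + n * d ℓ ≠ 0 := fun ℓ => by
    have := mul_nonneg hn (hd ℓ)
    linarith
  have hadd : ∀ d e : Fin p → ℝ, diagOp w d + diagOp w e = diagOp w fun ℓ => d ℓ + e ℓ := by
    intro d e
    simp only [diagOp, ← Finset.sum_add_distrib]
    refine Finset.sum_congr rfl fun ℓ _ => ?_
    ext f
    simp [add_smul]
  have hsmul : ∀ (r : ℝ) (d : Fin p → ℝ), r • diagOp w d = diagOp w fun ℓ => r * d ℓ := by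
    intro r d
    ext f
    simp only [smul_apply, diagOp_apply, Finset.smul_sum, smul_smul]
    refine Finset.sum_congr rfl fun ℓ _ => ?_
    congr 1
    ring
  have hsub : ∀ d e : Fin p → ℝ, diagOp w d - diagOp w e = diagOp w fun ℓ => d ℓ - e ℓ := by
    intro d e
    rw [sub_eq_iff_eq_add, hadd]
    simp
  have key : a • diagOp w s = n • diagOp w d - (n • diagOp w d) * diagOp w s := by
    rw [hsmul, hsmul, diagOp_mul hw, hsub]
    congr 1
    funext ℓ
    have := hpos ℓ
    simp only [hs]
    field_simp
    ring
  have hcomm : (n • diagOp w d) * diagOp w s = diagOp w s * (n • diagOp w d) := by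
    rw [hsmul, diagOp_mul hw, diagOp_mul hw]
    simp only [mul_comm]
  set Tn := n • diagOp w d with hT
  set Sn := diagOp w s with hS
  have h1 : (a • 1 + Tn) * (a⁻¹ • (1 - Sn)) = 1 := by
    rw [mul_smul_comm, mul_sub, mul_one, add_mul, smul_mul_assoc, one_mul, key,
      show a • 1 + Tn - (Tn - Tn * Sn + Tn * Sn) = a • (1 : E →L[ℝ] E) by abel, smul_smul,
      inv_mul_cancel₀ ha.ne', one_smul]
  have h2 : (a⁻¹ • (1 - Sn)) * (a • 1 + Tn) = 1 := by
    rw [smul_mul_assoc, sub_mul, one_mul, mul_add, mul_smul_comm, mul_one, ← hcomm, key,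
      show a • 1 + Tn - (Tn - Tn * Sn + Tn * Sn) = a • (1 : E →L[ℝ] E) by abel, smul_smul,
      inv_mul_cancel₀ ha.ne', one_smul]
  have h3 : Ring.inverse (a • 1 + Tn) = a⁻¹ • (1 - Sn) :=
    Ring.inverse_unit (⟨a • 1 + Tn, a⁻¹ • (1 - Sn), h1, h2⟩ : (E →L[ℝ] E)ˣ)
  rw [h3, mul_smul_comm, mul_sub, mul_one, ← key, smul_smul, inv_mul_cancel₀ ha.ne', one_smul]

end Orthonormal

/-! ### Features -/

section Features

variable {X : Type*} {p : ℕ}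

/-- The vector `(v_0 t, …, v_{p-1} t)`. -/
noncomputable def feature (v : ℕ → X → ℝ) (p : ℕ) (t : X) : EuclideanSpace ℝ (Fin p) :=
  WithLp.toLp 2 fun ℓ => v ℓ t

theorem feature_apply (v : ℕ → X → ℝ) (t : X) (ℓ : Fin p) : feature v p t ℓ = v ℓ t := rfl

theorem norm_feature_sq (v : ℕ → X → ℝ) (t : X) :
    ‖feature v p t‖ ^ 2 = ∑ ℓ ∈ Finset.range p, v ℓ t ^ 2 := by
  rw [EuclideanSpace.norm_sq_eq, Finset.sum_range]
  simp [feature_apply]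

theorem inner_feature (v : ℕ → X → ℝ) (f : EuclideanSpace ℝ (Fin p)) (t : X) :
    inner ℝ f (feature v p t) = ∑ ℓ, f ℓ * v ℓ t := by
  rw [PiLp.inner_apply]
  refine Finset.sum_congr rfl fun ℓ _ => ?_
  simp [feature_apply, mul_comm]

variable {ι : Type*} [Fintype ι]

/-- Sampling of `∑ f_ℓ v_ℓ` at the points `x`. -/
noncomputable def sampling (v : ℕ → X → ℝ) (p : ℕ) (x : ι → X) :
    EuclideanSpace ℝ (Fin p) →ₗ[ℝ] EuclideanSpace ℝ ι where
  toFun f := WithLp.toLp 2 fun j => inner ℝ f (feature v p (x j))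
  map_add' f g := by ext j; simp [inner_add_left]
  map_smul' a f := by ext j; simp [real_inner_smul_left]

/-- The transpose of the sampling map. -/
noncomputable def samplingT (v : ℕ → X → ℝ) (p : ℕ) (x : ι → X) :
    EuclideanSpace ℝ ι →ₗ[ℝ] EuclideanSpace ℝ (Fin p) where
  toFun w := ∑ j, w j • feature v p (x j)
  map_add' f g := by simp [add_smul, Finset.sum_add_distrib]
  map_smul' a f := by simp [Finset.smul_sum, smul_smul]

omit [Fintype ι] in
theorem sampling_apply (v : ℕ → X → ℝ) (x : ι → X) (f : EuclideanSpace ℝ (Fin p)) (j : ι) :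
    sampling v p x f j = inner ℝ f (feature v p (x j)) := rfl

theorem samplingT_apply (v : ℕ → X → ℝ) (x : ι → X) (w : EuclideanSpace ℝ ι) :
    samplingT v p x w = ∑ j, w j • feature v p (x j) := rfl

theorem inner_sampling (v : ℕ → X → ℝ) (x : ι → X) (f : EuclideanSpace ℝ (Fin p))
    (w : EuclideanSpace ℝ ι) : inner ℝ (sampling v p x f) w = inner ℝ f (samplingT v p x w) := by
  rw [samplingT_apply, inner_sum, PiLp.inner_apply]
  refine Finset.sum_congr rfl fun j _ => ?_
  rw [real_inner_smul_right, sampling_apply]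
  simp

end Features

/-! ### The leading eigenspace in coordinates -/

namespace EigenSystem

variable {X : Type*} [MeasurableSpace X] {μ : Measure X} {k : X → X → ℝ} (S : EigenSystem k μ)
  {p : ℕ}

theorem orthonormal_vL (hp : (p : ℕ∞) ≤ S.N) : Orthonormal ℝ fun ℓ : Fin p => S.vL ℓ := by
  rw [orthonormal_iff_ite]
  intro ℓ m
  have hN : ∀ ℓ : Fin p, ((ℓ : ℕ) : ℕ∞) < S.N := fun ℓ =>
    lt_of_lt_of_le (by exact_mod_cast ℓ.2) hp
  have h1 := S.orthonormal ℓ m (hN ℓ) (hN m)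
  rw [L2.inner_def]
  simp only [Fin.val_inj] at h1
  rw [← h1]
  refine integral_congr_ae ?_
  filter_upwards [(S.memLp ℓ).coeFn_toLp, (S.memLp m).coeFn_toLp] with t e1 e2
  simp only [vL, e1, e2]
  simp [mul_comm]

theorem G_eq (p : ℕ) : S.G p = Submodule.span ℝ (Set.range fun ℓ : Fin p => S.vL ℓ) := by
  rw [G]
  congr 1
  ext f
  constructor
  · rintro ⟨ℓ, h, rfl⟩
    exact ⟨⟨ℓ, h⟩, rfl⟩
  · rintro ⟨ℓ, rfl⟩
    exact ⟨ℓ, ℓ.2, rfl⟩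

theorem starProjection_G (hp : (p : ℕ∞) ≤ S.N) :
    (S.G p).starProjection = diagOp (fun ℓ : Fin p => S.vL ℓ) fun _ => 1 := by
  have : FiniteDimensional ℝ (Submodule.span ℝ (Set.range fun ℓ : Fin p => S.vL ℓ)) :=
    FiniteDimensional.span_of_finite ℝ (Set.finite_range _)
  rw [← starProjection_span_eq (S.orthonormal_vL hp)]
  congr 1
  exact S.G_eq p

theorem exists_eq_synth {η : Lp ℝ 2 μ} (hη : η ∈ S.G p) :
    ∃ f : EuclideanSpace ℝ (Fin p), η = synth (fun ℓ : Fin p => S.vL ℓ) f := by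
  rw [G_eq] at hη
  obtain ⟨c, hc⟩ := (Submodule.mem_span_range_iff_exists_fun ℝ).1 hη
  exact ⟨WithLp.toLp 2 c, hc.symm⟩

theorem coeFn_synth (f : EuclideanSpace ℝ (Fin p)) :
    (synth (fun ℓ : Fin p => S.vL ℓ) f : X → ℝ)
      =ᵐ[μ] fun t => inner ℝ f (feature S.v p t) := by
  rw [synth_apply]
  have h1 := Lp.coeFn_fun_finsetSum (μ := μ) (p := 2) Finset.univ fun ℓ : Fin p => f ℓ • S.vL ℓ
  have h2 : ∀ᵐ t ∂μ, ∀ ℓ : Fin p, (f ℓ • S.vL ℓ : Lp ℝ 2 μ) t = f ℓ * S.v ℓ t := by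
    refine ae_all_iff.2 fun ℓ => ?_
    filter_upwards [Lp.coeFn_smul (f ℓ) (S.vL ℓ), (S.memLp ℓ).coeFn_toLp] with t e1 e2
    rw [e1, Pi.smul_apply, vL, e2, smul_eq_mul]
  filter_upwards [h1, h2] with t e1 e2
  rw [e1, inner_feature]
  exact Finset.sum_congr rfl fun ℓ _ => e2 ℓ

theorem integral_inner_feature_mul (hp : (p : ℕ∞) ≤ S.N) (f g : EuclideanSpace ℝ (Fin p)) :
    ∫ t, inner ℝ f (feature S.v p t) * inner ℝ g (feature S.v p t) ∂μ = inner ℝ f g := by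
  have h1 : inner ℝ (synth (fun ℓ : Fin p => S.vL ℓ) f) (synth (fun ℓ : Fin p => S.vL ℓ) g)
      = inner ℝ f g := by
    nth_rewrite 1 [synth_apply]
    rw [sum_inner, PiLp.inner_apply]
    refine Finset.sum_congr rfl fun ℓ _ => ?_
    rw [real_inner_smul_left, inner_synth (S.orthonormal_vL hp)]
    simp [mul_comm]
  rw [← h1, L2.inner_def]
  refine integral_congr_ae ?_
  filter_upwards [S.coeFn_synth f, S.coeFn_synth g] with t e1 e2
  rw [e1, e2]
  simp [mul_comm]

theorem C_synth (hp : (p : ℕ∞) ≤ S.N) {ι : Type*} [Fintype ι] (x : ι → X)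
    (f : EuclideanSpace ℝ (Fin p)) :
    S.C p x (synth (fun ℓ : Fin p => S.vL ℓ) f) = sampling S.v p x f := by
  ext j
  rw [sampling_apply, inner_feature, C, Finset.sum_range, sum_apply]
  have : ∀ ℓ : Fin p, inner ℝ (S.vL ℓ) (synth (fun ℓ : Fin p => S.vL ℓ) f) = f ℓ := fun ℓ =>
    inner_synth (S.orthonormal_vL hp) f ℓ
  simp [this]

theorem adjoint_C_apply {ι : Type*} [Fintype ι] (x : ι → X) (w : EuclideanSpace ℝ ι) :
    (S.C p x).adjoint w = synth (fun ℓ : Fin p => S.vL ℓ) (samplingT S.v p x w) := by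
  refine ext_inner_right ℝ fun f => ?_
  rw [ContinuousLinearMap.adjoint_inner_left, C, Finset.sum_range,
    sum_apply, inner_sum, synth_apply, sum_inner]
  refine Finset.sum_congr rfl fun ℓ _ => ?_
  rw [ContinuousLinearMap.smulRight_apply, innerSL_apply_apply, real_inner_smul_right,
    real_inner_smul_left, mul_comm, samplingT_apply, PiLp.inner_apply]
  congr 1
  simp [feature_apply, mul_comm]

theorem norm_covariance_le (hp : (p : ℕ∞) ≤ S.N) {ι : Type*} [Fintype ι] (x : ι → X) (n : ℝ)
    (f : EuclideanSpace ℝ (Fin p)) :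
    ‖samplingT S.v p x (sampling S.v p x f) - n • f‖
      ≤ ‖(S.C p x).adjoint ∘L S.C p x - n • (S.G p).starProjection‖ * ‖f‖ := by
  have hw := S.orthonormal_vL hp
  have h1 := ((S.C p x).adjoint ∘L S.C p x - n • (S.G p).starProjection).le_opNorm
    (synth (fun ℓ : Fin p => S.vL ℓ) f)
  have h2 : diagMap (fun _ : Fin p => (1 : ℝ)) f = f := by
    ext ℓ; simp [diagMap_apply]
  rw [norm_synth hw] at h1
  rw [← norm_synth hw, map_sub, map_smul]
  refine le_trans (le_of_eq (congrArg norm ?_)) h1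
  rw [sub_apply, ContinuousLinearMap.comp_apply, S.C_synth hp, adjoint_C_apply, smul_apply,
    S.starProjection_G hp, diagOp_synth hw, h2]

end EigenSystem

namespace EigenSystem

variable {X : Type*} [MeasurableSpace X] {μ : Measure X}
  {H : Type*} [NormedAddCommGroup H] [InnerProductSpace ℝ H] [CompleteSpace H] [RKHS ℝ H X ℝ]
  (S : EigenSystem (ker H) μ) {p : ℕ}

theorem TG_eq (hH : ∀ f : H, MemLp (fun x => f x) 2 μ) (hp : (p : ℕ∞) ≤ S.N) :
    S.TG p = diagOp (fun ℓ : Fin p => S.vL ℓ) fun ℓ => S.lam ℓ := by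
  have hT : ∀ ℓ : Fin p, kernelOperator (ker H) μ (S.vL ℓ) = S.lam ℓ • S.vL ℓ := by
    intro ℓ
    apply Lp.ext
    filter_upwards [kernelOperator_spec hH (S.vL ℓ), Lp.coeFn_smul (S.lam ℓ) (S.vL ℓ),
      (S.memLp ℓ).coeFn_toLp] with t e1 e2 e3
    rw [e1, e2, Pi.smul_apply, vL, e3, smul_eq_mul,
      ← S.eigen ℓ (lt_of_lt_of_le (by exact_mod_cast ℓ.2) hp)]
    refine integral_congr_ae ?_
    filter_upwards [(S.memLp ℓ).coeFn_toLp] with r hr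
    rw [hr]
  ext1 f
  rw [TG, ContinuousLinearMap.comp_apply, S.starProjection_G hp, diagOp_apply, diagOp_apply,
    map_sum]
  refine Finset.sum_congr rfl fun ℓ _ => ?_
  rw [map_smul, hT, smul_smul, mul_one]

/-- The eigenvalues `n λ / (a + n λ)` of the survival operator. -/
noncomputable def survivalFactor (p n : ℕ) (a : ℝ) (ℓ : Fin p) : ℝ :=
  n * S.lam ℓ / (a + n * S.lam ℓ)

theorem survival_synth (hH : ∀ f : H, MemLp (fun x => f x) 2 μ) (hp : (p : ℕ∞) ≤ S.N)
    (hl : ∀ ℓ < p, 0 < S.lam ℓ) (n : ℕ) {a : ℝ} (ha : 0 < a) (f : EuclideanSpace ℝ (Fin p)) :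
    S.survival p n a (synth (fun ℓ : Fin p => S.vL ℓ) f)
      = synth (fun ℓ : Fin p => S.vL ℓ) (diagMap (S.survivalFactor p n a) f) := by
  have hw := S.orthonormal_vL hp
  rw [survival, S.TG_eq hH hp, mul_inverse_diagOp hw (fun ℓ => (hl ℓ ℓ.2).le) n.cast_nonneg ha,
    diagOp_synth hw]
  rfl

theorem bias_synth (hH : ∀ f : H, MemLp (fun x => f x) 2 μ) (hp : (p : ℕ∞) ≤ S.N)
    (hl : ∀ ℓ < p, 0 < S.lam ℓ) (n : ℕ) {a : ℝ} (ha : 0 < a) (f : EuclideanSpace ℝ (Fin p)) :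
    S.bias p n a (synth (fun ℓ : Fin p => S.vL ℓ) f)
      = synth (fun ℓ : Fin p => S.vL ℓ) (f - diagMap (S.survivalFactor p n a) f) := by
  rw [bias, sub_apply, S.survival_synth hH hp hl n ha, map_sub]
  rfl

end EigenSystem

section SupNorm

variable {X : Type*} [MeasurableSpace X] {μ : Measure X} {k : X → X → ℝ} (S : EigenSystem k μ)
  {p : ℕ}

theorem EigenSystem.abs_inner_feature_le_supNorm {B : ℝ}
    (hB : ∀ᵐ t ∂μ, ‖feature S.v p t‖ ≤ B) (f : EuclideanSpace ℝ (Fin p)) :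
    ∀ᵐ t ∂μ, |inner ℝ f (feature S.v p t)|
      ≤ supNorm (synth (fun ℓ : Fin p => S.vL ℓ) f) := by
  -- `supNorm` is a `toReal`, hence zero for an unbounded function; bounded features exclude that
  -- case.
  have h1 : eLpNorm (synth (fun ℓ : Fin p => S.vL ℓ) f) ∞ μ ≠ ∞ := by
    rw [eLpNorm_exponent_top]
    refine ne_top_of_le_ne_top ENNReal.ofReal_ne_top
      (eLpNormEssSup_le_of_ae_bound (C := ‖f‖ * B) ?_)
    filter_upwards [S.coeFn_synth f, hB] with t e1 e2
    rw [e1]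
    exact (norm_inner_le_norm _ _).trans (mul_le_mul_of_nonneg_left e2 (norm_nonneg _))
  filter_upwards [S.coeFn_synth f,
    enorm_ae_le_eLpNormEssSup (synth (fun ℓ : Fin p => S.vL ℓ) f) μ] with t e1 e2
  rw [← eLpNorm_exponent_top, e1] at e2
  rw [supNorm, ← Real.norm_eq_abs, ← toReal_enorm]
  exact ENNReal.toReal_mono h1 e2

/-- The `L₂` norm is at most the `L_∞` norm on a probability space, and coordinates are isometric.
-/
theorem EigenSystem.norm_le_of_abs_inner_feature_le [IsProbabilityMeasure μ]
    (hp : (p : ℕ∞) ≤ S.N) {B : ℝ} (hB0 : 0 ≤ B) {f : EuclideanSpace ℝ (Fin p)}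
    (hB : ∀ᵐ t ∂μ, |inner ℝ f (feature S.v p t)| ≤ B) : ‖f‖ ≤ B := by
  refine abs_le_of_sq_le_sq' ?_ hB0 |>.2
  rw [← real_inner_self_eq_norm_sq, ← S.integral_inner_feature_mul hp]
  have h := norm_integral_le_of_norm_le_const (μ := μ) (C := B ^ 2)
    (f := fun t => inner ℝ f (feature S.v p t) * inner ℝ f (feature S.v p t)) (by
      filter_upwards [hB] with t ht
      rw [norm_mul, Real.norm_eq_abs, ← sq]
      gcongr)
  rw [probReal_univ, mul_one] at h
  exact (le_abs_self _).trans h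

end SupNorm

/-! ### Vectors with one index left out, and Gram operators -/

section Extend

variable {n : ℕ}

theorem sum_extend {E : Type*} [AddCommMonoid E] (i : Fin n) (g : {j // j ≠ i} → E) :
    ∑ j, (if h : j ≠ i then g ⟨j, h⟩ else 0) = ∑ j, g j := by
  rw [← Fintype.sum_subtype_add_sum_subtype (fun j => j ≠ i)]
  rw [Finset.sum_congr rfl fun (j : {j // j ≠ i}) _ => dif_pos j.2,
    Finset.sum_congr rfl fun (j : {j // ¬ j ≠ i}) _ => dif_neg j.2]
  simp

/-- Extension by zero of a vector indexed by the points other than the `i`-th. -/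
noncomputable def extend (i : Fin n) (w : {j // j ≠ i} → ℝ) : EuclideanSpace ℝ (Fin n) :=
  WithLp.toLp 2 fun j => if h : j ≠ i then w ⟨j, h⟩ else 0

theorem extend_self (i : Fin n) (w : {j // j ≠ i} → ℝ) : extend i w i = 0 := by
  simp [extend]

theorem sum_extend_smul {E : Type*} [AddCommGroup E] [Module ℝ E] (i : Fin n)
    (w : {j // j ≠ i} → ℝ) (z : Fin n → E) :
    ∑ j, extend i w j • z j = ∑ j : {j // j ≠ i}, w j • z j := by
  rw [← sum_extend i fun j => w j • z j]
  refine Finset.sum_congr rfl fun j _ => ?_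
  simp only [extend]
  split_ifs <;> simp

theorem sum_extend_mul (i : Fin n) (w : {j // j ≠ i} → ℝ) (z : Fin n → ℝ) :
    ∑ j, extend i w j * z j = ∑ j : {j // j ≠ i}, w j * z j :=
  sum_extend_smul i w z

theorem norm_extend (i : Fin n) (w : EuclideanSpace ℝ {j // j ≠ i}) : ‖extend i w‖ = ‖w‖ := by
  have h : ‖extend i w‖ ^ 2 = ‖w‖ ^ 2 := by
    rw [EuclideanSpace.norm_sq_eq, EuclideanSpace.norm_sq_eq, ← sum_extend i fun j => ‖w j‖ ^ 2]
    refine Finset.sum_congr rfl fun j _ => ?_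
    simp only [extend]
    split_ifs <;> simp
  exact (sq_eq_sq₀ (norm_nonneg _) (norm_nonneg _)).1 h

end Extend

section Gram

variable {E : Type*} [NormedAddCommGroup E] [InnerProductSpace ℝ E] {ι : Type*} [Fintype ι]

/-- The Gram operator of a family of vectors. -/
noncomputable def gramOp (z : ι → E) : EuclideanSpace ℝ ι →ₗ[ℝ] EuclideanSpace ℝ ι where
  toFun w := WithLp.toLp 2 fun j => inner ℝ (z j) (∑ k, w k • z k)
  map_add' f g := by ext j; simp [add_smul, Finset.sum_add_distrib, inner_add_right]
  map_smul' a f := by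
    ext j
    simp only [PiLp.smul_apply, RingHom.id_apply, smul_eq_mul, mul_smul]
    rw [← Finset.smul_sum, real_inner_smul_right]

theorem gramOp_apply (z : ι → E) (w : EuclideanSpace ℝ ι) (j : ι) :
    gramOp z w j = inner ℝ (z j) (∑ k, w k • z k) := rfl

theorem inner_gramOp (z : ι → E) (v w : EuclideanSpace ℝ ι) :
    inner ℝ v (gramOp z w) = inner ℝ (∑ j, v j • z j) (∑ j, w j • z j) := by
  rw [sum_inner, PiLp.inner_apply]
  refine Finset.sum_congr rfl fun j _ => ?_
  rw [real_inner_smul_left, gramOp_apply]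
  simp [mul_comm]

theorem gramOp_symm (z : ι → E) : (gramOp z).IsSymmetric := by
  intro v w
  rw [real_inner_comm, inner_gramOp, inner_gramOp, real_inner_comm]

/-- `extend i w` vanishes at `i`, so subtracting the midpoint multiple of the identity does not
change the `i`-th entry of its image. The off-diagonal row is thus bounded by the half-width `(b -
a) / 2` rather than by `b`. -/
theorem norm_cross_gram_le {n : ℕ} {z : Fin n → E} {a b : ℝ}
    (hl : ∀ w : EuclideanSpace ℝ (Fin n), a * ‖w‖ ^ 2 ≤ ‖∑ j, w j • z j‖ ^ 2)
    (hu : ∀ w : EuclideanSpace ℝ (Fin n), ‖∑ j, w j • z j‖ ^ 2 ≤ b * ‖w‖ ^ 2)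
    (i : Fin n) (w : EuclideanSpace ℝ {j // j ≠ i}) :
    |∑ j : {j // j ≠ i}, w j * inner ℝ (z i) (z j)| ≤ (b - a) / 2 * ‖w‖ := by
  have h1 := norm_sub_midpoint_le (gramOp_symm z) (a := a) (b := b)
    (fun w => by rw [inner_gramOp, real_inner_self_eq_norm_sq]; exact hl w)
    (fun w => by rw [inner_gramOp, real_inner_self_eq_norm_sq]; exact hu w) (extend i w)
  rw [norm_extend] at h1
  refine le_trans (le_of_eq ?_) ((PiLp.norm_apply_le _ i).trans h1)
  rw [PiLp.sub_apply, PiLp.smul_apply, extend_self, smul_zero, sub_zero, gramOp_apply,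
    sum_extend_smul, inner_sum, Real.norm_eq_abs]
  simp only [real_inner_smul_right]

end Gram

/-! ### The leave-one-out interpolant -/

section LeaveOneOut

variable {X : Type*} {H : Type*} [NormedAddCommGroup H] [InnerProductSpace ℝ H] [CompleteSpace H]
  [RKHS ℝ H X ℝ]

/-- The kernel matrix of a family of points. -/
noncomputable def kerMatrix (H : Type*) [NormedAddCommGroup H] [InnerProductSpace ℝ H]
    [CompleteSpace H] [RKHS ℝ H X ℝ] {ι : Type*} (z : ι → X) : Matrix ι ι ℝ :=
  Matrix.of fun j k => ker H (z j) (z k)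

theorem kerMatrix_transpose {ι : Type*} (z : ι → X) :
    (kerMatrix H z).transpose = kerMatrix H z := by
  ext j k
  exact ker_comm _ _

variable {n : ℕ}

/-- The interpolant of the points other than the `i`-th has the value `∑ j, looWeight x i j * y j`
at the `i`-th point. -/
noncomputable def looWeight (H : Type*) [NormedAddCommGroup H] [InnerProductSpace ℝ H]
    [CompleteSpace H] [RKHS ℝ H X ℝ] (x : Fin n → X) (i : Fin n) :
    EuclideanSpace ℝ (Fin n) :=
  extend i ((kerMatrix H fun j : {j // j ≠ i} => x j)⁻¹.mulVec fun j : {j // j ≠ i} => ker H (x i) (x j))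

theorem proliferation_of_looWeight {x : Fin n → X} {y : Fin n → ℝ}
    (hy : ∀ i, y i = 1 ∨ y i = -1) (hK : IsUnit (kerMatrix H x))
    (hKi : ∀ i : Fin n, IsUnit (kerMatrix H fun j : {j // j ≠ i} => x j))
    (h : ∀ i, y i * ∑ j, looWeight H x i j * y j < 1) : Proliferation H x y := by
  have hβ : (kerMatrix H x).mulVec ((kerMatrix H x)⁻¹.mulVec y) = y := by
    rw [Matrix.mulVec_mulVec, Matrix.mul_nonsing_inv _ ((Matrix.isUnit_iff_isUnit_det _).1 hK),
      Matrix.one_mulVec]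
  set β := (kerMatrix H x)⁻¹.mulVec y with hβdef
  have hβ' : ∀ i, ∑ j, β j * ker H (x i) (x j) = y i := fun i => by
    rw [← congrFun hβ i, Matrix.mulVec, dotProduct]
    exact Finset.sum_congr rfl fun j _ => mul_comm _ _
  refine proliferation_of_dual_nonneg hy hβ' fun i => ?_
  set K := kerMatrix H fun j : {j // j ≠ i} => x j with hKdef
  set w : {j // j ≠ i} → ℝ := K⁻¹.mulVec fun j : {j // j ≠ i} => y j with hw
  have hKw : K.mulVec w = fun j : {j // j ≠ i} => y j := by
    rw [hw, Matrix.mulVec_mulVec,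
      Matrix.mul_nonsing_inv _ ((Matrix.isUnit_iff_isUnit_det _).1 (hKi i)), Matrix.one_mulVec]
  refine dual_sign_of_leaveOneOut hy hβ' (w := extend i w) (extend_self i w) ?_ ?_
  · intro j hj
    rw [sum_extend_mul i w fun k => ker H (x j) (x k), ← congrFun hKw ⟨j, hj⟩, Matrix.mulVec,
      dotProduct]
    exact Finset.sum_congr rfl fun k _ => mul_comm _ _
  · refine lt_of_eq_of_lt ?_ (h i)
    congr 1
    rw [sum_extend_mul i w fun k => ker H (x i) (x k), looWeight, sum_extend_mul i _ y]
    -- Symmetry of `K⁻¹` moves it from the labels to the kernel row, which makes the weights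
    -- independent of the labels.
    change w ⬝ᵥ (fun k : {j // j ≠ i} => ker H (x i) (x k))
      = (K⁻¹.mulVec fun j : {j // j ≠ i} => ker H (x i) (x j)) ⬝ᵥ fun j : {j // j ≠ i} => y j
    have hT : K⁻¹.transpose = K⁻¹ := by
      rw [Matrix.transpose_nonsing_inv, hKdef, kerMatrix_transpose]
    rw [hw, ← Matrix.vecMul_transpose, hT, ← Matrix.dotProduct_mulVec, dotProduct_comm]

end LeaveOneOut

/-! ### Good samples as ridge systems -/

section Good

variable {X : Type*} [MeasurableSpace X] {μ : Measure X}
  {H : Type*} [NormedAddCommGroup H] [InnerProductSpace ℝ H] [CompleteSpace H] [RKHS ℝ H X ℝ]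
  {S : EigenSystem (ker H) μ} {p : ℕ}

theorem kerMatrix_mulVec (hH : ∀ f : H, MemLp (fun x => f x) 2 μ) (hp : (p : ℕ∞) ≤ S.N)
    (hl : ∀ ℓ < p, 0 < S.lam ℓ) {ι : Type*} [Fintype ι] (z : ι → X) (w : EuclideanSpace ℝ ι)
    (t : X) :
    ∑ k, w k * ker H t (z k)
      = inner ℝ (diagMap (fun ℓ : Fin p => S.lam ℓ) (samplingT S.v p z w)) (feature S.v p t)
        + inner ℝ (residual H S.v p t) (∑ k, w k • residual H S.v p (z k)) := by
  rw [inner_sum, diagMap_symm, samplingT_apply, sum_inner, ← Finset.sum_add_distrib]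
  refine Finset.sum_congr rfl fun k _ => ?_
  rw [S.ker_eq hH hp hl t (z k), real_inner_smul_left, real_inner_smul_right,
    PiLp.inner_apply, Finset.sum_range, mul_add]
  congr 2

/-- The part of the kernel matrix coming from `G` is positive semidefinite, so the lower bound on
the residual Gram form already makes the matrix definite. -/
theorem isUnit_kerMatrix (hH : ∀ f : H, MemLp (fun x => f x) 2 μ) (hp : (p : ℕ∞) ≤ S.N)
    (hl : ∀ ℓ < p, 0 < S.lam ℓ) {ι : Type*} [Fintype ι] [DecidableEq ι] {z : ι → X} {a : ℝ}
    (ha : 0 < a)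
    (hz : ∀ w : EuclideanSpace ℝ ι, a * ‖w‖ ^ 2 ≤ ‖∑ j, w j • residual H S.v p (z j)‖ ^ 2) :
    IsUnit (kerMatrix H z) := by
  rw [← Matrix.mulVec_injective_iff_isUnit]
  refine (injective_iff_map_eq_zero (kerMatrix H z).mulVecLin).2 fun w hw => ?_
  have h0 : ∀ j, ∑ k, w k * ker H (z j) (z k) = 0 := fun j => by
    rw [← show (kerMatrix H z).mulVecLin w j = 0 by rw [hw]; rfl, Matrix.mulVecLin_apply,
      Matrix.mulVec, dotProduct]
    exact Finset.sum_congr rfl fun k _ => mul_comm _ _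
  set v : EuclideanSpace ℝ ι := WithLp.toLp 2 w with hv
  have h1 : ∑ j, v j * ∑ k, v k * ker H (z j) (z k) = 0 :=
    Finset.sum_eq_zero fun j _ => by rw [show ∑ k, v k * ker H (z j) (z k) = 0 from h0 j, mul_zero]
  simp only [kerMatrix_mulVec hH hp hl z v] at h1
  have h2 : ∑ j, v j * (inner ℝ (diagMap (fun ℓ : Fin p => S.lam ℓ) (samplingT S.v p z v))
        (feature S.v p (z j))
      + inner ℝ (residual H S.v p (z j)) (∑ k, v k • residual H S.v p (z k)))
      = inner ℝ (diagMap (fun ℓ : Fin p => S.lam ℓ) (samplingT S.v p z v)) (samplingT S.v p z v)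
        + ‖∑ k, v k • residual H S.v p (z k)‖ ^ 2 := by
    rw [← real_inner_self_eq_norm_sq]
    have e1 : ∀ f, inner ℝ f (samplingT S.v p z v)
        = ∑ j, v j * inner ℝ f (feature S.v p (z j)) := fun f => by
      rw [samplingT_apply, inner_sum]
      simp only [real_inner_smul_right]
    have e2 : ∀ r, inner ℝ (∑ k, v k • residual H S.v p (z k)) r
        = ∑ k, v k * inner ℝ (residual H S.v p (z k)) r := fun r => by
      rw [sum_inner]
      simp only [real_inner_smul_left]
    rw [e1, e2, ← Finset.sum_add_distrib]
    simp only [mul_add]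
  rw [h2] at h1
  have h3 : 0 ≤ inner ℝ (diagMap (fun ℓ : Fin p => S.lam ℓ) (samplingT S.v p z v))
      (samplingT S.v p z v) := by
    rw [PiLp.inner_apply]
    refine Finset.sum_nonneg fun ℓ _ => ?_
    simp only [diagMap_apply, RCLike.inner_apply, conj_trivial]
    have := hl ℓ ℓ.2
    nlinarith [mul_nonneg this.le (mul_self_nonneg (samplingT S.v p z v ℓ))]
  have h4 := hz v
  have h5 : ‖v‖ ^ 2 ≤ 0 := by
    by_contra h
    have := mul_pos ha (not_le.1 h)
    linarith
  have h6 : v = 0 := by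
    rw [← norm_eq_zero]
    nlinarith [norm_nonneg v]
  simpa [hv] using h6

variable {η : Lp ℝ 2 μ} {αL αU c M : ℝ} {n : ℕ} {x : Fin n → X}

theorem GoodSample.gram_bounds (h : GoodSample S p η αL αU c M x) (i : Fin n)
    (w : EuclideanSpace ℝ {j // j ≠ i}) :
    αL * ‖w‖ ^ 2 ≤ ‖∑ j, w j • residual H S.v p (x j)‖ ^ 2 ∧
      ‖∑ j, w j • residual H S.v p (x j)‖ ^ 2 ≤ αU * ‖w‖ ^ 2 := by
  have h1 := le_norm_sum_residual h.gram_lower (extend i w)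
  have h2 := norm_sum_residual_le h.gram_upper (extend i w)
  rw [norm_extend, sum_extend_smul i w fun j => residual H S.v p (x j)] at h1 h2
  exact ⟨h1, h2⟩

theorem GoodSample.le (h : GoodSample S p η αL αU c M x) (i : Fin n) : αL ≤ αU := by
  have h1 := (le_norm_sum_residual h.gram_lower (EuclideanSpace.single i 1)).trans
    (norm_sum_residual_le h.gram_upper (EuclideanSpace.single i 1))
  simpa using h1

theorem GoodSample.isRidgeSystem (h : GoodSample S p η αL αU c M x) (hp : (p : ℕ∞) ≤ S.N)
    (hl : ∀ ℓ < p, 0 < S.lam ℓ) (hL : 0 < αL) (hc : c ≤ 1 / 2) (i : Fin n) :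
    IsRidgeSystem (sampling S.v p fun j : {j // j ≠ i} => x j)
      (samplingT S.v p fun j : {j // j ≠ i} => x j)
      (gramOp fun j : {j // j ≠ i} => residual H S.v p (x j))
      (diagMap fun ℓ : Fin p => n / harmonicMean αL αU * S.lam ℓ)
      (diagMap (S.survivalFactor p n (harmonicMean αL αU))) n αL αU c := by
  have hn : (0 : ℝ) < n := by exact_mod_cast (Nat.zero_le _).trans_lt i.2
  have hLU := h.le i
  have hU : 0 < αU := hL.trans_le hLU
  have hm : 0 < harmonicMean αL αU := by unfold harmonicMean; positivity
  have hcov := h.covariance i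
  refine ⟨inner_sampling S.v _, gramOp_symm _, fun w => ?_, fun w => ?_, fun f => ?_, fun f => ?_,
    norm_diagMap_le fun ℓ => ?_, diagMap_symm _, hn, hL, hLU, hc, ?_⟩
  · rw [inner_gramOp, real_inner_self_eq_norm_sq]
    exact (h.gram_bounds i w).1
  · rw [inner_gramOp, real_inner_self_eq_norm_sq]
    exact (h.gram_bounds i w).2
  · rw [norm_smul, norm_inv, Real.norm_eq_abs, abs_of_pos hn]
    have h1 := S.norm_covariance_le hp (fun j : {j // j ≠ i} => x j) n f
    have h2 := mul_le_mul_of_nonneg_left h1 (inv_nonneg.2 hn.le)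
    refine h2.trans ?_
    rw [← mul_assoc]
    refine mul_le_mul_of_nonneg_right ?_ (norm_nonneg f)
    rw [inv_mul_eq_div]
    have e : ∀ r : ℝ, r / n = 2 / n * r / 2 := fun r => by ring
    rw [e]
    linarith
  · ext ℓ
    have := hl ℓ ℓ.2
    simp only [diagMap_apply, PiLp.add_apply, EigenSystem.survivalFactor]
    have h1 : 0 < harmonicMean αL αU + n * S.lam ℓ := by positivity
    field_simp
  · have := hl ℓ ℓ.2
    rw [EigenSystem.survivalFactor, abs_of_nonneg (by positivity), div_le_one (by positivity)]
    linarith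
  · have h1 : 0 ≤ 2 / (n : ℝ) * ‖(S.C p fun j : {j // j ≠ i} => x j).adjoint ∘L
        (S.C p fun j : {j // j ≠ i} => x j) - (n : ℝ) • (S.G p).starProjection‖ := by positivity
    linarith

end Good

/-! ### Leave-one-out weights and noiseless predictions -/

section Good

variable {X : Type*} [MeasurableSpace X] {μ : Measure X}
  {H : Type*} [NormedAddCommGroup H] [InnerProductSpace ℝ H] [CompleteSpace H] [RKHS ℝ H X ℝ]
  {S : EigenSystem (ker H) μ} {p : ℕ}

theorem toLp_kerMatrix_mulVec (hH : ∀ f : H, MemLp (fun x => f x) 2 μ) (hp : (p : ℕ∞) ≤ S.N)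
    (hl : ∀ ℓ < p, 0 < S.lam ℓ) {ι : Type*} [Fintype ι] (z : ι → X) (w : EuclideanSpace ℝ ι) :
    WithLp.toLp 2 ((kerMatrix H z).mulVec w)
      = sampling S.v p z (diagMap (fun ℓ : Fin p => S.lam ℓ) (samplingT S.v p z w))
        + gramOp (fun j => residual H S.v p (z j)) w := by
  ext j
  rw [PiLp.add_apply, sampling_apply, gramOp_apply, ← kerMatrix_mulVec hH hp hl z w (z j)]
  exact Finset.sum_congr rfl fun k _ => mul_comm _ _

theorem inner_diagMap_self_nonneg {d : Fin p → ℝ} (hd : ∀ ℓ, 0 ≤ d ℓ)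
    (f : EuclideanSpace ℝ (Fin p)) : 0 ≤ inner ℝ f (diagMap d f) := by
  rw [PiLp.inner_apply]
  refine Finset.sum_nonneg fun ℓ _ => ?_
  simp only [diagMap_apply, RCLike.inner_apply, conj_trivial]
  nlinarith [mul_nonneg (hd ℓ) (mul_self_nonneg (f ℓ))]

variable {η : Lp ℝ 2 μ} {αL αU c M : ℝ} {n : ℕ} {x : Fin n → X}

theorem harmonicMean_smul_diagMap {a : ℝ} (ha : 0 < a) {m : ℝ} (hm : 0 < m)
    (d : Fin p → ℝ) (f : EuclideanSpace ℝ (Fin p)) :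
    (a / m) • diagMap (fun ℓ => m / a * d ℓ) f = diagMap d f := by
  ext ℓ
  simp only [PiLp.smul_apply, diagMap_apply, smul_eq_mul]
  field_simp

/-- `ρ ≤ 1/2` means `αU ≤ 3 αL`, hence `αU + αL ≤ 4 αL`. -/
theorem half_sub_le (hL : 0 < αL) (hLU : αL ≤ αU) (hρ : (αU - αL) / (αU + αL) ≤ 1 / 2) :
    (αU - αL) / 2 ≤ 2 * ((αU - αL) / (αU + αL)) * αL := by
  rw [div_le_iff₀ (by linarith)] at hρ
  rw [mul_div_assoc', div_mul_eq_mul_div, le_div_iff₀ (by linarith)]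
  nlinarith

/-- The kernel row at `x_i` is `Φ Λ u` plus the residual row `q`. The first part is
`norm_coeff_eval_le`. For `a₂ = K⁻¹ q`, coercivity gives `αL ‖a₂‖² ≤ ⟪a₂, q⟫`, and `q` is an
off-diagonal Gram row, of size at most `(αU - αL) / 2`. -/
theorem GoodSample.norm_looWeight_le (h : GoodSample S p η αL αU c M x)
    (hH : ∀ f : H, MemLp (fun x => f x) 2 μ) (hp : (p : ℕ∞) ≤ S.N)
    (hl : ∀ ℓ < p, 0 < S.lam ℓ) (hL : 0 < αL) (hc : c ≤ 1 / 2) (i : Fin n) :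
    ‖looWeight H x i‖ ≤ 4 / √n * ‖feature S.v p (x i)‖ + 2 * ((αU - αL) / (αU + αL)) := by
  have hr := h.isRidgeSystem hp hl hL hc i
  have hU := isUnit_kerMatrix hH hp hl hL fun w => (h.gram_bounds i w).1
  set z : {j // j ≠ i} → X := fun j => x j with hz
  set K := kerMatrix H z with hK
  have hinv : ∀ r, K.mulVec (K⁻¹.mulVec r) = r := fun r => by
    rw [Matrix.mulVec_mulVec, Matrix.mul_nonsing_inv _ ((Matrix.isUnit_iff_isUnit_det _).1 hU),
      Matrix.one_mulVec]
  set u := feature S.v p (x i) with hu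
  set Λ := diagMap (fun ℓ : Fin p => S.lam ℓ) with hΛ
  have hker : (fun j => ker H (x i) (z j)) = (sampling S.v p z (Λ u)).ofLp
      + fun j => inner ℝ (residual H S.v p (x i)) (residual H S.v p (z j)) := by
    funext j
    rw [Pi.add_apply, sampling_apply, S.ker_eq hH hp hl, PiLp.inner_apply, Finset.sum_range]
    congr 1
    refine Finset.sum_congr rfl fun ℓ _ => ?_
    simp only [hΛ, hu, diagMap_apply, feature_apply, RCLike.inner_apply, conj_trivial]
    ring
  set q : {j // j ≠ i} → ℝ :=
    fun j => inner ℝ (residual H S.v p (x i)) (residual H S.v p (z j)) with hq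
  set a₁ : EuclideanSpace ℝ {j // j ≠ i} :=
    WithLp.toLp 2 (K⁻¹.mulVec (sampling S.v p z (Λ u)).ofLp) with ha₁
  set a₂ : EuclideanSpace ℝ {j // j ≠ i} := WithLp.toLp 2 (K⁻¹.mulVec q) with ha₂
  have e : looWeight H x i = extend i (a₁ + a₂ : EuclideanSpace ℝ {j // j ≠ i}) := by
    rw [looWeight]
    congr 1
    change K⁻¹.mulVec (fun j => ker H (x i) (z j)) = _
    rw [hker, Matrix.mulVec_add]
    rfl
  rw [e, norm_extend]
  refine (norm_add_le _ _).trans (add_le_add ?_ ?_)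
  · refine hr.norm_coeff_eval_le ?_
    rw [harmonicMean_smul_diagMap hr.harmonicMean_pos hr.n_pos, map_sub, map_sub, eq_sub_iff_add_eq,
      add_comm, ← toLp_kerMatrix_mulVec hH hp hl z a₁]
    change WithLp.toLp 2 (K.mulVec (K⁻¹.mulVec (sampling S.v p z (Λ u)).ofLp)) = _
    rw [hinv]
  · have h1 := norm_cross_gram_le (le_norm_sum_residual h.gram_lower)
      (norm_sum_residual_le h.gram_upper) i a₂
    have h2 : inner ℝ a₂ (WithLp.toLp 2 (K.mulVec a₂)) = ∑ j, a₂ j * q j := by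
      rw [show K.mulVec a₂ = q from hinv q, PiLp.inner_apply]
      exact Finset.sum_congr rfl fun j _ => by simp [mul_comm]
    rw [toLp_kerMatrix_mulVec hH hp hl z a₂, inner_add_right, real_inner_comm,
      inner_sampling, real_inner_comm] at h2
    have h3 := inner_diagMap_self_nonneg (d := fun ℓ : Fin p => S.lam ℓ)
      (fun ℓ => (hl ℓ ℓ.2).le) (samplingT S.v p z a₂)
    have h4 := hr.lower a₂
    have h5 := (le_abs_self _).trans h1
    have h6 : αL * ‖a₂‖ ^ 2 ≤ (αU - αL) / 2 * ‖a₂‖ := by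
      refine h4.trans (le_trans ?_ h5)
      change _ ≤ ∑ j, a₂ j * q j
      rw [← h2]
      linarith
    have h7 := half_sub_le hL hr.a_le (hr.rho_le.trans hc)
    by_cases h0 : ‖a₂‖ = 0
    · rw [h0]
      have := hr.rho_nonneg
      positivity
    · have h8 : 0 < ‖a₂‖ := lt_of_le_of_ne (norm_nonneg _) (Ne.symm h0)
      have h9 : αL * ‖a₂‖ ≤ (αU - αL) / 2 := by
        rw [sq, ← mul_assoc] at h6
        exact le_of_mul_le_mul_right h6 h8
      have h10 := h9.trans h7
      rw [mul_comm] at h10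
      exact le_of_mul_le_mul_right h10 hL

/-- The prediction is `(f - g)(x_i)` plus a residual cross term, and the ideal value is `(f -
k)(x_i)`. The four errors are, in order, the first order covariance term, the mismatch between `n -
1` points and the factor `n`, the second order remainder, and the cross term. -/
theorem GoodSample.abs_looWeight_signal_sub_le (h : GoodSample S p η αL αU c M x)
    (hH : ∀ f : H, MemLp (fun x => f x) 2 μ) (hp : (p : ℕ∞) ≤ S.N)
    (hl : ∀ ℓ < p, 0 < S.lam ℓ) (hL : 0 < αL) (hc : c ≤ 1 / 2) (i : Fin n)
    {f k : EuclideanSpace ℝ (Fin p)}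
    (hk : k = f - diagMap (S.survivalFactor p n (harmonicMean αL αU)) f) :
    |∑ j, looWeight H x i j * inner ℝ f (feature S.v p (x j))
        - inner ℝ (diagMap (S.survivalFactor p n (harmonicMean αL αU)) f) (feature S.v p (x i))|
      ≤ |∑ j ∈ Finset.univ.erase i,
          (inner ℝ (diagMap (S.survivalFactor p n (harmonicMean αL αU)) (feature S.v p (x i)))
              (feature S.v p (x j)) * inner ℝ k (feature S.v p (x j))
            - inner ℝ (diagMap (S.survivalFactor p n (harmonicMean αL αU))
              (feature S.v p (x i))) k)| / n
        + ‖feature S.v p (x i)‖ * ‖k‖ / n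
        + ‖feature S.v p (x i)‖ * ((2 * c ^ 2 + 5 / 2 * ((αU - αL) / (αU + αL))) * ‖k‖)
        + 9 / 2 * ((αU - αL) / (αU + αL)) * √n * ‖k‖ := by
  have hr := h.isRidgeSystem hp hl hL hc i
  have hU := isUnit_kerMatrix hH hp hl hL fun w => (h.gram_bounds i w).1
  set z : {j // j ≠ i} → X := fun j => x j with hz
  set K := kerMatrix H z with hK
  set Sv := diagMap (S.survivalFactor p n (harmonicMean αL αU)) with hSv
  set u := feature S.v p (x i) with hu
  set Λ := diagMap (fun ℓ : Fin p => S.lam ℓ) with hΛ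
  set w : EuclideanSpace ℝ {j // j ≠ i} :=
    WithLp.toLp 2 (K⁻¹.mulVec (sampling S.v p z f).ofLp) with hw
  have hKw : sampling S.v p z (Λ (samplingT S.v p z w))
      + gramOp (fun j => residual H S.v p (z j)) w = sampling S.v p z f := by
    rw [← toLp_kerMatrix_mulVec hH hp hl z w]
    change WithLp.toLp 2 (K.mulVec (K⁻¹.mulVec (sampling S.v p z f).ofLp)) = _
    rw [Matrix.mulVec_mulVec, Matrix.mul_nonsing_inv _ ((Matrix.isUnit_iff_isUnit_det _).1 hU),
      Matrix.one_mulVec]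
  have hn := hr.n_pos
  have hm := hr.harmonicMean_pos
  set g := f - Λ (samplingT S.v p z w) with hg
  have hQw : gramOp (fun j => residual H S.v p (z j)) w = sampling S.v p z g := by
    rw [hg, map_sub, ← hKw]; abel
  have hgN : g + diagMap (fun ℓ : Fin p => n / harmonicMean αL αU * S.lam ℓ)
      ((harmonicMean αL αU / n) • samplingT S.v p z w) = f := by
    rw [map_smul, harmonicMean_smul_diagMap hm hn, hg, sub_add_cancel]
  have hkN : k + diagMap (fun ℓ : Fin p => n / harmonicMean αL αU * S.lam ℓ) k = f := by
    rw [hk]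
    ext ℓ
    have := hl ℓ ℓ.2
    have h1 : 0 < harmonicMean αL αU + n * S.lam ℓ := by positivity
    simp only [hSv, diagMap_apply, PiLp.add_apply, PiLp.sub_apply, EigenSystem.survivalFactor]
    field_simp
    ring
  have hpred : ∑ j, looWeight H x i j * inner ℝ f (feature S.v p (x j))
      = inner ℝ u (f - g) + ∑ j, w j * inner ℝ (residual H S.v p (x i)) (residual H S.v p (z j)) := by
    have h1 : ∑ j, looWeight H x i j * inner ℝ f (feature S.v p (x j))
        = ∑ j, w j * ker H (x i) (z j) := by
      rw [looWeight, sum_extend_mul]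
      change (K⁻¹.mulVec fun j => ker H (x i) (z j)) ⬝ᵥ (sampling S.v p z f).ofLp
        = (K⁻¹.mulVec (sampling S.v p z f).ofLp) ⬝ᵥ fun j => ker H (x i) (z j)
      have hT : K⁻¹.transpose = K⁻¹ := by
        rw [Matrix.transpose_nonsing_inv, hK, kerMatrix_transpose]
      nth_rewrite 1 [← hT]
      rw [Matrix.mulVec_transpose, ← Matrix.dotProduct_mulVec, dotProduct_comm]
    rw [h1, kerMatrix_mulVec hH hp hl z w, inner_sum, hg, sub_sub_cancel, real_inner_comm]
    simp only [real_inner_smul_right]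
    rfl
  have hA := hr.abs_inner_bias_sub_le hQw hgN hkN u
  have hB := hr.norm_coeff_signal_le hQw hgN hkN
  have hC := norm_cross_gram_le (le_norm_sum_residual h.gram_lower)
      (norm_sum_residual_le h.gram_upper) i w
  have hD := half_sub_le hL hr.a_le (hr.rho_le.trans hc)
  have hρ := hr.rho_nonneg
  set ρ := (αU - αL) / (αU + αL) with hρdef
  have hC' : |∑ j, w j * inner ℝ (residual H S.v p (x i)) (residual H S.v p (z j))|
      ≤ 9 / 2 * ρ * √n * ‖k‖ := by
    refine hC.trans ((mul_le_mul_of_nonneg_right hD (norm_nonneg w)).trans ?_)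
    have := mul_le_mul_of_nonneg_left hB (by positivity : 0 ≤ 2 * ρ)
    linarith
  -- The sum has `n - 1` centred terms while the operator subtracts `n k`; this leaves the extra
  -- `⟪Sv u, k⟫ / n`.
  have hfirst : inner ℝ (Sv u) ((n : ℝ)⁻¹ • (samplingT S.v p z (sampling S.v p z k) - (n : ℝ) • k))
      = (∑ j ∈ Finset.univ.erase i, (inner ℝ (Sv u) (feature S.v p (x j))
          * inner ℝ k (feature S.v p (x j)) - inner ℝ (Sv u) k)) / n - inner ℝ (Sv u) k / n := by
    have h1 : inner ℝ (Sv u) (samplingT S.v p z (sampling S.v p z k))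
        = ∑ j ∈ Finset.univ.erase i, inner ℝ (Sv u) (feature S.v p (x j))
          * inner ℝ k (feature S.v p (x j)) := by
      rw [samplingT_apply, inner_sum, ← Finset.filter_ne' Finset.univ i,
        ← Finset.sum_subtype_eq_sum_filter, Finset.subtype_univ]
      refine Finset.sum_congr rfl fun j _ => ?_
      rw [real_inner_smul_right, sampling_apply, mul_comm]
    rw [Finset.sum_sub_distrib, ← h1, Finset.sum_const, Finset.card_erase_of_mem (Finset.mem_univ i),
      Finset.card_univ, Fintype.card_fin, nsmul_eq_mul, real_inner_smul_right, inner_sub_right,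
      real_inner_smul_right, Nat.cast_sub (by have := i.2; omega)]
    field_simp
    push_cast
    ring
  rw [hfirst] at hA
  set T := ∑ j ∈ Finset.univ.erase i, (inner ℝ (Sv u) (feature S.v p (x j))
          * inner ℝ k (feature S.v p (x j)) - inner ℝ (Sv u) k) with hT
  have hE : |inner ℝ (Sv u) k| ≤ ‖u‖ * ‖k‖ :=
    (abs_real_inner_le_norm _ _).trans
      (mul_le_mul_of_nonneg_right (hr.surv_norm u) (norm_nonneg k))
  have hE' : |inner ℝ (Sv u) k / n| ≤ ‖u‖ * ‖k‖ / n := by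
    rw [abs_div, abs_of_pos hn]
    gcongr
  have hT' : |T / n| = |T| / n := by rw [abs_div, abs_of_pos hn]
  rw [← hT', hpred]
  have e : inner ℝ u (f - g) - inner ℝ (Sv f) u
      = T / n - inner ℝ (Sv u) k / n
        - (inner ℝ u g - inner ℝ u k + (T / n - inner ℝ (Sv u) k / n)) := by
    have h2 : Sv f = f - k := by rw [hk]; abel
    rw [real_inner_comm u, h2, inner_sub_right u f k, inner_sub_right u f g]
    ring
  rw [add_sub_right_comm, e]
  refine (abs_add_le _ _).trans (add_le_add ?_ hC')
  refine (abs_sub _ _).trans (add_le_add ?_ hA)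
  exact (abs_sub _ _).trans (add_le_add le_rfl hE')

end Good

/-! ### Measurability of the leave-one-out weights -/

section Measurability

/-- Cramer's rule: entries of the inverse are polynomials times the inverse of the determinant, and
inversion on `ℝ` is measurable also at zero. -/
theorem measurable_matrix_inv_apply {α ι : Type*} [MeasurableSpace α] [Fintype ι] [DecidableEq ι]
    {K : α → Matrix ι ι ℝ} (hK : ∀ j k, Measurable fun a => K a j k) (j k : ι) :
    Measurable fun a => (K a)⁻¹ j k := by
  have hdet : ∀ {K : α → Matrix ι ι ℝ}, (∀ j k, Measurable fun a => K a j k) →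
      Measurable fun a => (K a).det := by
    intro K hK
    simp only [Matrix.det_apply']
    exact Finset.measurable_fun_sum _ fun σ _ =>
      (Finset.measurable_fun_prod _ fun i _ => hK _ _).const_mul _
  simp only [Matrix.inv_def, Ring.inverse_eq_inv', Matrix.smul_apply, Matrix.adjugate_apply,
    smul_eq_mul]
  refine (hdet hK).inv.mul (hdet fun l m => ?_)
  by_cases h : l = k
  · subst h
    simp
  · simpa [Matrix.updateRow_ne h] using hK l m

variable {X : Type*} [MeasurableSpace X]
  {H : Type*} [NormedAddCommGroup H] [InnerProductSpace ℝ H] [CompleteSpace H] [RKHS ℝ H X ℝ]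

theorem measurable_looWeight (hk : Measurable fun q : X × X => ker H q.1 q.2) {n : ℕ}
    (i j : Fin n) : Measurable fun x : Fin n → X => looWeight H x i j := by
  have hker : ∀ a b : Fin n, Measurable fun x : Fin n → X => ker H (x a) (x b) := fun a b => by
    have hp : Measurable fun x : Fin n → X => (x a, x b) := by fun_prop
    have h1 := hk.comp hp
    simpa only [Function.comp_def] using h1
  by_cases h : j ≠ i
  · have e : (fun x : Fin n → X => looWeight H x i j) = fun x => ∑ k : {j // j ≠ i},
        (kerMatrix H fun j : {j // j ≠ i} => x j)⁻¹ ⟨j, h⟩ k * ker H (x i) (x k) := by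
      funext x
      exact dif_pos h
    rw [e]
    refine Finset.measurable_fun_sum _ fun k _ => Measurable.mul ?_ (hker i k)
    exact measurable_matrix_inv_apply
      (K := fun x : Fin n → X => kerMatrix H fun j : {j // j ≠ i} => x j)
      (fun a b => hker a b) ⟨j, h⟩ k
  · obtain rfl := not_not.1 h
    simp only [looWeight, extend_self]
    exact measurable_const

theorem measurable_feature {v : ℕ → X → ℝ} {p : ℕ} (hv : ∀ ℓ < p, Measurable (v ℓ)) :
    Measurable (feature v p) :=
  (WithLp.measurable_toLp 2 (Fin p → ℝ)).comp (measurable_pi_lambda _ fun ℓ => hv ℓ ℓ.2)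

end Measurability

/-! ### The law of a labelled sample -/

namespace IsLabelledSample

variable {X : Type*} [MeasurableSpace X] {Ω : Type*} [MeasurableSpace Ω] {μ : Measure X}
  {η : X → ℝ} {P : Measure Ω} [IsProbabilityMeasure P] {n : ℕ}
  {x : Fin n → Ω → X} {y : Fin n → Ω → ℝ}

theorem integrable_y (h : IsLabelledSample μ η P x y) (i : Fin n) : Integrable (y i) P := by
  refine Integrable.of_bound (h.measurable_y i).aestronglyMeasurable 1 (Eventually.of_forall ?_)
  intro ω
  rcases h.labels i ω with h | h <;> simp [h]

theorem map_x (h : IsLabelledSample μ η P x y) :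
    P.map (fun ω i => x i ω) = Measure.pi fun _ => μ := by
  have h1 : iIndepFun x P := h.indep.comp (fun _ => Prod.fst) fun _ => measurable_fst
  rw [(iIndepFun_iff_map_fun_eq_pi_map fun i => (h.measurable_x i).aemeasurable).1 h1]
  simp only [h.law_x]

theorem map_xy (h : IsLabelledSample μ η P x y) :
    P.map (fun ω i => (x i ω, y i ω)) = Measure.pi fun i => P.map fun ω => (x i ω, y i ω) :=
  (iIndepFun_iff_map_fun_eq_pi_map fun i =>
    ((h.measurable_x i).prodMk (h.measurable_y i)).aemeasurable).1 h.indep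

omit [IsProbabilityMeasure P] in
theorem ae_abs_le_one (h : IsLabelledSample μ η P x y) (hη : Measurable η) (i : Fin n) :
    ∀ᵐ t ∂μ, |η t| ≤ 1 := by
  have h1 : ∀ᵐ ω ∂P, |y i ω| ≤ 1 := Eventually.of_forall fun ω => by
    rcases h.labels i ω with h | h <;> simp [h]
  have h2 : ∀ᵐ ω ∂P, |η (x i ω)| ≤ 1 := by
    filter_upwards [ae_bdd_abs_condExp_of_ae_bdd_abs (m := MeasurableSpace.comap (x i) inferInstance) h1,
      h.regression i] with ω e1 e2
    rwa [e2] at e1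
  rw [← h.law_x i, ae_map_iff (h.measurable_x i).aemeasurable
    (measurableSet_le hη.abs measurable_const)]
  exact h2

theorem setIntegral_y (h : IsLabelledSample μ η P x y) (hη : Measurable η) (i : Fin n) {s : Set X}
    (hs : MeasurableSet s) : ∫ ω in x i ⁻¹' s, y i ω ∂P = ∫ t in s, η t ∂μ := by
  rw [← setIntegral_condExp (h.measurable_x i).comap_le (h.integrable_y i) ⟨s, hs, rfl⟩,
    setIntegral_congr_ae (g := fun ω => η (x i ω)) (h.measurable_x i hs)
      ((h.regression i).mono fun ω e _ => e)]
  conv_rhs => rw [← h.law_x i]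
  rw [setIntegral_map hs hη.aestronglyMeasurable (h.measurable_x i).aemeasurable]

/-- Because labels are `±1`, the indicator of `y = ε` equals `(1 + ε y) / 2`; integrating it over
events in `x_i` replaces `y` by `η`. -/
theorem map_restrict (h : IsLabelledSample μ η P x y) (hη : Measurable η) (i : Fin n) {ε : ℝ}
    (hε : ε = 1 ∨ ε = -1) :
    (P.restrict {ω | y i ω = ε}).map (x i)
      = μ.withDensity fun t => ENNReal.ofReal ((1 + ε * η t) / 2) := by
  have hμ : IsProbabilityMeasure μ := by
    rw [← h.law_x i]
    exact Measure.isProbabilityMeasure_map (h.measurable_x i).aemeasurable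
  have hb := h.ae_abs_le_one hη i
  have hηi : Integrable η μ :=
    Integrable.of_bound hη.aestronglyMeasurable 1 (by simpa using hb)
  have hA : MeasurableSet {ω | y i ω = ε} := h.measurable_y i (measurableSet_singleton ε)
  ext s hs
  have hxs := h.measurable_x i hs
  rw [Measure.map_apply (h.measurable_x i) hs, Measure.restrict_apply hxs, withDensity_apply _ hs,
    ← ofReal_integral_eq_lintegral_ofReal]
  · have h1 : ∫ ω in x i ⁻¹' s, (1 + ε * y i ω) / 2 ∂P = P.real (x i ⁻¹' s ∩ {ω | y i ω = ε}) := by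
      rw [← integral_indicator_one (hxs.inter hA), ← integral_indicator hxs]
      refine integral_congr_ae (Eventually.of_forall fun ω => ?_)
      by_cases h1 : ω ∈ x i ⁻¹' s
      · rcases h.labels i ω with h2 | h2 <;> rcases hε with rfl | rfl <;>
          simp [Set.indicator, h1, h2] <;> norm_num
      · simp [Set.indicator, h1]
    have h2 : ∫ t in s, (1 + ε * η t) / 2 ∂μ = ∫ ω in x i ⁻¹' s, (1 + ε * y i ω) / 2 ∂P := by
      have hyi := h.integrable_y i
      rw [integral_div, integral_div, integral_add (by fun_prop) (hηi.restrict.const_mul ε),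
        integral_add (by fun_prop) (hyi.restrict.const_mul ε), integral_const_mul,
        integral_const_mul, h.setIntegral_y hη i hs]
      congr 2
      simp only [integral_const, MeasurableSet.univ, measureReal_restrict_apply, Set.univ_inter,
        smul_eq_mul, mul_one]
      rw [← h.law_x i, map_measureReal_apply (h.measurable_x i) hs]
    rw [h2, h1, ofReal_measureReal]
  · have := (hηi.restrict (s := s)).const_mul ε
    fun_prop
  · refine ae_restrict_of_ae ?_
    filter_upwards [hb] with t ht
    obtain ⟨h1, h2⟩ := abs_le.1 ht
    rcases hε with rfl | rfl <;> simp only [Pi.zero_apply] <;> linarith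

theorem isLabelLaw (h : IsLabelledSample μ η P x y) (hη : Measurable η) (i : Fin n) :
    IsLabelLaw μ η (P.map fun ω => (x i ω, y i ω)) := by
  intro ψ hψ
  have hxy := (h.measurable_x i).prodMk (h.measurable_y i)
  have hA : ∀ ε : ℝ, MeasurableSet {ω | y i ω = ε} := fun ε =>
    h.measurable_y i (measurableSet_singleton ε)
  have key : ∀ ε : ℝ, ε = 1 ∨ ε = -1 → ∫⁻ ω in {ω | y i ω = ε}, ψ (x i ω, y i ω) ∂P
      = ∫⁻ t, ENNReal.ofReal ((1 + ε * η t) / 2) * ψ (t, ε) ∂μ := by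
    intro ε hε
    have hm : Measurable fun t => ψ (t, ε) := by fun_prop
    rw [setLIntegral_congr_fun (g := fun ω => ψ (x i ω, ε)) (hA ε) fun ω hω => by
        have : y i ω = ε := hω
        simp only [this],
      ← lintegral_map hm (h.measurable_x i), h.map_restrict hη i hε,
      lintegral_withDensity_eq_lintegral_mul _ (by fun_prop) hm]
    rfl
  have hc : {ω | y i ω = 1}ᶜ = {ω | y i ω = -1} := by
    ext ω
    rcases h.labels i ω with h1 | h1 <;> simp [h1] <;> norm_num
  rw [lintegral_map hψ hxy, ← lintegral_add_compl _ (hA 1), hc, key 1 (Or.inl rfl),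
    key (-1) (Or.inr rfl), ← lintegral_add_left (by fun_prop)]
  simp only [one_mul, neg_mul, ← sub_eq_add_neg]

theorem measure_abs_noise_ge_le (h : IsLabelledSample μ η P x y) (hη : Measurable η) (i : Fin n)
    {a : Fin n → (Fin n → X) → ℝ} (ha : ∀ i, Measurable (a i)) {L : ℝ} (hL : 0 < L)
    (haL : ∀ x, ∑ i, a i x ^ 2 ≤ L ^ 2) {t : ℝ} (ht : 0 ≤ t) :
    P {ω | t ≤ |∑ j, a j (fun k => x k ω) * (y j ω - η (x j ω))|}
      ≤ 2 * ENNReal.ofReal (Real.exp (-(t ^ 2 / (8 * L ^ 2)))) := by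
  have hxy : ∀ i, Measurable fun ω => (x i ω, y i ω) := fun i =>
    (h.measurable_x i).prodMk (h.measurable_y i)
  have hprob : ∀ i, IsProbabilityMeasure (P.map fun ω => (x i ω, y i ω)) := fun i =>
    Measure.isProbabilityMeasure_map (hxy i).aemeasurable
  have h1 := SVP.measure_abs_noise_ge_le (fun i => h.isLabelLaw hη i) hη (h.ae_abs_le_one hη i)
    ha hL haL ht
  rw [← h.map_xy] at h1
  exact (Measure.le_map_apply (measurable_pi_lambda _ hxy).aemeasurable _).trans h1

end IsLabelledSample

/-! ### The first order covariance error -/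

/-- Given `x_i`, the summands are independent and centred because the features are orthonormal. The
uncentred products are bounded by `B² b`, and orthonormality bounds their second moment by `b² B²`,
so the Bernstein exponent has `B²` and not `B⁴` in the denominator. -/
theorem EigenSystem.measure_covariance_ge_le {X : Type*} [MeasurableSpace X] {μ : Measure X}
    [IsProbabilityMeasure μ] {k : X → X → ℝ} (S : EigenSystem k μ) {p : ℕ} (hp : (p : ℕ∞) ≤ S.N)
    (hv : ∀ ℓ < p, Measurable (S.v ℓ)) {B b θ : ℝ} (hB0 : 0 < B) (hb0 : 0 < b) (hθ : 0 < θ)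
    (hθ1 : θ ≤ 1) (hB : ∀ᵐ t ∂μ, ‖feature S.v p t‖ ≤ B) {g : EuclideanSpace ℝ (Fin p)}
    (hg : ∀ᵐ t ∂μ, |inner ℝ g (feature S.v p t)| ≤ b)
    {T : EuclideanSpace ℝ (Fin p) →ₗ[ℝ] EuclideanSpace ℝ (Fin p)} (hT : ∀ f, ‖T f‖ ≤ ‖f‖)
    {n : ℕ} (i : Fin n) :
    Measure.pi (fun _ : Fin n => μ) {x | ‖feature S.v p (x i)‖ ≤ B ∧ n * (θ * b) ≤
        |∑ j ∈ Finset.univ.erase i, (inner ℝ (T (feature S.v p (x i))) (feature S.v p (x j))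
          * inner ℝ g (feature S.v p (x j)) - inner ℝ (T (feature S.v p (x i))) g)|}
      ≤ 2 * ENNReal.ofReal (Real.exp (-(θ ^ 2 * n / (4 * B ^ 2)))) := by
  classical
  have hu := measurable_feature (p := p) hv
  have hTm : Measurable T := (LinearMap.continuous_of_finiteDimensional T).measurable
  -- The cutoff makes the exponential moment bound valid for every first point, not only almost
  -- every one.
  set F : X → X → ℝ := fun r t => if ‖feature S.v p r‖ ≤ B then
    inner ℝ (T (feature S.v p r)) (feature S.v p t) * inner ℝ g (feature S.v p t)
      - inner ℝ (T (feature S.v p r)) g else 0 with hF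
  have hFm : Measurable (Function.uncurry F) := by
    refine Measurable.ite ?_ ?_ measurable_const
    · exact measurableSet_le (hu.comp measurable_fst).norm measurable_const
    · have h1 : Measurable fun q : X × X => T (feature S.v p q.1) := by fun_prop
      have h2 : Measurable fun q : X × X => feature S.v p q.2 := by fun_prop
      exact ((h1.inner h2).mul (measurable_const.inner h2)).sub (h1.inner measurable_const)
  -- The minimizer of `-s n θ b + n s² b² B²`; `θ ≤ 1` is what keeps it in the range of the moment
  -- bound.
  set s := θ / (2 * B ^ 2 * b) with hs
  have hs0 : 0 < s := by positivity
  have hmgf : ∀ σ : ℝ, |σ| = s → ∀ r, ∫⁻ t, ENNReal.ofReal (Real.exp (σ * F r t)) ∂μ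
      ≤ ENNReal.ofReal (Real.exp (s ^ 2 * (b ^ 2 * B ^ 2))) := by
    intro σ hσ r
    by_cases hr : ‖feature S.v p r‖ ≤ B
    · simp only [hF, if_pos hr]
      have hTr : ‖T (feature S.v p r)‖ ≤ B := (hT _).trans hr
      rw [← S.integral_inner_feature_mul hp, ← sq_abs s, ← hσ, abs_abs, sq_abs]
      refine lintegral_exp_sub_integral_le (B := B * B * b) ?_ ?_ ?_ ?_
      · exact ((measurable_const.inner hu).mul (measurable_const.inner hu)).aemeasurable
      · filter_upwards [hB, hg] with t e1 e2
        rw [abs_mul]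
        refine mul_le_mul ((abs_real_inner_le_norm _ _).trans ?_) e2 (abs_nonneg _) (by positivity)
        exact mul_le_mul hTr e1 (norm_nonneg _) hB0.le
      · calc ∫ t, (inner ℝ (T (feature S.v p r)) (feature S.v p t)
                * inner ℝ g (feature S.v p t)) ^ 2 ∂μ
            ≤ ∫ t, b ^ 2 * (inner ℝ (T (feature S.v p r)) (feature S.v p t)
                * inner ℝ (T (feature S.v p r)) (feature S.v p t)) ∂μ := by
              have hi : Integrable (fun t => b ^ 2 *
                  (inner ℝ (T (feature S.v p r)) (feature S.v p t)
                  * inner ℝ (T (feature S.v p r)) (feature S.v p t))) μ := by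
                refine Integrable.const_mul (Integrable.of_bound
                  ((measurable_const.inner hu).mul
                    (measurable_const.inner hu)).aestronglyMeasurable ((B * B) * (B * B)) ?_) _
                filter_upwards [hB] with t e1
                have h1 : |inner ℝ (T (feature S.v p r)) (feature S.v p t)| ≤ B * B :=
                  (abs_real_inner_le_norm _ _).trans (mul_le_mul hTr e1 (norm_nonneg _) hB0.le)
                rw [Real.norm_eq_abs, Pi.mul_apply, abs_mul]
                exact mul_le_mul h1 h1 (abs_nonneg _) (by positivity)
              refine integral_mono_of_nonneg (Eventually.of_forall fun t => sq_nonneg _) hi ?_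
              filter_upwards [hg] with t e2
              have h1 : inner ℝ g (feature S.v p t) ^ 2 ≤ b ^ 2 := by
                rw [← sq_abs]
                gcongr
              rw [mul_pow, mul_comm, ← sq]
              exact mul_le_mul_of_nonneg_right h1 (sq_nonneg _)
          _ = b ^ 2 * ‖T (feature S.v p r)‖ ^ 2 := by
              rw [integral_const_mul, S.integral_inner_feature_mul hp, real_inner_self_eq_norm_sq]
          _ ≤ b ^ 2 * B ^ 2 := by gcongr
      · rw [hσ, hs]
        have : θ / (2 * B ^ 2 * b) * (2 * (B * B * b)) = θ := by field_simp
        rw [this]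
        exact hθ1
    · simp only [hF, if_neg hr, mul_zero, Real.exp_zero, ENNReal.ofReal_one, lintegral_const,
        measure_univ, mul_one]
      rw [← ENNReal.ofReal_one]
      exact ENNReal.ofReal_le_ofReal (Real.one_le_exp (by positivity))
  have hcard : ((Finset.univ.erase i).card : ℝ) ≤ n := by
    have h1 : (Finset.univ.erase i).card ≤ n :=
      (Finset.card_le_univ _).trans (Fintype.card_fin n).le
    exact_mod_cast h1
  have e : -(s * (n * (θ * b))) + n * (s ^ 2 * (b ^ 2 * B ^ 2)) = -(θ ^ 2 * n / (4 * B ^ 2)) := by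
    rw [hs]
    field_simp
    ring
  have h1 := measure_pair_sum_ge_le hFm hs0.le (by positivity)
    (hmgf s (abs_of_pos hs0)) (Finset.notMem_erase i Finset.univ) (T := n * (θ * b)) hcard
  have h2 := measure_pair_sum_ge_le (F := fun r t => - F r t) hFm.neg hs0.le
    (by positivity : 0 ≤ b ^ 2 * B ^ 2) (fun r => by
      have := hmgf (-s) (by rw [abs_neg, abs_of_pos hs0]) r
      simpa using this) (Finset.notMem_erase i Finset.univ) (T := n * (θ * b)) hcard
  rw [e] at h1 h2
  rw [two_mul]
  refine le_trans (measure_mono ?_) ((measure_union_le _ _).trans (add_le_add h1 h2))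
  rintro x ⟨hx1, hx2⟩
  simp only [hF, if_pos hx1, Set.mem_union, Set.mem_ofPred_eq, Finset.sum_neg_distrib]
  exact le_abs.1 hx2

/-! ### Numerical bounds -/

/-- Three logarithms give `n⁻³`; one factor `n ≥ 2` pays for the two-sided tail, and `n⁻²` survives
a union over the points. -/
theorem two_mul_exp_neg_le {n : ℕ} (hn : 2 ≤ n) {r : ℝ} (hr : 3 * Real.log n ≤ r) :
    2 * Real.exp (-r) ≤ 1 / (n : ℝ) ^ 2 := by
  have hn' : (2 : ℝ) ≤ n := by exact_mod_cast hn
  have h1 : Real.exp (-r) ≤ ((n : ℝ) ^ 3)⁻¹ := by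
    rw [← Real.exp_log (by positivity : (0 : ℝ) < n ^ 3), ← Real.exp_neg, Real.log_pow]
    exact Real.exp_le_exp.2 (by push_cast; linarith)
  have h2 : 2 * ((n : ℝ) ^ 3)⁻¹ ≤ 1 / (n : ℝ) ^ 2 := by
    rw [← div_eq_mul_inv, div_le_div_iff₀ (by positivity) (by positivity)]
    nlinarith [sq_nonneg (n : ℝ)]
  linarith

/-- The smallness condition on the sample size, with its threshold `θ / (100 C (1 + M))`. -/
structure IsSmall (C M θ p n b ρ c : ℝ) : Prop where
  one_le_C : 1 ≤ C
  M_pos : 0 < M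
  theta_eq : θ = 1 / (8 * (1 + M))
  one_le_p : 1 ≤ p
  n_pos : 0 < n
  one_le_log : 1 ≤ Real.log n
  b_pos : 0 < b
  b_le : b ≤ M
  rho_nonneg : 0 ≤ ρ
  sum_le : 1 / b * √(p * Real.log n / n) + ρ * (√(Real.log n) / b + √n) + c ^ 2 * √p
    ≤ θ / (100 * C * (1 + M))

namespace IsSmall

variable {C M θ p n b ρ c : ℝ} (h : IsSmall C M θ p n b ρ c)
include h

theorem theta_pos : 0 < θ := by
  have := h.M_pos
  rw [h.theta_eq]; positivity

theorem theta_le : θ ≤ 1 := by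
  have := h.M_pos
  rw [h.theta_eq, div_le_one (by positivity)]
  linarith

theorem terms_le : √(p * Real.log n / n) ≤ θ / (100 * C * (1 + M)) * b ∧
    ρ * √(Real.log n) ≤ θ / (100 * C * (1 + M)) * b ∧ ρ * √n ≤ θ / (100 * C * (1 + M)) ∧
      c ^ 2 * √p ≤ θ / (100 * C * (1 + M)) := by
  have hb := h.b_pos
  have hρ := h.rho_nonneg
  have h0 := h.sum_le
  have h1 : 0 ≤ 1 / b * √(p * Real.log n / n) := by positivity
  have h2 : 0 ≤ ρ * (√(Real.log n) / b) := by positivity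
  have h3 : 0 ≤ ρ * √n := by positivity
  have h4 : 0 ≤ c ^ 2 * √p := by positivity
  rw [mul_add] at h0
  refine ⟨?_, ?_, by linarith, by linarith⟩
  · rw [← div_le_iff₀ hb, ← one_div_mul_eq_div]
    linarith
  · rw [← div_le_iff₀ hb, mul_div_assoc]
    linarith

theorem threshold_mul_le : C * (θ / (100 * C * (1 + M))) ≤ θ / 100 ∧
    C * (θ / (100 * C * (1 + M))) * M ≤ θ / 100 := by
  have hC : 0 < C := zero_lt_one.trans_le h.one_le_C
  have hM := h.M_pos
  have hθ := h.theta_pos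
  have e : C * (θ / (100 * C * (1 + M))) = θ / 100 / (1 + M) := by field_simp
  rw [e]
  constructor
  · exact div_le_self (by positivity) (by linarith)
  · rw [div_mul_eq_mul_div, div_le_iff₀ (by positivity)]
    gcongr
    linarith

theorem sqrt_div_le : √(p / n) ≤ θ / (100 * C * (1 + M)) * b := by
  refine le_trans (Real.sqrt_le_sqrt ?_) h.terms_le.1
  have := h.n_pos
  have := h.one_le_p
  have := h.one_le_log
  gcongr
  exact le_mul_of_one_le_right (by linarith) h.one_le_log

/-- `b ≤ M` converts the smallness condition into a bound on `p log n / n` that is free of `b`. -/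
theorem pair_exponent_le : 3 * Real.log n ≤ θ ^ 2 * n / (4 * √(C * p) ^ 2) := by
  have hC := h.one_le_C
  have hC0 : 0 < C := zero_lt_one.trans_le hC
  have hp : 0 < p := zero_lt_one.trans_le h.one_le_p
  have hn := h.n_pos
  have hM := h.M_pos
  have hθ := h.theta_pos
  have hl := h.one_le_log
  rw [Real.sq_sqrt (by positivity), le_div_iff₀ (by positivity)]
  set t := θ / (100 * C * (1 + M)) with ht
  have ht0 : 0 < t := by positivity
  have h1 : √(p * Real.log n / n) ≤ t * M :=
    h.terms_le.1.trans (mul_le_mul_of_nonneg_left h.b_le ht0.le)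
  have h2 : p * Real.log n / n ≤ (t * M) ^ 2 := by
    rw [← Real.sq_sqrt (by positivity : 0 ≤ p * Real.log n / n)]
    gcongr
  rw [div_le_iff₀ hn] at h2
  have h3 := h.threshold_mul_le.2
  rw [← ht] at h3
  have h4 : C * (t * M) ^ 2 ≤ (θ / 100) ^ 2 := by
    calc C * (t * M) ^ 2 ≤ C * C * (t * M) ^ 2 := by
          gcongr
          nlinarith
      _ = (C * t * M) ^ 2 := by ring
      _ ≤ (θ / 100) ^ 2 := by gcongr
  have h5 : C * (p * Real.log n) ≤ (θ / 100) ^ 2 * n := by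
    calc C * (p * Real.log n) ≤ C * ((t * M) ^ 2 * n) := by gcongr
      _ = C * (t * M) ^ 2 * n := by ring
      _ ≤ _ := by gcongr
  nlinarith [mul_pos (pow_pos hθ 2) hn]

/-- `√(log n)` times the weight bound is a combination of the two smallness terms that carry `1 /
b`. -/
theorem noise_exponent_le :
    3 * Real.log n ≤ (θ * b) ^ 2 / (8 * (4 / √n * √(C * p) + 2 * ρ) ^ 2) := by
  have hC := h.one_le_C
  have hC0 : 0 < C := zero_lt_one.trans_le hC
  have hp : 0 < p := zero_lt_one.trans_le h.one_le_p
  have hn := h.n_pos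
  have hM := h.M_pos
  have hθ := h.theta_pos
  have hl := h.one_le_log
  have hb := h.b_pos
  have hρ := h.rho_nonneg
  obtain ⟨h1, h2, -, -⟩ := h.terms_le
  have h3 := h.threshold_mul_le.1
  set t := θ / (100 * C * (1 + M)) with ht
  have ht0 : 0 < t := by positivity
  have hL : 0 < 4 / √n * √(C * p) + 2 * ρ := by positivity
  rw [le_div_iff₀ (by positivity)]
  have hsC : √C ≤ C := Real.sqrt_le_self_iff.2 (Or.inr hC)
  have e : √(Real.log n) * (4 / √n * √(C * p) + 2 * ρ)
      = 4 * √C * √(p * Real.log n / n) + 2 * (ρ * √(Real.log n)) := by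
    rw [Real.sqrt_div (by positivity), Real.sqrt_mul hp.le, Real.sqrt_mul hC0.le]
    ring
  have h4 : √(Real.log n) * (4 / √n * √(C * p) + 2 * ρ) ≤ 6 / 100 * (θ * b) := by
    rw [e]
    have h5 : √C * √(p * Real.log n / n) ≤ C * (t * b) := by gcongr
    have h6 : t * b ≤ C * (t * b) := le_mul_of_one_le_left (by positivity) hC
    have h7 : C * (t * b) ≤ θ / 100 * b := by
      rw [← mul_assoc]
      gcongr
    linarith
  have h8 : (√(Real.log n) * (4 / √n * √(C * p) + 2 * ρ)) ^ 2 ≤ (6 / 100 * (θ * b)) ^ 2 := by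
    gcongr
  rw [mul_pow, Real.sq_sqrt (by linarith)] at h8
  nlinarith [sq_nonneg (θ * b)]

theorem error_lt : θ * b + √(C * p) * b / n + √(C * p) * ((2 * c ^ 2 + 5 / 2 * ρ) * b)
    + 9 / 2 * ρ * √n * b + θ * b < b / M := by
  have hC := h.one_le_C
  have hC0 : 0 < C := zero_lt_one.trans_le hC
  have hp : 0 < p := zero_lt_one.trans_le h.one_le_p
  have hn := h.n_pos
  have hM := h.M_pos
  have hθ := h.theta_pos
  have hθ1 := h.theta_le
  have hl := h.one_le_log
  have hb := h.b_pos
  have hbM := h.b_le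
  have hρ := h.rho_nonneg
  obtain ⟨-, -, h1, h2⟩ := h.terms_le
  obtain ⟨h3, h4⟩ := h.threshold_mul_le
  have h5 := h.sqrt_div_le
  set t := θ / (100 * C * (1 + M)) with ht
  have ht0 : 0 < t := by positivity
  have hsC : √C ≤ C := Real.sqrt_le_self_iff.2 (Or.inr hC)
  have htC : t ≤ C * t := le_mul_of_one_le_left ht0.le hC
  have hn1 : 1 ≤ n := by
    by_contra hlt
    have := Real.log_nonpos hn.le (not_le.1 hlt).le
    linarith
  have h6 : √(p / n) ≤ t * M := h5.trans (by gcongr)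
  have hpn : √p = √(p / n) * √n := by
    rw [← Real.sqrt_mul (by positivity), div_mul_cancel₀ _ hn.ne']
  -- No hypothesis bounds `√p ρ` directly; it factors as `√(p / n)` times `ρ √n`.
  have h7 : √p * ρ ≤ t := by
    have h8 : t * M ≤ 1 := by
      have : t * M ≤ C * t * M := by gcongr
      linarith
    calc √p * ρ = √(p / n) * (ρ * √n) := by rw [hpn]; ring
      _ ≤ 1 * t := mul_le_mul (h6.trans h8) h1 (by positivity) zero_le_one
      _ = t := one_mul t
  have h8 : √p / n ≤ t * M := by
    refine le_trans ?_ h6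
    rw [Real.sqrt_div hp.le]
    refine div_le_div_of_nonneg_left (Real.sqrt_nonneg _) (by positivity) ?_
    exact Real.sqrt_le_self_iff.2 (Or.inr hn1)
  have h9 : √(C * p) / n ≤ θ / 100 := by
    rw [Real.sqrt_mul hC0.le, mul_div_assoc]
    calc √C * (√p / n) ≤ C * (t * M) := by gcongr
      _ = C * t * M := by ring
      _ ≤ _ := h4
  have h10 : √(C * p) * (2 * c ^ 2 + 5 / 2 * ρ) ≤ 9 / 2 * (θ / 100) := by
    rw [Real.sqrt_mul hC0.le]
    calc √C * √p * (2 * c ^ 2 + 5 / 2 * ρ) = √C * (2 * (c ^ 2 * √p) + 5 / 2 * (√p * ρ)) := by ring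
      _ ≤ C * (2 * t + 5 / 2 * t) := by gcongr
      _ = 9 / 2 * (C * t) := by ring
      _ ≤ _ := by gcongr
  have h11 : 9 / 2 * ρ * √n ≤ 9 / 2 * (θ / 100) := by linarith
  -- This is what fixes `θ`: it reduces to `3 M < 8 (1 + M)`. The two probabilistic terms use `2 θ`,
  -- and the others together at most `θ / 10`.
  have h12 : 3 * θ < 1 / M := by
    rw [h.theta_eq, mul_one_div, div_lt_div_iff₀ (by positivity) hM]
    linarith
  calc θ * b + √(C * p) * b / n + √(C * p) * ((2 * c ^ 2 + 5 / 2 * ρ) * b)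
        + 9 / 2 * ρ * √n * b + θ * b
      = (2 * θ + √(C * p) / n + √(C * p) * (2 * c ^ 2 + 5 / 2 * ρ) + 9 / 2 * ρ * √n) * b := by ring
    _ ≤ (3 * θ) * b := by
        gcongr
        linarith
    _ < 1 / M * b := by gcongr
    _ = b / M := by ring

end IsSmall

/-! ### From the deterministic and probabilistic bounds to proliferation -/

theorem GoodSample.proliferation {X : Type*} [MeasurableSpace X] {μ : Measure X}
    {H : Type*} [NormedAddCommGroup H] [InnerProductSpace ℝ H] [CompleteSpace H] [RKHS ℝ H X ℝ]
    {S : EigenSystem (ker H) μ} {p : ℕ} {η : Lp ℝ 2 μ} {αL αU c C M θ b : ℝ} {n : ℕ}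
    {x : Fin n → X} {y : Fin n → ℝ} (h : GoodSample S p η αL αU c M x)
    (hH : ∀ f : H, MemLp (fun x => f x) 2 μ) (hp : (p : ℕ∞) ≤ S.N)
    (hl : ∀ ℓ < p, 0 < S.lam ℓ) (hL : 0 < αL) (hc : c ≤ 1 / 2)
    (hs : IsSmall C M θ p n b ((αU - αL) / (αU + αL)) c) (hy : ∀ i, y i = 1 ∨ y i = -1)
    {f k : EuclideanSpace ℝ (Fin p)}
    (hk : k = f - diagMap (S.survivalFactor p n (harmonicMean αL αU)) f) (hkb : ‖k‖ ≤ b)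
    (hu : ∀ i, ‖feature S.v p (x i)‖ ≤ √(C * p))
    (hsurv : ∀ i, b ≤ M * (1 - |inner ℝ (diagMap (S.survivalFactor p n (harmonicMean αL αU)) f)
      (feature S.v p (x i))|))
    (hcov : ∀ i, |∑ j ∈ Finset.univ.erase i,
          (inner ℝ (diagMap (S.survivalFactor p n (harmonicMean αL αU)) (feature S.v p (x i)))
              (feature S.v p (x j)) * inner ℝ k (feature S.v p (x j))
            - inner ℝ (diagMap (S.survivalFactor p n (harmonicMean αL αU))
              (feature S.v p (x i))) k)| ≤ n * (θ * b))
    (hnoise : ∀ i, |∑ j, looWeight H x i j * (y j - inner ℝ f (feature S.v p (x j)))| ≤ θ * b) :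
    Proliferation H x y := by
  refine proliferation_of_looWeight hy
    (isUnit_kerMatrix hH hp hl hL (le_norm_sum_residual h.gram_lower))
    (fun i => isUnit_kerMatrix hH hp hl hL fun w => (h.gram_bounds i w).1) fun i => ?_
  have h1 := h.abs_looWeight_signal_sub_le hH hp hl hL hc i hk
  have h2 := hnoise i
  have h3 := hs.error_lt
  have hn := hs.n_pos
  have hρ := hs.rho_nonneg
  set ρ := (αU - αL) / (αU + αL) with hρdef
  set s := inner ℝ (diagMap (S.survivalFactor p n (harmonicMean αL αU)) f)
    (feature S.v p (x i)) with hsdef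
  have h4 : |∑ j, looWeight H x i j * inner ℝ f (feature S.v p (x j)) - s|
      ≤ θ * b + √(C * p) * b / n + √(C * p) * ((2 * c ^ 2 + 5 / 2 * ρ) * b)
        + 9 / 2 * ρ * √n * b := by
    refine h1.trans ?_
    have hui := hu i
    have h5 := (div_le_iff₀' hn).2 (hcov i)
    have hb := hs.b_pos.le
    gcongr
  have hM := hs.M_pos
  -- The room below one left by the idealized recovered signal, which `hs.error_lt` shows exceeds
  -- all errors.
  have h6 : b / M ≤ 1 - |s| := (div_le_iff₀' hM).2 (hsurv i)
  have h7 : ∑ j, looWeight H x i j * y j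
      = s + (∑ j, looWeight H x i j * inner ℝ f (feature S.v p (x j)) - s)
        + ∑ j, looWeight H x i j * (y j - inner ℝ f (feature S.v p (x j))) := by
    simp only [mul_sub, Finset.sum_sub_distrib]
    ring
  have h8 : |∑ j, looWeight H x i j * y j| < 1 := by
    rw [h7]
    refine lt_of_le_of_lt (abs_add_three _ _ _) ?_
    linarith
  have h9 := abs_lt.1 h8
  rcases hy i with h | h <;> rw [h] <;> linarith

/-- Only monotonicity and subadditivity enter, so none of the events has to be measurable. -/
theorem measureReal_le_add_of_inter_subset {Ω : Type*} [MeasurableSpace Ω] {P : Measure Ω}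
    [IsProbabilityMeasure P] {E B F : Set Ω} (h : ∀ ω ∈ E, ω ∉ B → ω ∈ F) {r : ℝ} (hr : 0 ≤ r)
    (hB : P B ≤ ENNReal.ofReal r) : P.real E - r ≤ P.real F := by
  have h1 : E ⊆ F ∪ B := fun ω hω => by
    by_cases hb : ω ∈ B
    · exact Or.inr hb
    · exact Or.inl (h ω hω hb)
  have h2 := (measureReal_mono (μ := P) h1).trans (measureReal_union_le F B)
  have h3 : P.real B ≤ r := ENNReal.toReal_le_of_le_ofReal hr hB
  linarith

end SVP

theorem theorem1 (C M : ℝ) (hC : 1 ≤ C) (hM : 0 < M) :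
    ∃ c₀ : ℝ, 0 < c₀ ∧
      ∀ (X : Type*) [MeasurableSpace X] (μ : MeasureTheory.Measure X)
        [MeasureTheory.IsProbabilityMeasure μ]
        (H : Type*) [NormedAddCommGroup H] [InnerProductSpace ℝ H] [CompleteSpace H]
        [RKHS ℝ H X ℝ]
        (_ : Measurable fun q : X × X => SVP.ker H q.1 q.2)
        (_ : ∀ f : H, MeasureTheory.MemLp (fun x => f x) 2 μ)
        (S : SVP.EigenSystem (SVP.ker H) μ) (p : ℕ) (_ : (p : ℕ∞) ≤ S.N)
        (_ : ∀ ℓ < p, 0 < S.lam ℓ)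
        (_ : ∀ᵐ x ∂μ, ∑ ℓ ∈ Finset.range p, S.v ℓ x ^ 2 ≤ C * p)
        (η : MeasureTheory.Lp ℝ 2 μ) (_ : η ∈ S.G p)
        (Ω : Type*) [MeasurableSpace Ω] (P : MeasureTheory.Measure Ω)
        [MeasureTheory.IsProbabilityMeasure P]
        (n : ℕ) (_ : 0 < n) (x : Fin n → Ω → X) (y : Fin n → Ω → ℝ)
        (_ : SVP.IsLabelledSample μ η P x y)
        (δ αL αU c b : ℝ) (_ : 0 < δ) (_ : δ < 1 / 2) (_ : 0 < αL) (_ : 0 < αU) (_ : c ≤ 1 / 2)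
        (_ : 1 - δ ≤ P.real {ω | SVP.GoodSample S p η αL αU c M fun i => x i ω})
        (_ : b = SVP.supNorm (S.bias p n (SVP.harmonicMean αL αU) η)) (_ : 0 < b)
        (_ : 1 / b * √(p * Real.log n / n)
          + (αU - αL) / (αU + αL) * (√(Real.log n) / b + √n) + c ^ 2 * √p ≤ c₀),
        1 - δ - 2 / n ≤ P.real {ω | SVP.Proliferation H (fun i => x i ω) (fun i => y i ω)} := by
  set θ : ℝ := 1 / (8 * (1 + M)) with hθ
  have hC0 : 0 < C := zero_lt_one.trans_le hC
  refine ⟨θ / (100 * C * (1 + M)), by positivity, ?_⟩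
  intro X _ μ _ H _ _ _ _ hker hH S p hp hl hbos η hη Ω _ P _ n hn x y hxy δ αL αU c b hδ hδ2 hL hU
    hc hgood hb hb0 hsmall
  have hn0 : (0 : ℝ) < n := by exact_mod_cast hn
  -- For `n ≤ 2` the claimed probability is not positive; for `n ≥ 3 > e` one has `log n ≥ 1`.
  by_cases hn3 : n < 3
  · have h1 : (1 : ℝ) ≤ 2 / n := by
      rw [le_div_iff₀ hn0, one_mul]
      exact_mod_cast (by omega : n ≤ 2)
    have h2 : 0 ≤ P.real {ω | SVP.Proliferation H (fun i => x i ω) (fun i => y i ω)} :=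
      measureReal_nonneg
    linarith
  have hlog : 1 ≤ Real.log n := by
    rw [Real.le_log_iff_exp_le hn0]
    have h1 : (3 : ℝ) ≤ n := by exact_mod_cast not_lt.1 hn3
    linarith [Real.exp_one_lt_d9]
  obtain ⟨f, rfl⟩ := S.exists_eq_synth hη
  set m := SVP.harmonicMean αL αU with hm
  have hm0 : 0 < m := by
    rw [hm, SVP.harmonicMean]; positivity
  set T := SVP.diagMap (S.survivalFactor p n m) with hT
  set k := f - T f with hk
  set η := SVP.synth (fun ℓ : Fin p => S.vL ℓ) f with hηdef
  rw [S.bias_synth hH hp hl n hm0 f] at hb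
  -- For `p = 0` the space `G` is trivial and `b` would vanish.
  have hp1 : 1 ≤ p := by
    by_contra h0
    obtain rfl : p = 0 := by omega
    rw [show f - SVP.diagMap (S.survivalFactor 0 n m) f = 0 from Subsingleton.elim _ _, map_zero,
      SVP.supNorm] at hb
    have h1 : eLpNorm ((0 : Lp ℝ 2 μ) : X → ℝ) ∞ μ = 0 := by
      rw [eLpNorm_congr_ae (Lp.coeFn_zero ℝ 2 μ), eLpNorm_zero]
    rw [h1, ENNReal.toReal_zero] at hb
    exact hb0.ne' hb
  -- The good event has positive probability, so one sample in it supplies the facts that do not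
  -- depend on the sample: `αL ≤ αU` and the signal bound.
  obtain ⟨ω₀, hω₀⟩ : {ω | SVP.GoodSample S p η αL αU c M fun i => x i ω}.Nonempty := by
    rw [Set.nonempty_iff_ne_empty]
    intro h0
    rw [h0, measureReal_empty] at hgood
    linarith
  have hsig := hω₀.signal
  rw [S.bias_synth hH hp hl n hm0 f, S.survival_synth hH hp hl n hm0 f, ← hb, ← hT] at hsig
  have hsmall' : SVP.IsSmall C M θ p n b ((αU - αL) / (αU + αL)) c := by
    refine ⟨hC, hM, hθ, by exact_mod_cast hp1, hn0, hlog, hb0, ?_, ?_, hsmall⟩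
    · have h1 : 0 ≤ SVP.supNorm (SVP.synth (fun ℓ : Fin p => S.vL ℓ) (T f)) :=
        ENNReal.toReal_nonneg
      nlinarith
    · exact div_nonneg (sub_nonneg.2 (hω₀.le ⟨0, hn⟩)) (by positivity)
  set B := √(C * p) with hB
  have hp0 : (0 : ℝ) < p := by exact_mod_cast hp1
  have hB0 : 0 < B := Real.sqrt_pos.2 (by positivity)
  have hfeat : ∀ᵐ t ∂μ, ‖SVP.feature S.v p t‖ ≤ B := by
    filter_upwards [hbos] with t ht
    rw [← SVP.norm_feature_sq] at ht
    exact Real.le_sqrt_of_sq_le ht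
  have hkae := S.abs_inner_feature_le_supNorm hfeat k
  rw [← hb] at hkae
  have hTae := S.abs_inner_feature_le_supNorm hfeat (T f)
  have hkb : ‖k‖ ≤ b := S.norm_le_of_abs_inner_feature_le hp hb0.le hkae
  have hηm : Measurable (η : X → ℝ) := (Lp.stronglyMeasurable η).measurable
  have hv : ∀ ℓ < p, Measurable (S.v ℓ) := fun ℓ hℓ =>
    S.measurable_v hker (lt_of_lt_of_le (by exact_mod_cast hℓ) hp) (hl ℓ hℓ)
  have hTn : ∀ g, ‖T g‖ ≤ ‖g‖ := SVP.norm_diagMap_le fun ℓ => by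
    have := hl ℓ ℓ.2
    rw [SVP.EigenSystem.survivalFactor, abs_of_nonneg (by positivity), div_le_one (by positivity)]
    linarith
  have hnull : P {ω | ¬ ∀ i, ‖SVP.feature S.v p (x i ω)‖ ≤ B ∧
      |inner ℝ (T f) (SVP.feature S.v p (x i ω))|
        ≤ SVP.supNorm (SVP.synth (fun ℓ : Fin p => S.vL ℓ) (T f)) ∧
      η (x i ω) = inner ℝ f (SVP.feature S.v p (x i ω))} = 0 := by
    refine ae_iff.1 (ae_all_iff.2 fun i => ?_)
    have h1 : ∀ᵐ t ∂P.map (x i), ‖SVP.feature S.v p t‖ ≤ B ∧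
        |inner ℝ (T f) (SVP.feature S.v p t)|
          ≤ SVP.supNorm (SVP.synth (fun ℓ : Fin p => S.vL ℓ) (T f)) ∧
        η t = inner ℝ f (SVP.feature S.v p t) := by
      rw [hxy.law_x i]
      filter_upwards [hfeat, hTae, S.coeFn_synth f] with t e1 e2 e3
      exact ⟨e1, e2, e3⟩
    exact ae_of_ae_map (hxy.measurable_x i).aemeasurable h1
  have hbad1 : ∀ i, P {ω | ‖SVP.feature S.v p (x i ω)‖ ≤ B ∧ n * (θ * b) ≤
      |∑ j ∈ Finset.univ.erase i,
        (inner ℝ (T (SVP.feature S.v p (x i ω))) (SVP.feature S.v p (x j ω))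
          * inner ℝ k (SVP.feature S.v p (x j ω))
          - inner ℝ (T (SVP.feature S.v p (x i ω))) k)|} ≤ ENNReal.ofReal (1 / (n : ℝ) ^ 2) := by
    intro i
    have h1 := S.measure_covariance_ge_le hp hv hB0 hb0 hsmall'.theta_pos hsmall'.theta_le hfeat
      hkae hTn i
    rw [← hxy.map_x] at h1
    refine ((Measure.le_map_apply
      (measurable_pi_lambda _ hxy.measurable_x).aemeasurable _).trans h1).trans ?_
    rw [← ENNReal.ofReal_ofNat 2, ← ENNReal.ofReal_mul (by norm_num)]
    exact ENNReal.ofReal_le_ofReal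
      (SVP.two_mul_exp_neg_le (by omega) hsmall'.pair_exponent_le)
  set L := 4 / √n * B + 2 * ((αU - αL) / (αU + αL)) with hLdef
  have hL0 : 0 < L := by
    have := hsmall'.rho_nonneg
    positivity
  -- The sub-Gaussian tail requires a weight bound for all positions, while `norm_looWeight_le`
  -- holds on good samples only. The weights are therefore cut off at norm `L`, which changes
  -- nothing on a good sample whose features are bounded by `B`.
  have hbad2 : ∀ i, P {ω | θ * b ≤ |∑ j, (if ‖SVP.looWeight H (fun l => x l ω) i‖ ≤ L then
      SVP.looWeight H (fun l => x l ω) i j else 0) * (y j ω - η (x j ω))|}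
        ≤ ENNReal.ofReal (1 / (n : ℝ) ^ 2) := by
    intro i
    have hw : ∀ j, Measurable fun z : Fin n → X => SVP.looWeight H z i j := fun j =>
      SVP.measurable_looWeight hker i j
    have hw2 : Measurable fun z : Fin n → X => ‖SVP.looWeight H z i‖ := by
      simp only [EuclideanSpace.norm_eq]
      exact (Finset.measurable_fun_sum _ fun j _ => (hw j).norm.pow_const 2).sqrt
    refine (hxy.measure_abs_noise_ge_le hηm i
      (a := fun j z => if ‖SVP.looWeight H z i‖ ≤ L then SVP.looWeight H z i j else 0)
      (fun j => Measurable.ite (measurableSet_le hw2 measurable_const) (hw j) measurable_const)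
      hL0 (fun z => ?_) (mul_pos hsmall'.theta_pos hb0).le).trans ?_
    · by_cases hz : ‖SVP.looWeight H z i‖ ≤ L
      · simp only [if_pos hz]
        have h1 : ‖SVP.looWeight H z i‖ ^ 2 ≤ L ^ 2 := by gcongr
        rw [EuclideanSpace.norm_sq_eq] at h1
        simpa using h1
      · simp only [if_neg hz]
        simp
        positivity
    · rw [← ENNReal.ofReal_ofNat 2, ← ENNReal.ofReal_mul (by norm_num)]
      exact ENNReal.ofReal_le_ofReal
        (SVP.two_mul_exp_neg_le (by omega) hsmall'.noise_exponent_le)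
  have hbad : P ({ω | ¬ ∀ i, ‖SVP.feature S.v p (x i ω)‖ ≤ B ∧
      |inner ℝ (T f) (SVP.feature S.v p (x i ω))|
        ≤ SVP.supNorm (SVP.synth (fun ℓ : Fin p => S.vL ℓ) (T f)) ∧
      η (x i ω) = inner ℝ f (SVP.feature S.v p (x i ω))} ∪
      ((⋃ i, {ω | ‖SVP.feature S.v p (x i ω)‖ ≤ B ∧ n * (θ * b) ≤
      |∑ j ∈ Finset.univ.erase i,
        (inner ℝ (T (SVP.feature S.v p (x i ω))) (SVP.feature S.v p (x j ω))
          * inner ℝ k (SVP.feature S.v p (x j ω))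
          - inner ℝ (T (SVP.feature S.v p (x i ω))) k)|}) ∪
      ⋃ i, {ω | θ * b ≤ |∑ j, (if ‖SVP.looWeight H (fun l => x l ω) i‖ ≤ L then
      SVP.looWeight H (fun l => x l ω) i j else 0) * (y j ω - η (x j ω))|}))
      ≤ ENNReal.ofReal (2 / n) := by
    have hsum : ∑ _i : Fin n, ENNReal.ofReal (1 / (n : ℝ) ^ 2) = ENNReal.ofReal (1 / n) := by
      rw [Finset.sum_const, Finset.card_univ, Fintype.card_fin, ← ENNReal.ofReal_nsmul]
      congr 1
      rw [nsmul_eq_mul]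
      field_simp
    have h1 := (measure_iUnion_fintype_le P _).trans ((Finset.sum_le_sum fun i _ => hbad1 i).trans
      hsum.le)
    have h2 := (measure_iUnion_fintype_le P _).trans ((Finset.sum_le_sum fun i _ => hbad2 i).trans
      hsum.le)
    refine (measure_union_le _ _).trans ?_
    rw [hnull, zero_add]
    refine (measure_union_le _ _).trans ((add_le_add h1 h2).trans ?_)
    rw [← ENNReal.ofReal_add (by positivity) (by positivity)]
    refine ENNReal.ofReal_le_ofReal (le_of_eq ?_)
    ring
  refine le_trans (sub_le_sub_right hgood _)
    (SVP.measureReal_le_add_of_inter_subset (fun ω hω hnot => ?_) (by positivity) hbad)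
  simp only [Set.mem_union, Set.mem_iUnion, Set.mem_ofPred_eq, not_or, not_exists, not_not,
    not_and, not_le] at hnot
  obtain ⟨ha, hb1, hb2⟩ := hnot
  refine SVP.GoodSample.proliferation hω hH hp hl hL hc hsmall' (fun i => hxy.labels i ω) hk hkb
    (fun i => (ha i).1) (fun i => hsig.trans ?_) (fun i => (hb1 i (ha i).1).le) fun i => ?_
  · have := (ha i).2.1
    gcongr
  · have h1 : ‖SVP.looWeight H (fun l => x l ω) i‖ ≤ L := by
      refine (SVP.GoodSample.norm_looWeight_le hω hH hp hl hL hc i).trans ?_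
      have := (ha i).1
      rw [hLdef]
      gcongr
    have h2 := hb2 i
    simp only [if_pos h1] at h2
    refine le_trans (le_of_eq ?_) h2.le
    congr 1
    exact Finset.sum_congr rfl fun j _ => by rw [(ha j).2.2]
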